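/- Let $g\ge 2$ be even, let $p\ge 1$ be odd, and put $n=2g+p-1$. Let $\Sigma$ be an oriented surface of genus $g$ with $p$ punctures and a basepoint, and let $\psi\colon R_n\to\Sigma$ be a marking, i.e. a basepoint preserving homotopy equivalence from the rose $R_n$ with one vertex and $n$ edges. All maps and homotopies preserve basepoints. Recall the following notions. * A marked graph $(\Gamma,\phi)$ is a finite connected graph $\Gamma$ with a basepoint, without separating edges, whose basepoint has valence at least $2$ and whose other vertices have valence at least $3$, together with a homotopy equivalence $\phi\colon R_n\to\Gamma$. Two marked graphs $(\Gamma_1,\phi_1)$, $(\Gamma_2,\phi_2)$ are equivalent if there is a graph isomorphism $h\colon\Gamma_1\to\Gamma_2$ with $h\circ\phi_1\simeq\phi_2$. The degree of $\Gamma$ is the sum of $|x|-2$ over all vertices $x$ other than the basepoint, where $|x|$ is the valence of $x$. * A ribbon structure $O$ on $\Gamma$ is a cyclic ordering of the half edges at each vertex. The ribbon surface $|\Gamma,O|\supset\Gamma$ is the oriented surface obtained from $\Gamma$ by gluing a once punctured disk along each boundary cycle, that is, along each cyclic sequence of directed edges in which every directed edge, on arriving at its terminal vertex $v$, is followed by the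 next half edge in the cyclic order at $v$. The marked graph $(\Gamma,\phi)$ can be drawn in $(\Sigma,\psi)$ if for some ribbon structure $O$ there is an orientation preserving homeomorphism $h\colon|\Gamma,O|\to\Sigma$ with $h\circ i\circ\phi\simeq\psi$, where $i\colon\Gamma\to|\Gamma,O|$ is the inclusion. * The vertices of the degree $2$ complex $S\mathbb T_{\Sigma,2}$ are the equivalence classes of marked graphs of degree at most $2$ that can be drawn in $(\Sigma,\psi)$. * The group $MCG_*(\Sigma)$ of orientation preserving homeomorphisms of $\Sigma$ fixing the basepoint (punctures may be permuted), modulo isotopies fixing the basepoint, acts on $S\mathbb T_{\Sigma,2}$ from the right by $(\Gamma,\phi)\cdot f=(\Gamma,\phi\circ\alpha)$, where $\alpha\colon R_n\to R_n$ is the homotopy equivalence with $\psi\circ\alpha\simeq f\circ\psi$. The vertices of the quotient $S\mathbb T_{\Sigma,2}/MCG_*(\Sigma)$ are the orbits of the vertices of $S\mathbb T_{\Sigma,2}$. Proposition. The quotient $S\mathbb T_{\Sigma,2}/MCG_*(\Sigma)$ has at least $2^{(p-1)/2+g/2+1}$ vertices. -/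

import Mathlib

open CategoryTheory

noncomputable section

namespace RibbonComplex

/-! ### Pointed spaces and pointed homotopy classes of maps -/

/-- A topological space with a basepoint. -/
structure PtdSpace : Type 1 where
  carrier : Type
  [top : TopologicalSpace carrier]
  pt : carrier

attribute [instance] PtdSpace.top

/-- Basepoint preserving continuous maps. -/
@[ext]
structure PtdMap (X Y : PtdSpace) where
  map : C(X.carrier, Y.carrier)
  map_pt : map X.pt = Y.pt

/-- Basepoint preserving homotopy of basepoint preserving maps. -/
instance PtdMap.setoid (X Y : PtdSpace) : Setoid (PtdMap X Y) where
  r f g := f.map.HomotopicRel g.map {X.pt}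
  iseqv := ⟨fun f => .refl f.map, fun h => h.symm, fun h k => h.trans k⟩

def PtdMap.id (X : PtdSpace) : PtdMap X X := ⟨.id _, rfl⟩

/-- Composition, in diagrammatic order. -/
def PtdMap.comp {X Y Z : PtdSpace} (f : PtdMap X Y) (g : PtdMap Y Z) : PtdMap X Z :=
  ⟨g.map.comp f.map, by simp [f.map_pt, g.map_pt]⟩

theorem PtdMap.comp_congr {X Y Z : PtdSpace} {f f' : PtdMap X Y} {g g' : PtdMap Y Z}
    (hf : f ≈ f') (hg : g ≈ g') : f.comp g ≈ f'.comp g' := by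
  obtain ⟨F⟩ := hf
  obtain ⟨G⟩ := hg
  refine ⟨⟨G.toHomotopy.comp F.toHomotopy, ?_⟩⟩
  intro t x hx
  rw [Set.mem_singleton_iff] at hx
  subst hx
  have h1 : F (t, X.pt) = Y.pt := (F.eq_fst t rfl).trans f.map_pt
  have h2 : G (t, Y.pt) = g.map Y.pt := G.eq_fst t rfl
  change G (t, F (t, X.pt)) = g.map (f.map X.pt)
  rw [h1, h2, f.map_pt]

/-- The pointed homotopy category: morphisms are pointed homotopy classes of pointed maps, so that
isomorphisms are exactly (classes of) pointed homotopy equivalences. -/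
instance : Category PtdSpace where
  Hom X Y := Quotient (PtdMap.setoid X Y)
  id X := ⟦PtdMap.id X⟧
  comp f g := Quotient.map₂ PtdMap.comp (fun _ _ hf _ _ hg => PtdMap.comp_congr hf hg) f g
  id_comp f := by
    induction f using Quotient.inductionOn
    rfl
  comp_id f := by
    induction f using Quotient.inductionOn
    rfl
  assoc f g h := by
    induction f using Quotient.inductionOn
    induction g using Quotient.inductionOn
    induction h using Quotient.inductionOn
    rfl

/-- The pointed homotopy class of a pointed map. -/
def PtdMap.cls {X Y : PtdSpace} (f : PtdMap X Y) : X ⟶ Y := (⟦f⟧ : Quotient (PtdMap.setoid X Y))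

theorem PtdMap.cls_comp {X Y Z : PtdSpace} (f : PtdMap X Y) (g : PtdMap Y Z) :
    (f.comp g).cls = f.cls ≫ g.cls := rfl

theorem PtdMap.cls_id (X : PtdSpace) : (PtdMap.id X).cls = 𝟙 X := rfl

theorem PtdMap.cls_eq {X Y : PtdSpace} {f g : PtdMap X Y}
    (h : f.map.HomotopicRel g.map {X.pt}) : f.cls = g.cls := Quotient.sound h

/-! ### Graphs -/

/-- A finite graph with a basepoint, loops and multiple edges allowed. Every edge is recorded as
the pair `d`, `rev d` of its two orientations; the directed edge `d` is also identified with the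
half edge at its initial vertex `src d`. -/
structure Graph : Type 1 where
  V : Type
  D : Type
  [finV : Fintype V]
  [finD : Fintype D]
  rev : D → D
  rev_rev : ∀ d, rev (rev d) = d
  rev_ne : ∀ d, rev d ≠ d
  src : D → V
  base : V

attribute [instance] Graph.finV Graph.finD

namespace Graph

/-- Any two vertices are joined by a path of directed edges from the set `A`. -/
def ConnectedVia (G : Graph) (A : Set G.D) : Prop :=
  ∀ v w : G.V, Relation.ReflTransGen
    (fun a b => ∃ d ∈ A, G.src d = a ∧ G.src (G.rev d) = b) v w

def Connected (G : Graph) : Prop := G.ConnectedVia Set.univ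

/-- The edge `{d, rev d}` separates the (connected) graph if removing it disconnects the graph. -/
def IsSeparating (G : Graph) (d : G.D) : Prop :=
  ¬ G.ConnectedVia {x | x ≠ d ∧ x ≠ G.rev d}

/-- The number of half edges at a vertex. -/
def valence (G : Graph) (v : G.V) : ℕ := Nat.card {d : G.D // G.src d = v}

open Classical in
/-- The sum of `|x| - 2` over all vertices `x` other than the basepoint. -/
def degree (G : Graph) : ℤ :=
  ∑ x ∈ Finset.univ.filter (fun x : G.V => x ≠ G.base), ((G.valence x : ℤ) - 2)

/-- The graphs allowed in (the spine of) Auter space. -/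
structure Admissible (G : Graph) : Prop where
  connected : G.Connected
  valence_ge : ∀ v, v ≠ G.base → 3 ≤ G.valence v
  valence_base : 2 ≤ G.valence G.base
  not_separating : ∀ d, ¬ G.IsSeparating d

/-- The graph with one vertex whose edges are indexed by `E`; the edge `e` has the initial half
edge `(e, true)` and the terminal half edge `(e, false)`. -/
def rose (E : Type) [Fintype E] : Graph where
  V := Unit
  D := E × Bool
  rev d := (d.1, !d.2)
  rev_rev d := by simp
  rev_ne d := by
    intro h
    have := congrArg Prod.snd h
    simp at this
  src _ := ()
  base := ()

/-- Vertices form a discrete space. -/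
instance (G : Graph) : TopologicalSpace G.V := ⊥

instance (G : Graph) : DiscreteTopology G.V := ⟨rfl⟩

/-- The pieces from which the topological realization of a graph is glued: its vertices and a unit
interval for each directed edge. -/
abbrev Piece (G : Graph) : Type := G.V ⊕ (Σ _ : G.D, unitInterval)

/-- The interval of a directed edge starts at its initial vertex, and the intervals of the two
orientations of an edge are the same interval read backwards. -/
inductive Glue (G : Graph) : G.Piece → G.Piece → Prop
  | start (d : G.D) : Glue G (.inr ⟨d, 0⟩) (.inl (G.src d))
  | flip (d : G.D) (t : unitInterval) :
      Glue G (.inr ⟨d, t⟩) (.inr ⟨G.rev d, unitInterval.symm t⟩)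

/-- The topological realization of a graph, as a pointed space. -/
def space (G : Graph) : PtdSpace where
  carrier := Quot G.Glue
  pt := Quot.mk _ (.inl G.base)

/-- Isomorphisms of graphs with basepoint. -/
structure GIso (G H : Graph) where
  onV : G.V ≃ H.V
  onD : G.D ≃ H.D
  onD_rev : ∀ d, onD (G.rev d) = H.rev (onD d)
  onV_src : ∀ d, onV (G.src d) = H.src (onD d)
  onV_base : onV G.base = H.base

namespace GIso

def refl (G : Graph) : GIso G G :=
  ⟨Equiv.refl _, Equiv.refl _, fun _ => rfl, fun _ => rfl, rfl⟩

def symm {G H : Graph} (h : GIso G H) : GIso H G where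
  onV := h.onV.symm
  onD := h.onD.symm
  onD_rev d := by rw [Equiv.symm_apply_eq, h.onD_rev, Equiv.apply_symm_apply]
  onV_src d := by rw [Equiv.symm_apply_eq, h.onV_src, Equiv.apply_symm_apply]
  onV_base := by rw [Equiv.symm_apply_eq, h.onV_base]

def trans {G H K : Graph} (h : GIso G H) (k : GIso H K) : GIso G K where
  onV := h.onV.trans k.onV
  onD := h.onD.trans k.onD
  onD_rev d := by simp [h.onD_rev, k.onD_rev]
  onV_src d := by simp [h.onV_src, k.onV_src]
  onV_base := by simp [h.onV_base, k.onV_base]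

def onPiece {G H : Graph} (h : GIso G H) : G.Piece → H.Piece :=
  Sum.map h.onV (Sigma.map h.onD fun _ t => t)

theorem continuous_onPiece {G H : Graph} (h : GIso G H) : Continuous h.onPiece :=
  Continuous.sumMap continuous_of_discreteTopology
    (Continuous.sigma_map fun _ => continuous_id)

/-- The homeomorphism of realizations given by a graph isomorphism, as a pointed map. -/
def map {G H : Graph} (h : GIso G H) : PtdMap G.space H.space where
  map :=
    { toFun := Quot.map h.onPiece (by
        rintro _ _ (d | ⟨d, t⟩)
        · change H.Glue (.inr ⟨h.onD d, 0⟩) (.inl (h.onV (G.src d)))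
          rw [h.onV_src]
          exact .start _
        · change H.Glue (.inr ⟨h.onD d, t⟩) (.inr ⟨h.onD (G.rev d), unitInterval.symm t⟩)
          rw [h.onD_rev]
          exact .flip _ _)
      continuous_toFun :=
        continuous_quot_lift _ (continuous_quot_mk.comp h.continuous_onPiece) }
  map_pt := congrArg (fun v => Quot.mk H.Glue (.inl v)) h.onV_base

theorem map_refl (G : Graph) : (refl G).map.cls = 𝟙 _ := by
  refine PtdMap.cls_eq (g := PtdMap.id G.space) ?_
  convert ContinuousMap.HomotopicRel.refl _ using 1
  ext x
  induction x using Quot.inductionOn with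
  | h x => rcases x with v | ⟨d, t⟩ <;> rfl

theorem map_trans {G H K : Graph} (h : GIso G H) (k : GIso H K) :
    (h.trans k).map.cls = h.map.cls ≫ k.map.cls := by
  rw [← PtdMap.cls_comp]
  refine PtdMap.cls_eq ?_
  convert ContinuousMap.HomotopicRel.refl _ using 1
  ext x
  induction x using Quot.inductionOn with
  | h x => rcases x with v | ⟨d, t⟩ <;> rfl

theorem map_symm {G H : Graph} (h : GIso G H) : h.map.cls ≫ h.symm.map.cls = 𝟙 _ := by
  rw [← map_trans, ← map_refl]
  congr 2
  simp [trans, symm, refl]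

end GIso

/-! ### Ribbon graphs and ribbon surfaces -/

/-- A ribbon structure: a cyclic ordering of the half edges at each vertex, given by the
permutation taking each half edge to its successor. -/
structure Ribbon (G : Graph) where
  succ : Equiv.Perm G.D
  src_succ : ∀ d, G.src (succ d) = G.src d
  cyclic : ∀ d e, G.src d = G.src e → succ.SameCycle d e

/-- The directed edge which follows `d` in its boundary cycle: having arrived along the half edge
`rev d`, leave along the successor of that half edge. -/
def Ribbon.next {G : Graph} (O : G.Ribbon) (d : G.D) : G.D := O.succ (G.rev d)

/-- The pieces from which a ribbon surface is glued: the vertices and, for each directed edge, a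
strip `[0,1] × [0,∞)`. -/
abbrev RPiece (G : Graph) : Type := G.V ⊕ (Σ _ : G.D, unitInterval × NNReal)

/-- The bottom sides of the strips are glued to each other as in the graph. The right side of the
strip of `d` is glued to the left side of the strip of the next directed edge in the boundary
cycle of `d`. The strips along a boundary cycle thus form `S¹ × [0,∞)`, a once punctured disk
whose boundary is attached to the graph along that cycle. -/
inductive RGlue (G : Graph) (O : G.Ribbon) : G.RPiece → G.RPiece → Prop
  | start (d : G.D) : RGlue G O (.inr ⟨d, (0, 0)⟩) (.inl (G.src d))
  | flip (d : G.D) (t : unitInterval) :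
      RGlue G O (.inr ⟨d, (t, 0)⟩) (.inr ⟨G.rev d, (unitInterval.symm t, 0)⟩)
  | side (d : G.D) (s : NNReal) :
      RGlue G O (.inr ⟨d, (1, s)⟩) (.inr ⟨O.next d, (0, s)⟩)

/-- The ribbon surface as a pointed space. -/
def ribbonSpace (G : Graph) (O : G.Ribbon) : PtdSpace where
  carrier := Quot (G.RGlue O)
  pt := Quot.mk _ (.inl G.base)

/-- The inclusion of a graph into its ribbon surface. -/
def inclusion (G : Graph) (O : G.Ribbon) : PtdMap G.space (G.ribbonSpace O) where
  map :=
    { toFun := Quot.map (Sum.map id (Sigma.map id fun _ t => (t, 0))) (by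
        rintro _ _ (d | ⟨d, t⟩)
        · exact .start d
        · exact .flip d t)
      continuous_toFun := by
        refine continuous_quot_lift _ (continuous_quot_mk.comp ?_)
        exact Continuous.sumMap continuous_id
          (Continuous.sigma_map fun _ => by fun_prop) }
  map_pt := rfl

/-- The point with coordinates `w = t + i s` in the strip of `d`; it is only used for
`0 < t < 1` and `0 < s`, where it is an open embedding. -/
def stripPoint (G : Graph) (O : G.Ribbon) (d : G.D) (w : ℂ) : (G.ribbonSpace O).carrier :=
  Quot.mk _ (.inr ⟨d, (Set.projIcc 0 1 zero_le_one w.re, w.im.toNNReal)⟩)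

end Graph

/-! ### Oriented surfaces -/

/-- A map of the plane, continuous and injective near `z`, preserves the orientation at `z`: it
takes small positively oriented circles around `z` to loops which wind once, in the positive
direction, around the image of `z`. -/
def PreservesOrientationAt (c : ℂ → ℂ) (z : ℂ) : Prop :=
  ∃ r₀ : ℝ, 0 < r₀ ∧ ∀ r : ℝ, 0 < r → r < r₀ →
    ∃ H : C(unitInterval × Circle, ℂ), (∀ x, H x ≠ 0) ∧
      ∀ u : Circle, H (0, u) = c (z + r * u) - c z ∧ H (1, u) = u

/-- A pointed space together with a set of open embeddings of the plane, thought of as the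
positively oriented ones. -/
structure OrientedSpace : Type 1 where
  space : PtdSpace
  positive : Set (ℂ → space.carrier)

/-- The ribbon surface `|Γ, O|` with its orientation: an open embedding of the plane is positive if
its coordinate expressions in the open strips preserve the orientation. (The gluing maps of the
strips are orientation preserving. The strip of `d` lies on the left of `d`, so the cyclic orders
`O` are clockwise.) -/
def Graph.ribbonSurface (G : Graph) (O : G.Ribbon) : OrientedSpace where
  space := G.ribbonSpace O
  positive := {e | Topology.IsOpenEmbedding e ∧
    ∀ (d : G.D) (c : ℂ → ℂ) (z : ℂ) (ε : ℝ), 0 < ε →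
      (∀ w ∈ Metric.ball z ε, 0 < (c w).re ∧ (c w).re < 1 ∧ 0 < (c w).im ∧
        G.stripPoint O d (c w) = e w) →
      PreservesOrientationAt c z}

/-- Orientation preserving and basepoint preserving homeomorphisms. -/
structure IsOriented (S T : OrientedSpace) (h : S.space.carrier ≃ₜ T.space.carrier) : Prop where
  map_pt : h S.space.pt = T.space.pt
  positive_iff : ∀ e, e ∈ S.positive ↔ h ∘ e ∈ T.positive

/-- The homotopy class of a homeomorphism. -/
def IsOriented.cls {S T : OrientedSpace} {h : S.space.carrier ≃ₜ T.space.carrier}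
    (hh : IsOriented S T h) : S.space ⟶ T.space :=
  PtdMap.cls ⟨⟨h, h.continuous⟩, hh.map_pt⟩

/-- The edges of the standard rose in a surface of genus `g` with `p ≥ 1` punctures: a loop around
each of `p - 1` punctures, and two loops for each handle. -/
abbrev StdEdge (g p : ℕ) : Type := Fin (p - 1) ⊕ (Fin g ⊕ Fin g)

/-- The half edges of the standard rose, listed in their cyclic order: first the blocks
`aⱼⁱ, aⱼᵗ` for the `p - 1` loops `aⱼ`, then the blocks `xₖⁱ, yₖⁱ, xₖᵗ, yₖᵗ` for the `g`
pairs of loops `xₖ, yₖ`. -/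
def stdList (g p : ℕ) : List (StdEdge g p × Bool) :=
  (List.finRange (p - 1)).flatMap (fun j => [(.inl j, true), (.inl j, false)]) ++
  (List.finRange g).flatMap (fun k =>
    [(.inr (.inl k), true), (.inr (.inr k), true), (.inr (.inl k), false), (.inr (.inr k), false)])

theorem mem_stdList {g p : ℕ} (d : StdEdge g p × Bool) : d ∈ stdList g p := by
  rcases d with ⟨j | k | k, _ | _⟩ <;> simp [stdList]

theorem nodup_stdList (g p : ℕ) : (stdList g p).Nodup := by
  unfold stdList
  rw [List.nodup_append]
  refine ⟨?_, ?_, ?_⟩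
  · rw [List.nodup_flatMap]
    refine ⟨by simp, (List.nodup_finRange _).imp ?_⟩
    intro a b hab
    simp [Function.onFun, List.disjoint_left, hab]
  · rw [List.nodup_flatMap]
    refine ⟨by simp, (List.nodup_finRange _).imp ?_⟩
    intro a b hab
    simp [Function.onFun, List.disjoint_left, hab]
  · intro a ha b hb
    simp only [List.mem_flatMap, List.mem_finRange, true_and] at ha hb
    obtain ⟨j, hj⟩ := ha
    obtain ⟨k, hk⟩ := hb
    rintro rfl
    simp only [List.mem_cons, List.not_mem_nil, or_false] at hj hk
    rcases hj with rfl | rfl <;> simp at hk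

/-- The standard ribbon structure, with `p` boundary cycles. -/
def stdRibbon (g p : ℕ) : (Graph.rose (StdEdge g p)).Ribbon where
  succ := (stdList g p).formPerm
  src_succ _ := rfl
  cyclic d e _ := by
    by_cases hde : d = e
    · subst hde
      exact Equiv.Perm.SameCycle.refl _ _
    · have h2 : 2 ≤ (stdList g p).length := by
        by_contra hlt
        have h1 : ∀ x : StdEdge g p × Bool, x ∈ stdList g p := mem_stdList
        rcases hl : stdList g p with _ | ⟨a, _ | ⟨b, l⟩⟩
        · rw [hl] at h1
          exact absurd (h1 d) List.not_mem_nil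
        · rw [hl] at h1
          exact hde ((List.mem_singleton.1 (h1 d)).trans (List.mem_singleton.1 (h1 e)).symm)
        · simp [hl] at hlt
      have hc := List.isCycle_formPerm (nodup_stdList g p) h2
      have hne : ∀ x, (stdList g p).formPerm x ≠ x := fun x =>
        (List.formPerm_apply_mem_ne_self_iff _ (nodup_stdList g p) x (mem_stdList x)).2 h2
      exact hc.sameCycle (hne d) (hne e)

/-- The standard oriented surface of genus `g` with `p ≥ 1` punctures, with a basepoint: a disk
with bands attached along its boundary, extended by a puncture at each of the `p` boundary
components; the Euler characteristic is `1 - (2 g + p - 1) = 2 - 2 g - p`. -/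
def stdSurface (g p : ℕ) : OrientedSpace := (Graph.rose (StdEdge g p)).ribbonSurface (stdRibbon g p)

/-- `S` is a (pointed, oriented) surface of genus `g` with `p` punctures. -/
def IsSurface (g p : ℕ) (S : OrientedSpace) : Prop := ∃ h, IsOriented S (stdSurface g p) h

/-! ### The mapping class group -/

/-- The group of orientation preserving, basepoint preserving self-homeomorphisms. -/
def HomeoPlus (S : OrientedSpace) : Subgroup (S.space.carrier ≃ₜ S.space.carrier) where
  carrier := {h | IsOriented S S h}
  one_mem' := ⟨rfl, fun _ => Iff.rfl⟩
  mul_mem' {f k} hf hk := ⟨(congrArg f hk.map_pt).trans hf.map_pt, fun e =>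
    (hk.positive_iff e).trans (hf.positive_iff (k ∘ e))⟩
  inv_mem' {f} hf := by
    refine ⟨?_, fun e => ?_⟩
    · change f.symm S.space.pt = S.space.pt
      rw [Homeomorph.symm_apply_eq, hf.map_pt]
    · rw [hf.positive_iff (⇑f⁻¹ ∘ e)]
      have : ⇑f ∘ ⇑f⁻¹ ∘ e = e := by
        funext x
        exact f.apply_symm_apply (e x)
      rw [this]

/-- A homeomorphism is isotopic to the identity through basepoint preserving homeomorphisms; an
isotopy is a level preserving homeomorphism of `[0,1] × S`. -/
def IsotopicToId (S : OrientedSpace) (f : S.space.carrier ≃ₜ S.space.carrier) : Prop :=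
  ∃ Φ : (unitInterval × S.space.carrier) ≃ₜ (unitInterval × S.space.carrier),
    (∀ x, (Φ x).1 = x.1) ∧ (∀ t, Φ (t, S.space.pt) = (t, S.space.pt)) ∧
    (∀ x, Φ (0, x) = (0, x)) ∧ ∀ x, Φ (1, x) = (1, f x)

/-- The normal subgroup of the homeomorphisms isotopic to the identity. -/
def isotopicToId (S : OrientedSpace) : Subgroup (HomeoPlus S) where
  carrier := {f | IsotopicToId S f}
  one_mem' := ⟨Homeomorph.refl _, fun _ => rfl, fun _ => rfl, fun _ => rfl, fun _ => rfl⟩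
  mul_mem' := by
    rintro f k ⟨F, a, b, c, d⟩ ⟨K, a', b', c', d'⟩
    refine ⟨K.trans F, fun x => ?_, fun t => ?_, fun x => ?_, fun x => ?_⟩
    · simp [a, a']
    · simp [b, b']
    · simp [c, c']
    · simp [d, d']
  inv_mem' := by
    rintro f ⟨F, a, b, c, d⟩
    refine ⟨F.symm, fun x => ?_, fun t => ?_, fun x => ?_, fun x => ?_⟩
    · rw [← a (F.symm x), F.apply_symm_apply]
    · rw [Homeomorph.symm_apply_eq, b]
    · rw [Homeomorph.symm_apply_eq, c]
    · rw [Homeomorph.symm_apply_eq, d]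
      exact congrArg (Prod.mk 1) ((f : S.space.carrier ≃ₜ S.space.carrier).apply_symm_apply x).symm

instance (S : OrientedSpace) : (isotopicToId S).Normal where
  conj_mem := by
    rintro f ⟨F, a, b, c, d⟩ k
    let k' : S.space.carrier ≃ₜ S.space.carrier := k
    have hk : k'.symm S.space.pt = S.space.pt := by
      rw [Homeomorph.symm_apply_eq, k.2.map_pt]
    let K := (Homeomorph.refl unitInterval).prodCongr k'
    refine ⟨K.symm.trans (F.trans K), fun x => ?_, fun t => ?_, fun x => ?_, fun x => ?_⟩
    · change (F (x.1, k'.symm x.2)).1 = x.1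
      rw [a]
    · change K (F (t, k'.symm S.space.pt)) = _
      rw [hk, b]
      exact congrArg (Prod.mk t) k.2.map_pt
    · change K (F (0, k'.symm x)) = _
      rw [c]
      exact congrArg (Prod.mk 0) (k'.apply_symm_apply x)
    · change K (F (1, k'.symm x)) = _
      rw [d]
      rfl

/-- The basepoint preserving mapping class group: orientation preserving, basepoint preserving
homeomorphisms modulo basepoint preserving isotopy. -/
abbrev MCG (S : OrientedSpace) : Type := HomeoPlus S ⧸ isotopicToId S

/-- The homotopy class of an element of `HomeoPlus S`, as an automorphism of `S` in the pointed
homotopy category. -/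
def homotopyClass (S : OrientedSpace) : HomeoPlus S →* Aut S.space where
  toFun f :=
    { hom := f.2.cls
      inv := (f⁻¹).2.cls
      hom_inv_id := by
        refine (PtdMap.cls_comp _ _).symm.trans (congrArg PtdMap.cls ?_)
        apply PtdMap.ext
        ext x
        exact (f : S.space.carrier ≃ₜ S.space.carrier).symm_apply_apply x
      inv_hom_id := by
        refine (PtdMap.cls_comp _ _).symm.trans (congrArg PtdMap.cls ?_)
        apply PtdMap.ext
        ext x
        exact (f : S.space.carrier ≃ₜ S.space.carrier).apply_symm_apply x }
  map_one' := by
    apply Iso.ext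
    rfl
  map_mul' f k := by
    apply Iso.ext
    rfl

/-- Mapping classes act by homotopy classes, as isotopic homeomorphisms are homotopic. -/
def MCG.toAut (S : OrientedSpace) : MCG S →* Aut S.space :=
  QuotientGroup.lift (isotopicToId S) (homotopyClass S) (by
    rintro f ⟨F, a, b, c, d⟩
    apply Iso.ext
    refine Eq.symm (PtdMap.cls_eq (f := PtdMap.id S.space)
      ⟨⟨⟨⟨fun x => (F x).2, by fun_prop⟩, fun x => ?_, fun x => ?_⟩, fun t x hx => ?_⟩⟩)
    · simp [c, PtdMap.id]
    · simp [d]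
    · rw [Set.mem_singleton_iff] at hx
      subst hx
      simp [b, PtdMap.id])

/-! ### Marked graphs and the ribbon graph complex -/

/-- `R_n`. -/
abbrev R (n : ℕ) : PtdSpace := (Graph.rose (Fin n)).space

/-- A marked graph: a graph with a pointed homotopy equivalence from `R_n`. -/
structure MarkedGraph (n : ℕ) : Type 1 where
  graph : Graph
  admissible : graph.Admissible
  marking : R n ≅ graph.space

/-- Equivalence of marked graphs: a graph isomorphism compatible with the markings up to
homotopy. -/
instance MarkedGraph.setoid (n : ℕ) : Setoid (MarkedGraph n) where
  r x y := ∃ h : Graph.GIso x.graph y.graph, x.marking.hom ≫ h.map.cls = y.marking.hom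
  iseqv :=
    { refl := fun x => ⟨.refl _, by rw [Graph.GIso.map_refl, Category.comp_id]⟩
      symm := by
        rintro x y ⟨h, hh⟩
        exact ⟨h.symm, by rw [← hh, Category.assoc, Graph.GIso.map_symm, Category.comp_id]⟩
      trans := by
        rintro x y z ⟨h, hh⟩ ⟨k, hk⟩
        exact ⟨h.trans k, by rw [Graph.GIso.map_trans, ← Category.assoc, hh, hk]⟩ }

/-- The vertices of the spine of Auter space (graphs without separating edges): equivalence classes
of marked graphs. -/
def AuterVertex (n : ℕ) : Type 1 := Quotient (MarkedGraph.setoid n)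

/-- The marked graph `(Γ, φ)` can be drawn in the marked surface `(S, ψ)`: for some ribbon structure
`O` there is an orientation preserving homeomorphism `h` from `|Γ, O|` to `S` such that
`h ∘ i ∘ φ` is homotopic to `ψ`. -/
def MarkedGraph.CanBeDrawn {n : ℕ} (x : MarkedGraph n) (S : OrientedSpace) (ψ : R n ≅ S.space) :
    Prop :=
  ∃ (O : x.graph.Ribbon) (h : (x.graph.ribbonSpace O).carrier ≃ₜ S.space.carrier)
    (hh : IsOriented (x.graph.ribbonSurface O) S h),
    x.marking.hom ≫ (x.graph.inclusion O).cls ≫ hh.cls = ψ.hom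

/-- The vertices of the degree `k` complex of the marked surface `(S, ψ)`: the classes of marked
graphs which have degree at most `k` and can be drawn in `(S, ψ)`. -/
def DegreeVertex {n : ℕ} (S : OrientedSpace) (ψ : R n ≅ S.space) (k : ℕ) : Type 1 :=
  {v : AuterVertex n // ∃ x : MarkedGraph n,
    Quotient.mk _ x = v ∧ x.CanBeDrawn S ψ ∧ x.graph.degree ≤ k}

/-- The right action of `α` on marked graphs, `(Γ, φ) α = (Γ, φ ∘ α)`. -/
def MarkedGraph.act {n : ℕ} (α : Aut (R n)) (x : MarkedGraph n) : MarkedGraph n :=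
  ⟨x.graph, x.admissible, α ≪≫ x.marking⟩

theorem MarkedGraph.act_one {n : ℕ} (x : MarkedGraph n) : x.act 1 = x := by
  have h : (1 : Aut (R n)) ≪≫ x.marking = x.marking := Iso.refl_trans x.marking
  unfold MarkedGraph.act
  rw [h]

theorem MarkedGraph.act_act {n : ℕ} (α β : Aut (R n)) (x : MarkedGraph n) :
    x.act (α * β) = (x.act α).act β := by
  have h : (α * β) ≪≫ x.marking = β ≪≫ (α ≪≫ x.marking) := Iso.trans_assoc β α x.marking
  unfold MarkedGraph.act
  rw [h]

/-- The action of homotopy equivalences of `R_n` (that is, of `Aut(F_n)`) on the vertices of the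
spine of Auter space. -/
def AuterVertex.act {n : ℕ} (α : Aut (R n)) : AuterVertex n → AuterVertex n :=
  Quotient.map (MarkedGraph.act α) (by
    rintro x y ⟨h, hh⟩
    refine ⟨h, ?_⟩
    change (α.hom ≫ x.marking.hom) ≫ h.map.cls = α.hom ≫ y.marking.hom
    rw [Category.assoc, hh])

/-- The embedding of the mapping class group given by the marking: `f` is sent to the homotopy
equivalence `α` of `R_n` with `ψ ∘ α` homotopic to `f ∘ ψ`. -/
def markedAut {n : ℕ} (S : OrientedSpace) (ψ : R n ≅ S.space) : MCG S →* Aut (R n) where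
  toFun f := ψ ≪≫ MCG.toAut S f ≪≫ ψ.symm
  map_one' := by
    rw [map_one]
    apply Iso.ext
    change ψ.hom ≫ 𝟙 _ ≫ ψ.inv = 𝟙 _
    simp
  map_mul' f k := by
    rw [map_mul]
    apply Iso.ext
    change ψ.hom ≫ ((MCG.toAut S k).hom ≫ (MCG.toAut S f).hom) ≫ ψ.inv =
      (ψ.hom ≫ (MCG.toAut S k).hom ≫ ψ.inv) ≫ (ψ.hom ≫ (MCG.toAut S f).hom ≫ ψ.inv)
    simp

theorem MarkedGraph.CanBeDrawn.act {n : ℕ} {S : OrientedSpace} {ψ : R n ≅ S.space} {x : MarkedGraph n}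
    (hx : x.CanBeDrawn S ψ) (f : MCG S) : (x.act (markedAut S ψ f)).CanBeDrawn S ψ := by
  obtain ⟨O, h, hh, e⟩ := hx
  induction f using QuotientGroup.induction_on with
  | H f =>
    have hf : IsOriented S S (f⁻¹ : HomeoPlus S).1 := (f⁻¹).2
    have hc : IsOriented (x.graph.ribbonSurface O) S (h.trans (f⁻¹ : HomeoPlus S).1) :=
      ⟨(congrArg _ hh.map_pt).trans hf.map_pt, fun e =>
        (hh.positive_iff e).trans (hf.positive_iff (h ∘ e))⟩
    refine ⟨O, _, hc, ?_⟩
    have h1 : hc.cls = hh.cls ≫ (homotopyClass S f).inv := rfl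
    let a : S.space ≅ S.space := homotopyClass S f
    change ((ψ.hom ≫ a.hom ≫ ψ.inv) ≫ x.marking.hom) ≫
      (x.graph.inclusion O).cls ≫ hc.cls = ψ.hom
    have h2 : x.marking.hom ≫ (x.graph.inclusion O).cls ≫ hh.cls ≫ a.inv = ψ.hom ≫ a.inv := by
      rw [← e]
      exact ((Category.assoc x.marking.hom ((x.graph.inclusion O).cls ≫ hh.cls) a.inv).trans
        (congrArg (x.marking.hom ≫ ·)
          (Category.assoc (x.graph.inclusion O).cls hh.cls a.inv))).symm
    rw [h1, Category.assoc]
    refine (congrArg ((ψ.hom ≫ a.hom ≫ ψ.inv) ≫ ·) h2).trans ?_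
    simp

/-- The right action of the mapping class group on the vertices of the degree `k` complex. -/
instance {n : ℕ} (S : OrientedSpace) (ψ : R n ≅ S.space) (k : ℕ) :
    MulAction (MCG S)ᵐᵒᵖ (DegreeVertex S ψ k) where
  smul f v := ⟨AuterVertex.act (markedAut S ψ f.unop) v.1, by
    obtain ⟨_, x, rfl, hx, hd⟩ := v
    exact ⟨x.act (markedAut S ψ f.unop), rfl, MarkedGraph.CanBeDrawn.act hx f.unop, hd⟩⟩
  one_smul v := by
    obtain ⟨_, x, rfl, hx, hd⟩ := v
    apply Subtype.ext
    change Quotient.mk (MarkedGraph.setoid n) (x.act (markedAut S ψ 1)) = Quotient.mk _ x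
    rw [map_one, MarkedGraph.act_one]
  mul_smul f k v := by
    obtain ⟨_, x, rfl, hx, hd⟩ := v
    apply Subtype.ext
    change Quotient.mk (MarkedGraph.setoid n) (x.act (markedAut S ψ (k.unop * f.unop))) =
      Quotient.mk _ ((x.act (markedAut S ψ k.unop)).act (markedAut S ψ f.unop))
    rw [map_mul, MarkedGraph.act_act]

/-- The vertices of the quotient of the degree `k` complex by the mapping class group: the orbits of
its vertices. -/
abbrev QuotientVertex {n : ℕ} (S : OrientedSpace) (ψ : R n ≅ S.space) (k : ℕ) : Type 1 :=
  MulAction.orbitRel.Quotient (MCG S)ᵐᵒᵖ (DegreeVertex S ψ k)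

end RibbonComplex

end

/-!
All vertices of the complex used here are roses, of degree `0`. A ribbon structure on a rose is a
cyclic order of its half edges, that is, a cyclic word in which every letter of the alphabet
`E × Bool` occurs once. If its ribbon surface is the given surface, then the marking of the surface
is transported to the rose (`drawnRose`), which gives a vertex of the complex. The proof consists of
an invariant of the orbit of such a vertex and of a family of words whose invariants differ.

*The invariant.* The marked graph does not record the ribbon structure, but the orbit of a rose
nearly determines it. If two ribbon structures give roses in the same orbit, then there is a
homeomorphism of their ribbon surfaces which is compatible, up to homotopy and a symmetry of the
rose, with the retractions to the rose (`exists_homotopy_of_mem_orbit`). A boundary loop of the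
first surface, pushed close enough to its puncture, is mapped into the complement of the graph in
the second surface, hence into a punctured disk, where it winds around the puncture
(`Graph.exists_unwinding`). Retracting to the rose gives a free homotopy between two loops which run
along boundary cycles. Freely homotopic loops have conjugate holonomies in the covering of the rose
with group `FreeGroup E` (`TwoCharts.IsHolonomy.isConj`). The word of a boundary cycle never
backtracks, so it is cyclically reduced, and cyclically reduced conjugate words are rotations of
each other (`isRotated_of_isConj`). So the boundary cycles agree up to their direction, which means
that each half edge has the same successor in the two cyclic orders or in the first and the reverse
of the second (`succ_eq_of_homotopic`). The alternative is then the same for all half edges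
(`eq_or_eq_inv`). Therefore the set `endDistances` of distances, along the cyclic order, between the
two ends of an edge depends only on the orbit (`endDistances_eq_of_mem_orbit`).

*The family.* Sliding one end of an edge along another edge does not change the oriented ribbon
surface: three strips of the surface are laid out in the plane, and the slide is realized by an
explicit homeomorphism of the plane, isotopic to the identity (`slidePlane`,
`Graph.IsSlide.isOriented_homeo`). Write `g = 2m` and `p - 1 = 2q`. A word of the family is built in
`m + q` stages, the first `m` adding two handles each and the others two punctures each. In every
stage one bit decides whether some new edges have their ends on different sides of the previous word
`X`, so that the distance of their ends is `|X| + 5` or `|X| + 1`, or all new letters follow `X`.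
One more bit replaces the first stage by words in which the distance `4` occurs. Slides take each
word to the standard word of the surface (`slideEq_familyWord`). The `m + q + 1` bits can be read
off from the set of distances (`familyStage_bits`): the lengths `|X|` are multiples of `4`, so the
distances which witness the bits are not confused with each other, nor with the distances measured
the other way around the cyclic order. This gives `2 ^ (m + q + 1)` orbits.
-/

open CategoryTheory

noncomputable section

namespace RibbonComplex

section

/-! ### Orientation of plane maps -/

/-- Two free loops in the punctured plane are homotopic there. -/
def LoopHomotopic (f g : Circle → ℂ) : Prop :=
  ∃ H : C(unitInterval × Circle, ℂ), (∀ x, H x ≠ 0) ∧ ∀ u : Circle, H (0, u) = f u ∧ H (1, u) = g u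

theorem LoopHomotopic.trans {f g k : Circle → ℂ} (h₁ : LoopHomotopic f g)
    (h₂ : LoopHomotopic g k) : LoopHomotopic f k := by
  obtain ⟨H, hH, hH'⟩ := h₁
  obtain ⟨K, hK, hK'⟩ := h₂
  have key : ∀ (H : C(unitInterval × Circle, ℂ)), (∀ x, H x ≠ 0) →
      ContinuousMap.HomotopicWith (H.curry 0) (H.curry 1) (fun k => ∀ u, k u ≠ 0) := fun H hH =>
    ⟨⟨⟨H, fun _ => rfl, fun _ => rfl⟩, fun t u => hH (t, u)⟩⟩
  have hmid : H.curry 1 = K.curry 0 := by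
    ext u
    exact (hH' u).2.trans (hK' u).1.symm
  obtain ⟨F⟩ := (key H hH).trans (hmid ▸ key K hK)
  refine ⟨F.toContinuousMap, fun x => F.prop' x.1 x.2, fun u => ⟨?_, ?_⟩⟩
  · exact (F.apply_zero u).trans (hH' u).1
  · exact (F.apply_one u).trans (hK' u).2

theorem PreservesOrientationAt.congr {c c' : ℂ → ℂ} {z : ℂ} (h : PreservesOrientationAt c z)
    {ε : ℝ} (hε : 0 < ε) (hcc : ∀ w ∈ Metric.ball z ε, c w = c' w) :
    PreservesOrientationAt c' z := by
  obtain ⟨r₀, hr₀, H⟩ := h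
  refine ⟨min r₀ ε, lt_min hr₀ hε, fun r hr hr' => ?_⟩
  obtain ⟨K, hK, hK'⟩ := H r hr (hr'.trans_le (min_le_left _ _))
  refine ⟨K, hK, fun u => ?_⟩
  rw [← hcc z (Metric.mem_ball_self hε), ← hcc (z + r * u)]
  · exact hK' u
  · simpa [abs_of_pos hr, Circle.norm_coe u] using hr'.trans_le (min_le_right _ _)

/-- Small circles around two points of a disk, mapped by an injective map of the disk, are homotopic
in the punctured plane: move one circle to the other. -/
theorem loopHomotopic_of_injOn {c : ℂ → ℂ} {z₀ : ℂ} {R : ℝ}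
    (hc : ContinuousOn c (Metric.ball z₀ R)) (hi : Set.InjOn c (Metric.ball z₀ R))
    {z z' : ℂ} {r r' : ℝ} (hr : 0 < r) (hr' : 0 < r') (hz : dist z z₀ + r < R)
    (hz' : dist z' z₀ + r' < R) :
    LoopHomotopic (fun u => c (z + r * u) - c z) (fun u => c (z' + r' * u) - c z') := by
  have hmem : ∀ (t : unitInterval) (u : ℂ), ‖u‖ ≤ 1 →
      ((1 - t : ℝ) * z + (t : ℝ) * z' + ((1 - t : ℝ) * r + (t : ℝ) * r' : ℝ) * u) ∈
        Metric.ball z₀ R := by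
    intro t u hu
    have h0 := t.2.1
    have h1 := t.2.2
    rw [Metric.mem_ball, dist_eq_norm]
    rw [dist_eq_norm] at hz hz'
    have e : ((1 - t : ℝ) * z + (t : ℝ) * z' + ((1 - t : ℝ) * r + (t : ℝ) * r' : ℝ) * u) - z₀ =
        ((1 - t : ℝ) : ℂ) * (z - z₀) + ((t : ℝ) : ℂ) * (z' - z₀) +
        ((1 - t : ℝ) * r + (t : ℝ) * r' : ℝ) * u := by
      push_cast
      ring
    rw [e]
    have hp : 0 ≤ (1 - t : ℝ) * r + (t : ℝ) * r' := by
      have := mul_nonneg (sub_nonneg.2 h1) hr.le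
      have := mul_nonneg h0 hr'.le
      linarith
    calc _ ≤ ‖((1 - t : ℝ) : ℂ) * (z - z₀)‖ + ‖((t : ℝ) : ℂ) * (z' - z₀)‖ +
          ‖(((1 - t : ℝ) * r + (t : ℝ) * r' : ℝ) : ℂ) * u‖ := norm_add₃_le
      _ ≤ (1 - t : ℝ) * ‖z - z₀‖ + (t : ℝ) * ‖z' - z₀‖ + ((1 - t : ℝ) * r + (t : ℝ) * r') * 1 := by
        rw [norm_mul, norm_mul, norm_mul, Complex.norm_real, Complex.norm_real, Complex.norm_real,
          Real.norm_of_nonneg h0, Real.norm_of_nonneg (sub_nonneg.2 h1), Real.norm_of_nonneg hp]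
        gcongr
      _ = (1 - t : ℝ) * (‖z - z₀‖ + r) + (t : ℝ) * (‖z' - z₀‖ + r') := by ring
      _ < R := by
        rcases h0.eq_or_lt with h | h
        · rw [← h]
          linarith
        · have := mul_lt_mul_of_pos_left hz' h
          have := mul_le_mul_of_nonneg_left hz.le (sub_nonneg.2 h1)
          linarith
  let A : unitInterval × Circle → ℂ := fun x =>
    (1 - x.1 : ℝ) * z + (x.1 : ℝ) * z' + ((1 - x.1 : ℝ) * r + (x.1 : ℝ) * r' : ℝ) * (x.2 : ℂ)
  let B : unitInterval × Circle → ℂ := fun x => (1 - x.1 : ℝ) * z + (x.1 : ℝ) * z'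
  have hA : ∀ x, A x ∈ Metric.ball z₀ R := fun x => hmem x.1 x.2 (Circle.norm_coe x.2).le
  have hB : ∀ x, B x ∈ Metric.ball z₀ R := fun x => by
    simpa only [mul_zero, add_zero] using hmem x.1 0 (by simp)
  have hAc : Continuous A := by fun_prop
  have hBc : Continuous B := by fun_prop
  refine ⟨⟨fun x => c (A x) - c (B x), ?_⟩, fun x => ?_, fun u => ⟨?_, ?_⟩⟩
  · exact (hc.comp_continuous hAc hA).sub (hc.comp_continuous hBc hB)
  · intro h
    have h' := hi (hA x) (hB x) (sub_eq_zero.1 h)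
    have hp : 0 < (1 - x.1 : ℝ) * r + (x.1 : ℝ) * r' := by
      have h0 := x.1.2.1
      have h1 := x.1.2.2
      rcases h0.eq_or_lt with h | h
      · rw [← h]
        linarith
      · have := mul_pos h hr'
        have := mul_nonneg (sub_nonneg.2 h1) hr.le
        linarith
    have h2 : (((1 - x.1 : ℝ) * r + (x.1 : ℝ) * r' : ℝ) : ℂ) * (x.2 : ℂ) = 0 := by
      simpa [A, B] using h'
    rcases mul_eq_zero.1 h2 with h3 | h3
    · exact hp.ne' (Complex.ofReal_eq_zero.1 h3)
    · exact Circle.coe_ne_zero _ h3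
  · simp [A, B]
  · simp [A, B]

/-- Whether an injective map of a disk preserves the orientation does not depend on the point. -/
theorem PreservesOrientationAt.of_injOn {c : ℂ → ℂ} {z z' : ℂ} {R : ℝ}
    (hc : ContinuousOn c (Metric.ball z R)) (hi : Set.InjOn c (Metric.ball z R))
    (hz' : z' ∈ Metric.ball z R) (h : PreservesOrientationAt c z') :
    PreservesOrientationAt c z := by
  obtain ⟨r₀, hr₀, H⟩ := h
  have hR : 0 < R := (dist_nonneg).trans_lt hz'
  have hd : 0 < R - dist z' z := sub_pos.2 hz'
  refine ⟨R, hR, fun r hr hrR => ?_⟩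
  have hm : 0 < min r₀ (R - dist z' z) := lt_min hr₀ hd
  have h1 : min r₀ (R - dist z' z) / 2 < r₀ :=
    (half_lt_self hm).trans_le (min_le_left _ _)
  have h2 : min r₀ (R - dist z' z) / 2 < R - dist z' z :=
    (half_lt_self hm).trans_le (min_le_right _ _)
  refine LoopHomotopic.trans ?_ (H _ (half_pos hm) h1)
  exact loopHomotopic_of_injOn hc hi hr (half_pos hm) (by simpa using hrR) (by linarith)

/-- A map of the plane is isotopic to the identity, through injective maps. -/
def PlaneIsotopic (χ : ℂ → ℂ) : Prop :=
  ∃ K : unitInterval × ℂ → ℂ, Continuous K ∧ (∀ t, Function.Injective fun w => K (t, w)) ∧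
    ∀ w, K (0, w) = χ w ∧ K (1, w) = w

theorem PlaneIsotopic.continuous {χ : ℂ → ℂ} (h : PlaneIsotopic χ) : Continuous χ := by
  obtain ⟨K, hK, -, h0⟩ := h
  have : χ = fun w => K (0, w) := funext fun w => (h0 w).1.symm
  rw [this]
  fun_prop

theorem PlaneIsotopic.id : PlaneIsotopic fun w => w :=
  ⟨fun x => x.2, continuous_snd, fun _ _ _ h => h, fun _ => ⟨rfl, rfl⟩⟩

theorem PlaneIsotopic.preservesOrientationAt {χ c : ℂ → ℂ} (hχ : PlaneIsotopic χ) {z : ℂ} {R : ℝ}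
    (hR : 0 < R) (hc : ContinuousOn c (Metric.ball z R)) (hi : Set.InjOn c (Metric.ball z R))
    (h : PreservesOrientationAt c z) : PreservesOrientationAt (fun w => χ (c w)) z := by
  obtain ⟨r₀, hr₀, H⟩ := h
  obtain ⟨K, hK, hKi, hK0⟩ := hχ
  refine ⟨min r₀ R, lt_min hr₀ hR, fun r hr hr' => ?_⟩
  refine LoopHomotopic.trans ?_ (H r hr (hr'.trans_le (min_le_left _ _)))
  have hz : z ∈ Metric.ball z R := Metric.mem_ball_self hR
  have hm : ∀ u : Circle, z + r * u ∈ Metric.ball z R := fun u => by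
    simpa [abs_of_pos hr, Circle.norm_coe u] using hr'.trans_le (min_le_right _ _)
  have hcc : Continuous fun u : Circle => c (z + r * u) :=
    hc.comp_continuous (by fun_prop) hm
  refine ⟨⟨fun x => K (x.1, c (z + r * x.2)) - K (x.1, c z), ?_⟩, fun x => ?_, fun u => ?_⟩
  · have : Continuous fun x : unitInterval × Circle => c (z + r * x.2) := hcc.comp continuous_snd
    exact (hK.comp (continuous_fst.prodMk this)).sub
      (hK.comp (continuous_fst.prodMk continuous_const))
  · intro h
    have h1 := hi (hm x.2) hz (hKi x.1 (sub_eq_zero.1 h))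
    have h2 : (r : ℂ) * (x.2 : ℂ) = 0 := by simpa using h1
    rcases mul_eq_zero.1 h2 with h3 | h3
    · exact hr.ne' (Complex.ofReal_eq_zero.1 h3)
    · exact Circle.coe_ne_zero _ h3
  · simp [hK0]

theorem PlaneIsotopic.comp {χ χ' : ℂ → ℂ} (h : PlaneIsotopic χ) (h' : PlaneIsotopic χ') :
    PlaneIsotopic fun w => χ (χ' w) := by
  obtain ⟨K, hK, hKi, hK0⟩ := h
  obtain ⟨K', hK', hKi', hK0'⟩ := h'
  refine ⟨fun x => K (x.1, K' x), by fun_prop, fun t a b hab => hKi' t (hKi t hab), fun w => ?_⟩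
  simp [hK0, hK0']

theorem planeIsotopic_add (a : ℂ) : PlaneIsotopic fun w => w + a :=
  ⟨fun x => x.2 + (1 - (x.1 : ℝ) : ℝ) * a, by fun_prop, fun t a b h => by simpa using h,
    fun w => by simp⟩

theorem planeIsotopic_neg : PlaneIsotopic fun w => -w := by
  refine ⟨fun x => Complex.exp (Real.pi * (1 - (x.1 : ℝ) : ℝ) * Complex.I) * x.2, by fun_prop,
    fun t a b h => ?_, fun w => ?_⟩
  · exact mul_left_cancel₀ (Complex.exp_ne_zero _) h
  · simp

/-! ### Open strips of a ribbon surface -/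

/-- The open strip, in the complex coordinate. -/
def openStrip : Set ℂ := {w | 0 < w.re ∧ w.re < 1 ∧ 0 < w.im}

theorem isOpen_openStrip : IsOpen openStrip :=
  (isOpen_lt continuous_const Complex.continuous_re).inter
    ((isOpen_lt Complex.continuous_re continuous_const).inter
      (isOpen_lt continuous_const Complex.continuous_im))

namespace Graph

variable {G : Graph} {O : G.Ribbon}

/-- The point of the ribbon surface with coordinates `t`, `s` in the closed strip of `d`. -/
def stripMk (O : G.Ribbon) (d : G.D) (t : unitInterval) (s : NNReal) :
    (G.ribbonSpace O).carrier :=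
  Quot.mk _ (.inr ⟨d, (t, s)⟩)

theorem continuous_stripMk (O : G.Ribbon) (d : G.D) :
    Continuous fun x : unitInterval × NNReal => stripMk O d x.1 x.2 :=
  continuous_quot_mk.comp (continuous_inr.comp
    (continuous_sigmaMk (σ := fun _ : G.D => unitInterval × NNReal) (i := d)))

theorem stripPoint_eq (d : G.D) (w : ℂ) : G.stripPoint O d w =
    stripMk O d (Set.projIcc 0 1 zero_le_one w.re) w.im.toNNReal := rfl

open Classical in
/-- The coordinate in the open strip of `d`, extended by `0`. -/
def stripCoordPiece (d : G.D) : G.RPiece → ℂ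
  | .inl _ => 0
  | .inr ⟨d', (t, s)⟩ => if d' = d ∧ (0 : ℝ) < t ∧ (t : ℝ) < 1 ∧ 0 < s then ⟨t, s⟩ else 0

open Classical in
/-- The coordinate in the open strip of `d`, as a function on the ribbon surface which is `0` outside
of the open strip. -/
def stripCoord (O : G.Ribbon) (d : G.D) : (G.ribbonSpace O).carrier → ℂ :=
  Quot.lift (stripCoordPiece d) (by
    rintro _ _ (d' | ⟨d', t⟩ | ⟨d', s⟩) <;> simp [stripCoordPiece])

theorem stripCoord_stripMk_ne_zero {d d' : G.D} {t : unitInterval} {s : NNReal}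
    (h : stripCoord O d (stripMk O d' t s) ≠ 0) :
    d' = d ∧ (0 : ℝ) < t ∧ (t : ℝ) < 1 ∧ 0 < s ∧ stripCoord O d (stripMk O d' t s) = ⟨t, s⟩ := by
  change stripCoordPiece d (.inr ⟨d', (t, s)⟩) ≠ 0 at h
  change _ ∧ _ ∧ _ ∧ _ ∧ stripCoordPiece d (.inr ⟨d', (t, s)⟩) = _
  simp only [stripCoordPiece] at h ⊢
  split_ifs at h ⊢ with h1
  · exact ⟨h1.1, h1.2.1, h1.2.2.1, h1.2.2.2, rfl⟩
  · exact absurd rfl h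

theorem stripCoord_stripPoint {d : G.D} {w : ℂ} (hw : w ∈ openStrip) :
    stripCoord O d (G.stripPoint O d w) = w := by
  obtain ⟨h1, h2, h3⟩ := hw
  have e : Set.projIcc (0 : ℝ) 1 zero_le_one w.re = ⟨w.re, h1.le, h2.le⟩ :=
    Set.projIcc_of_mem _ ⟨h1.le, h2.le⟩
  change stripCoordPiece d (.inr ⟨d, (_, _)⟩) = w
  simp only [stripCoordPiece]
  rw [if_pos ⟨trivial, by rw [e]; exact h1, by rw [e]; exact h2, Real.toNNReal_pos.2 h3⟩]
  apply Complex.ext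
  · simp [e]
  · simp [h3.le]

theorem ne_zero_of_mem_openStrip {w : ℂ} (hw : w ∈ openStrip) : w ≠ 0 := by
  rintro rfl
  exact lt_irrefl _ hw.1

/-- A point of an open strip has only one representation as a point of a closed strip. -/
theorem stripMk_eq_stripPoint {d d' : G.D} {t : unitInterval} {s : NNReal} {w : ℂ}
    (hw : w ∈ openStrip) (h : stripMk O d' t s = G.stripPoint O d w) :
    d' = d ∧ (t : ℝ) = w.re ∧ (s : ℝ) = w.im := by
  have h1 := stripCoord_stripPoint (O := O) (d := d) hw
  rw [← h] at h1
  obtain ⟨a, -, -, -, b⟩ := stripCoord_stripMk_ne_zero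
    (h1.trans_ne (ne_zero_of_mem_openStrip hw))
  rw [h1] at b
  exact ⟨a, (congrArg Complex.re b).symm, (congrArg Complex.im b).symm⟩

theorem stripCoord_ne_zero {d : G.D} {x : (G.ribbonSpace O).carrier} (h : stripCoord O d x ≠ 0) :
    stripCoord O d x ∈ openStrip ∧ G.stripPoint O d (stripCoord O d x) = x := by
  induction x using Quot.inductionOn with
  | h x =>
    rcases x with v | ⟨d', t, s⟩
    · exact absurd rfl h
    · obtain ⟨rfl, h1, h2, h3, h4⟩ := stripCoord_stripMk_ne_zero h
      change stripCoord O d' (stripMk O d' t s) ∈ openStrip ∧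
        G.stripPoint O d' (stripCoord O d' (stripMk O d' t s)) = stripMk O d' t s
      rw [h4]
      refine ⟨⟨h1, h2, NNReal.coe_pos.2 h3⟩, ?_⟩
      rw [stripPoint_eq]
      simp [Set.projIcc_of_mem _ t.2]

theorem isOpen_stripCoord_ne_zero (d : G.D) : IsOpen {x | stripCoord O d x ≠ 0} := by
  classical
  change IsOpen (Quot.mk _ ⁻¹' {x | stripCoord O d x ≠ 0})
  rw [isOpen_sum_iff]
  refine ⟨by convert isOpen_empty; simp [stripCoord, stripCoordPiece], ?_⟩
  rw [isOpen_sigma_iff]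
  intro d'
  have : (Sigma.mk d' ⁻¹' (Sum.inr ⁻¹' (Quot.mk (G.RGlue O) ⁻¹' {x | stripCoord O d x ≠ 0}))) =
      {x : unitInterval × NNReal | d' = d ∧ (0 : ℝ) < x.1 ∧ (x.1 : ℝ) < 1 ∧ (0 : ℝ) < x.2} := by
    ext ⟨t, s⟩
    constructor
    · intro h
      obtain ⟨a, b, c, d, -⟩ := stripCoord_stripMk_ne_zero (O := O) h
      exact ⟨a, b, c, NNReal.coe_pos.2 d⟩
    · rintro ⟨a, b, c, e⟩
      change stripCoordPiece _ (.inr ⟨d', (t, s)⟩) ≠ 0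
      simp only [stripCoordPiece]
      rw [if_pos ⟨a, b, c, NNReal.coe_pos.1 e⟩]
      intro h
      exact (ne_of_gt b) (congrArg Complex.re h)
  rw [this]
  refine (isOpen_const).inter (IsOpen.inter ?_ (IsOpen.inter ?_ ?_))
  · exact isOpen_lt continuous_const (continuous_subtype_val.comp continuous_fst)
  · exact isOpen_lt (continuous_subtype_val.comp continuous_fst) continuous_const
  · exact isOpen_lt continuous_const (NNReal.continuous_coe.comp continuous_snd)

theorem continuousOn_stripCoord (d : G.D) :
    ContinuousOn (stripCoord O d) {x | stripCoord O d x ≠ 0} := by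
  classical
  have hq : Topology.IsQuotientMap (Quot.mk (G.RGlue O)) := isQuotientMap_quot_mk
  refine (hq.continuousOn_isOpen_iff (isOpen_stripCoord_ne_zero d)).2 ?_
  have hc : Continuous fun x : G.RPiece =>
      (Sum.elim (fun _ => (0 : ℂ)) (fun y => (⟨(y.2.1 : ℝ), (y.2.2 : ℝ)⟩ : ℂ)) x : ℂ) := by
    refine Continuous.sumElim continuous_const ?_
    have : Continuous fun y : (Σ _ : G.D, unitInterval × NNReal) =>
        (((y.2.1 : ℝ) : ℂ) + ((y.2.2 : ℝ) : ℂ) * Complex.I) := by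
      refine continuous_sigma fun i => ?_
      fun_prop
    convert this using 2 with y
    exact Complex.mk_eq_add_mul_I _ _
  refine hc.continuousOn.congr ?_
  rintro (v | ⟨d', t, s⟩) h
  · exact absurd rfl h
  · exact (stripCoord_stripMk_ne_zero (O := O) h).2.2.2.2

/-- The open strips are dense. -/
theorem exists_stripPoint_mem (hG : ∀ v, ∃ d, G.src d = v) {U : Set (G.ribbonSpace O).carrier}
    (hU : IsOpen U) (hne : U.Nonempty) : ∃ d, ∃ w ∈ openStrip, G.stripPoint O d w ∈ U := by
  obtain ⟨d, t, s, hx⟩ : ∃ d t s, stripMk O d t s ∈ U := by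
    obtain ⟨x, hx⟩ := hne
    induction x using Quot.inductionOn with
    | h x =>
      rcases x with v | ⟨d, t, s⟩
      · obtain ⟨d, rfl⟩ := hG v
        exact ⟨d, 0, 0, by rwa [show stripMk O d 0 0 = Quot.mk _ (.inl (G.src d)) from
          Quot.sound (.start d)]⟩
      · exact ⟨d, t, s, hx⟩
  have hV : IsOpen {w : ℂ | G.stripPoint O d w ∈ U} :=
    hU.preimage ((continuous_stripMk O d).comp
      (f := fun w : ℂ => (Set.projIcc 0 1 zero_le_one w.re, w.im.toNNReal)) (by fun_prop))
  have hw : (⟨t, s⟩ : ℂ) ∈ {w : ℂ | G.stripPoint O d w ∈ U} := by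
    change G.stripPoint O d _ ∈ U
    rw [stripPoint_eq]
    simpa [Set.projIcc_of_mem _ t.2] using hx
  have hcl : (⟨t, s⟩ : ℂ) ∈ closure openStrip := by
    have h1 : openStrip = (Set.Ioo 0 1) ×ℂ (Set.Ioi 0) := by
      ext w
      simp [openStrip, Complex.mem_reProdIm, and_assoc]
    rw [h1, Complex.closure_reProdIm, closure_Ioo zero_ne_one, closure_Ioi]
    exact ⟨t.2, s.2⟩
  obtain ⟨w, h1, h2⟩ := mem_closure_iff.1 hcl _ hV hw
  exact ⟨d, w, h2, h1⟩

/-- A homeomorphism which is given, between open strips, by plane maps isotopic to the identity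
takes positive open embeddings to positive ones. -/
theorem comp_mem_positive {G' : Graph} {O' : G'.Ribbon} (hG : ∀ v, ∃ d, G.src d = v)
    (h : (G.ribbonSpace O).carrier ≃ₜ (G'.ribbonSpace O').carrier)
    (hloc : ∀ d, ∀ w ∈ openStrip, ∀ d', ∀ w' ∈ openStrip,
      h (G.stripPoint O d w) = G'.stripPoint O' d' w' →
      ∃ χ : ℂ → ℂ, PlaneIsotopic χ ∧ χ w = w' ∧
        ∀ᶠ v in nhds w, h (G.stripPoint O d v) = G'.stripPoint O' d' (χ v))
    {e : ℂ → (G.ribbonSpace O).carrier} (he : e ∈ (G.ribbonSurface O).positive) :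
    h ∘ e ∈ (G'.ribbonSurface O').positive := by
  obtain ⟨heo, hep⟩ := he
  refine ⟨h.isOpenEmbedding.comp heo, fun d' c z ε hε hc => ?_⟩
  have hcs : ∀ w ∈ Metric.ball z ε, c w ∈ openStrip := fun w hw =>
    ⟨(hc w hw).1, (hc w hw).2.1, (hc w hw).2.2.1⟩
  have hce : ∀ w ∈ Metric.ball z ε, c w = stripCoord O' d' (h (e w)) := fun w hw => by
    rw [← Function.comp_apply (f := h), ← (hc w hw).2.2.2, stripCoord_stripPoint (hcs w hw)]
  have hcc : ContinuousOn c (Metric.ball z ε) := by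
    refine ContinuousOn.congr ?_ hce
    refine (continuousOn_stripCoord (O := O') d').comp
      (h.continuous.comp heo.continuous).continuousOn fun w hw => ?_
    change stripCoord O' d' (h (e w)) ≠ 0
    rw [← hce w hw]
    exact ne_zero_of_mem_openStrip (hcs w hw)
  have hci : Set.InjOn c (Metric.ball z ε) := by
    intro a ha b hb hab
    apply heo.injective
    apply h.injective
    have := (hc a ha).2.2.2
    rw [hab, (hc b hb).2.2.2] at this
    exact this.symm
  obtain ⟨d, v, hv, z₁, hz₁, hvz⟩ := exists_stripPoint_mem hG
    (heo.isOpenMap _ (Metric.isOpen_ball (x := z) (ε := ε)))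
    ⟨_, z, Metric.mem_ball_self hε, rfl⟩
  obtain ⟨χ, hχ, hχv, hev⟩ := hloc d v hv d' (c z₁) (hcs z₁ hz₁) (by
    rw [← hvz]
    exact (hc z₁ hz₁).2.2.2.symm)
  let c₁ : ℂ → ℂ := fun w => stripCoord O d (e w)
  have hc₁v : c₁ z₁ = v := by
    change stripCoord O d (e z₁) = v
    rw [hvz, stripCoord_stripPoint hv]
  have hW : IsOpen {w | stripCoord O d (e w) ≠ 0} :=
    (isOpen_stripCoord_ne_zero d).preimage heo.continuous
  have hc₁c : ContinuousOn c₁ {w | stripCoord O d (e w) ≠ 0} :=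
    (continuousOn_stripCoord (O := O) d).comp heo.continuous.continuousOn fun w hw => hw
  have hz₁W : z₁ ∈ {w | stripCoord O d (e w) ≠ 0} :=
    hc₁v.trans_ne (ne_zero_of_mem_openStrip hv)
  have hca : ContinuousAt c₁ z₁ := hc₁c.continuousAt (hW.mem_nhds hz₁W)
  have hev' : ∀ᶠ w in nhds z₁, h (G.stripPoint O d (c₁ w)) = G'.stripPoint O' d' (χ (c₁ w)) ∧
      χ (c₁ w) ∈ openStrip := by
    rw [← hc₁v] at hev
    refine (hca.eventually hev).and ?_
    refine (hχ.continuous.continuousAt.comp hca).eventually (isOpen_openStrip.mem_nhds ?_)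
    rw [Function.comp_apply, hc₁v, hχv]
    exact hcs z₁ hz₁
  obtain ⟨δ, hδ, hball⟩ := Metric.mem_nhds_iff.1
    (Filter.inter_mem (hW.mem_nhds hz₁W)
      (Filter.inter_mem (Metric.isOpen_ball.mem_nhds hz₁) hev'))
  have hpt : ∀ w ∈ Metric.ball z₁ δ, G.stripPoint O d (c₁ w) = e w := fun w hw =>
    (stripCoord_ne_zero (hball hw).1).2
  have hp₁ : PreservesOrientationAt c₁ z₁ := by
    refine hep d c₁ z₁ δ hδ fun w hw => ?_
    have := (stripCoord_ne_zero (hball hw).1).1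
    exact ⟨this.1, this.2.1, this.2.2, hpt w hw⟩
  have hp₂ := hχ.preservesOrientationAt hδ (hc₁c.mono fun w hw => (hball hw).1)
    (fun a ha b hb hab => heo.injective (by rw [← hpt a ha, ← hpt b hb, hab])) hp₁
  refine PreservesOrientationAt.of_injOn hcc hci hz₁ (hp₂.congr hδ fun w hw => ?_)
  obtain ⟨-, hwb, h1, h2⟩ := hball hw
  rw [hce w hwb, ← hpt w hw, h1, stripCoord_stripPoint h2]

/-- A homeomorphism of ribbon surfaces is orientation preserving if, in the coordinates of the open
strips, it and its inverse are locally given by plane maps isotopic to the identity. Points outside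
of the open strips need no check, since the orientation behavior of a disk is determined at any of
its points. -/
theorem isOriented_of_local {G' : Graph} {O' : G'.Ribbon} (hG : ∀ v, ∃ d, G.src d = v)
    (hG' : ∀ v, ∃ d, G'.src d = v)
    (h : (G.ribbonSpace O).carrier ≃ₜ (G'.ribbonSpace O').carrier)
    (hpt : h (G.ribbonSpace O).pt = (G'.ribbonSpace O').pt)
    (hloc : ∀ d, ∀ w ∈ openStrip, ∀ d', ∀ w' ∈ openStrip,
      h (G.stripPoint O d w) = G'.stripPoint O' d' w' →
      ∃ χ : ℂ → ℂ, PlaneIsotopic χ ∧ χ w = w' ∧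
        ∀ᶠ v in nhds w, h (G.stripPoint O d v) = G'.stripPoint O' d' (χ v))
    (hloc' : ∀ d, ∀ w ∈ openStrip, ∀ d', ∀ w' ∈ openStrip,
      h.symm (G'.stripPoint O' d w) = G.stripPoint O d' w' →
      ∃ χ : ℂ → ℂ, PlaneIsotopic χ ∧ χ w = w' ∧
        ∀ᶠ v in nhds w, h.symm (G'.stripPoint O' d v) = G.stripPoint O d' (χ v)) :
    IsOriented (G.ribbonSurface O) (G'.ribbonSurface O') h := by
  refine ⟨hpt, fun e => ⟨fun he => comp_mem_positive hG h hloc he, fun he => ?_⟩⟩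
  have := comp_mem_positive hG' h.symm hloc' he
  have e' : h.symm ∘ h ∘ e = e := funext fun x => h.symm_apply_apply (e x)
  exact (congrArg (· ∈ (G.ribbonSurface O).positive) e').mp this

end Graph

end

section

/-! ### A plane homeomorphism realizing a slide -/

/-- The shear along the imaginary direction by a function of the real part. -/
def shear (m : ℝ → ℝ) (w : ℂ) : ℂ := ⟨w.re, w.im + m w.re⟩

/-- The map scaling each horizontal line from its point with real part `1`, by a factor depending on
the imaginary part. -/
def rowScale (ρ : ℝ → ℝ) (w : ℂ) : ℂ := ⟨1 - (1 - w.re) * ρ w.im, w.im⟩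

theorem continuous_complex_mk {X : Type*} [TopologicalSpace X] {f g : X → ℝ} (hf : Continuous f)
    (hg : Continuous g) : Continuous fun x => (⟨f x, g x⟩ : ℂ) := by
  have : (fun x => (⟨f x, g x⟩ : ℂ)) = fun x => ((f x : ℂ) + (g x : ℂ) * Complex.I) :=
    funext fun x => Complex.mk_eq_add_mul_I _ _
  rw [this]
  fun_prop

theorem planeIsotopic_shear {m : ℝ → ℝ} (hm : Continuous m) : PlaneIsotopic (shear m) := by
  refine ⟨fun x => ⟨x.2.re, x.2.im + (1 - (x.1 : ℝ)) * m x.2.re⟩,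
    continuous_complex_mk (by fun_prop) (by fun_prop), fun t a b h => ?_, fun w => ?_⟩
  · obtain ⟨h1, h2⟩ := Complex.ext_iff.1 h
    simp only at h1 h2
    rw [h1] at h2
    exact Complex.ext h1 (add_right_cancel h2)
  · exact ⟨Complex.ext (by simp [shear]) (by simp [shear]), Complex.ext (by simp) (by simp)⟩

theorem planeIsotopic_rowScale {ρ : ℝ → ℝ} (hρ : Continuous ρ) (hpos : ∀ y, 0 < ρ y) :
    PlaneIsotopic (rowScale ρ) := by
  refine ⟨fun x => ⟨1 - (1 - x.2.re) * ((1 - (x.1 : ℝ)) * ρ x.2.im + (x.1 : ℝ)), x.2.im⟩,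
    continuous_complex_mk (by fun_prop) (by fun_prop), fun t a b h => ?_, fun w => ?_⟩
  · obtain ⟨h2, h1⟩ := Complex.ext_iff.1 h
    simp only at h1 h2
    rw [h1] at h2
    have hp : 0 < (1 - (t : ℝ)) * ρ b.im + (t : ℝ) := by
      have h0 := t.2.1
      have h1 := t.2.2
      rcases h0.eq_or_lt with h | h
      · rw [← h]
        simpa using hpos b.im
      · have := mul_nonneg (sub_nonneg.2 h1) (hpos b.im).le
        linarith
    refine Complex.ext ?_ h1
    have := mul_right_cancel₀ hp.ne' (sub_right_injective h2)
    linarith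
  · exact ⟨Complex.ext (by simp [rowScale]) (by simp [rowScale]), Complex.ext (by simp) (by simp)⟩

theorem shear_shear (m m' : ℝ → ℝ) (h : ∀ x, m x + m' x = 0) (w : ℂ) :
    shear m (shear m' w) = w := by
  apply Complex.ext <;> simp only [shear]
  linarith [h w.re]

theorem rowScale_rowScale (ρ ρ' : ℝ → ℝ) (h : ∀ y, ρ y * ρ' y = 1) (w : ℂ) :
    rowScale ρ (rowScale ρ' w) = w := by
  apply Complex.ext <;> simp only [rowScale]
  linear_combination (w.re - 1) * h w.im

/-- The truncation of a real number to `[0, 1]`. -/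
def clamp (y : ℝ) : ℝ := max 0 (min 1 y)

theorem clamp_nonneg (y : ℝ) : 0 ≤ clamp y := le_max_left _ _

theorem clamp_le_one (y : ℝ) : clamp y ≤ 1 := max_le zero_le_one (min_le_left _ _)

theorem continuous_clamp : Continuous clamp := by
  unfold clamp
  fun_prop

/-- The scaling factor: the segment `[-c, 1]` is stretched to `[c - 1, 1]`, where `c = clamp y`. -/
def slideFactor (y : ℝ) : ℝ := (2 - clamp y) / (1 + clamp y)

theorem slideFactor_pos (y : ℝ) : 0 < slideFactor y :=
  div_pos (by linarith [clamp_le_one y]) (by linarith [clamp_nonneg y])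

theorem continuous_slideFactor : Continuous slideFactor := by
  refine Continuous.div ?_ ?_ fun y => by linarith [clamp_nonneg y]
  · exact continuous_const.sub continuous_clamp
  · exact continuous_const.add continuous_clamp

/-- The homeomorphism of the plane which takes `slideSource` to `slideTarget`, fixing the line
`re = 1` and shifting each of the three segments of the left boundary of `slideSource` to the
corresponding segment of the left boundary of `slideTarget`. After a shear these boundaries are
graphs over the imaginary axis, and each horizontal line can be mapped affinely. -/
def slidePlane (w : ℂ) : ℂ :=
  shear (fun x => |x| - 1) (rowScale slideFactor (shear (fun x => -min x 0) w))

/-- The inverse of `slidePlane`. -/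
def slidePlaneInv (w : ℂ) : ℂ :=
  shear (fun x => min x 0) (rowScale (fun y => (slideFactor y)⁻¹) (shear (fun x => 1 - |x|) w))

theorem slidePlaneInv_slidePlane (w : ℂ) : slidePlaneInv (slidePlane w) = w := by
  unfold slidePlaneInv slidePlane
  rw [shear_shear _ _ (by simp), rowScale_rowScale _ _
    (fun y => inv_mul_cancel₀ (slideFactor_pos y).ne'), shear_shear _ _ (by simp)]

theorem slidePlane_slidePlaneInv (w : ℂ) : slidePlane (slidePlaneInv w) = w := by
  unfold slidePlaneInv slidePlane
  rw [shear_shear _ _ (by simp), rowScale_rowScale _ _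
    (fun y => mul_inv_cancel₀ (slideFactor_pos y).ne'), shear_shear _ _ (by simp)]

theorem planeIsotopic_slidePlane : PlaneIsotopic slidePlane :=
  (planeIsotopic_shear (by fun_prop)).comp
    ((planeIsotopic_rowScale continuous_slideFactor slideFactor_pos).comp
      (planeIsotopic_shear (by fun_prop)))

theorem planeIsotopic_slidePlaneInv : PlaneIsotopic slidePlaneInv :=
  (planeIsotopic_shear (by fun_prop)).comp
    ((planeIsotopic_rowScale (continuous_slideFactor.inv₀ fun y => (slideFactor_pos y).ne')
      fun y => inv_pos.2 (slideFactor_pos y)).comp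
      (planeIsotopic_shear (by fun_prop)))

/-- The union of `[0, 1] × ℝ` and `[-1, 0] × [0, ∞)`. -/
def slideSource : Set ℂ := {w | w.re ≤ 1 ∧ -1 ≤ w.re ∧ (w.re < 0 → 0 ≤ w.im)}

/-- The union of `[0, 1] × ℝ` and `[-1, 0] × (-∞, 0]`. -/
def slideTarget : Set ℂ := {w | w.re ≤ 1 ∧ -1 ≤ w.re ∧ (w.re < 0 → w.im ≤ 0)}

theorem slidePlane_mem {w : ℂ} (hw : w ∈ slideSource) : slidePlane w ∈ slideTarget := by
  obtain ⟨x, y⟩ := w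
  obtain ⟨h1, h2, h3⟩ := hw
  simp only at h1 h2 h3
  simp only [slideTarget, slidePlane, shear, rowScale, Set.mem_ofPred_eq]
  set Y := y + -min x 0 with hY
  have hc : -clamp Y ≤ x := by
    rcases lt_or_ge x 0 with hx | hx
    · have : -x ≤ clamp Y := by
        rw [min_eq_left hx.le] at hY
        exact le_max_of_le_right (le_min (by linarith) (by linarith [h3 hx]))
      linarith
    · linarith [clamp_nonneg Y]
  have hc0 := clamp_nonneg Y
  have hc1 := clamp_le_one Y
  have hp : 0 < 1 + clamp Y := by linarith
  have hle : (1 - x) * slideFactor Y ≤ 2 - clamp Y := by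
    unfold slideFactor
    rw [mul_div_assoc', div_le_iff₀ hp]
    nlinarith
  have hge : 0 ≤ (1 - x) * slideFactor Y := mul_nonneg (by linarith) (slideFactor_pos Y).le
  refine ⟨by linarith, by linarith, fun hneg => ?_⟩
  rw [abs_of_neg hneg]
  rcases le_or_gt Y 1 with hY1 | hY1
  · have : Y ≤ clamp Y := le_max_of_le_right (le_min hY1 le_rfl)
    linarith
  · have : clamp Y = 1 := by
      unfold clamp
      rw [min_eq_left hY1.le]
      simp
    linarith

theorem slidePlaneInv_mem {w : ℂ} (hw : w ∈ slideTarget) : slidePlaneInv w ∈ slideSource := by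
  obtain ⟨x, y⟩ := w
  obtain ⟨h1, h2, h3⟩ := hw
  simp only at h1 h2 h3
  simp only [slideSource, slidePlaneInv, shear, rowScale, Set.mem_ofPred_eq]
  set Y := y + (1 - |x|) with hY
  have hc0 := clamp_nonneg Y
  have hc1 := clamp_le_one Y
  have hc : clamp Y - 1 ≤ x := by
    rcases lt_or_ge x 0 with hx | hx
    · have : clamp Y ≤ 1 + x := by
        rw [abs_of_neg hx] at hY
        exact max_le (by linarith) ((min_le_right _ _).trans (by linarith [h3 hx]))
      linarith
    · linarith
  have hp : 0 < 2 - clamp Y := by linarith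
  have hle : (1 - x) * (slideFactor Y)⁻¹ ≤ 1 + clamp Y := by
    unfold slideFactor
    rw [inv_div, mul_div_assoc', div_le_iff₀ hp]
    nlinarith
  have hge : 0 ≤ (1 - x) * (slideFactor Y)⁻¹ :=
    mul_nonneg (by linarith) (inv_pos.2 (slideFactor_pos Y)).le
  refine ⟨by linarith, by linarith, fun hneg => ?_⟩
  rw [min_eq_left hneg.le]
  rcases le_or_gt 0 Y with hY0 | hY0
  · have : clamp Y ≤ Y := max_le hY0 (min_le_right _ _)
    linarith
  · have : clamp Y = 0 := by
      unfold clamp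
      rw [min_eq_right (by linarith), max_eq_left hY0.le]
    linarith

theorem slidePlane_right (s : ℝ) : slidePlane ⟨1, s⟩ = ⟨1, s⟩ := by
  simp [slidePlane, shear, rowScale]

theorem slidePlane_upper {s : ℝ} (hs : 0 ≤ s) : slidePlane ⟨-1, s⟩ = ⟨0, s⟩ := by
  have : clamp (s + 1) = 1 := by
    unfold clamp
    rw [min_eq_left (by linarith)]
    simp
  have h2 : min (-1 : ℝ) 0 = -1 := by norm_num
  simp only [slidePlane, shear, rowScale, slideFactor, h2, neg_neg, this]
  norm_num

theorem slidePlane_middle {t : ℝ} (h0 : 0 ≤ t) (h1 : t ≤ 1) :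
    slidePlane ⟨t - 1, 0⟩ = ⟨-t, 0⟩ := by
  have h2 : min (t - 1 : ℝ) 0 = t - 1 := min_eq_left (by linarith)
  have h3 : clamp (0 + -(t - 1)) = 1 - t := by
    unfold clamp
    rw [min_eq_right (by linarith), max_eq_right (by linarith)]
    ring
  have h4 : 1 - (1 - (t - 1)) * ((2 - (1 - t)) / (1 + (1 - t))) = -t := by
    have : 1 + (1 - t) ≠ 0 := by linarith
    field_simp
    ring
  simp only [slidePlane, shear, rowScale, slideFactor, h2, h3, h4, abs_neg, abs_of_nonneg h0]
  apply Complex.ext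
  · rfl
  · simp

theorem slidePlane_lower {s : ℝ} (hs : 0 ≤ s) : slidePlane ⟨0, -s⟩ = ⟨-1, -s⟩ := by
  have : clamp (-s) = 0 := by
    unfold clamp
    rw [min_eq_right (by linarith), max_eq_left (by linarith)]
  simp only [slidePlane, shear, rowScale, slideFactor, min_self, neg_zero, add_zero, this]
  norm_num

end

section

namespace Graph

variable {G : Graph}

/-! ### Slides of ribbon structures -/

/-- The point with real coordinates `x`, `y` in the closed strip of `d`, the coordinates being
truncated to `[0, 1]` and `[0, ∞)`. -/
def stripPt (O : G.Ribbon) (d : G.D) (x y : ℝ) : (G.ribbonSpace O).carrier :=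
  stripMk O d (Set.projIcc 0 1 zero_le_one x) y.toNNReal

theorem continuous_stripPt (O : G.Ribbon) (d : G.D) :
    Continuous fun w : ℝ × ℝ => stripPt O d w.1 w.2 :=
  (continuous_stripMk O d).comp
    (f := fun w : ℝ × ℝ => (Set.projIcc 0 1 zero_le_one w.1, w.2.toNNReal)) (by fun_prop)

theorem stripPt_coe (O : G.Ribbon) (d : G.D) (t : unitInterval) (s : NNReal) :
    stripPt O d t s = stripMk O d t s := by
  simp [stripPt]

theorem stripPt_flip (O : G.Ribbon) (d : G.D) (x : ℝ) :
    stripPt O d x 0 = stripPt O (G.rev d) (1 - x) 0 := by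
  have h : Set.projIcc (0 : ℝ) 1 zero_le_one (1 - x) =
      unitInterval.symm (Set.projIcc 0 1 zero_le_one x) := by
    apply Subtype.ext
    rw [unitInterval.coe_symm_eq, Set.coe_projIcc, Set.coe_projIcc]
    rcases le_total x 0 with h | h
    · rw [min_eq_right (by linarith : x ≤ 1), min_eq_left (by linarith : 1 ≤ 1 - x), max_eq_left h]
      norm_num
    · rw [max_eq_right (le_min zero_le_one h)]
      rcases le_total x 1 with h' | h'
      · rw [min_eq_right h', min_eq_right (by linarith), max_eq_right (by linarith)]
      · rw [min_eq_left h', min_eq_right (by linarith), max_eq_left (by linarith)]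
        norm_num
  unfold stripPt
  rw [h, Real.toNNReal_zero]
  exact Quot.sound (.flip d _)

theorem stripPt_side (O : G.Ribbon) (d : G.D) (y : ℝ) :
    stripPt O d 1 y = stripPt O (O.next d) 0 y := by
  unfold stripPt
  simp only [Set.projIcc_left, Set.projIcc_right]
  exact Quot.sound (.side d _)

theorem stripPt_zero (O : G.Ribbon) (d : G.D) :
    stripPt O d 0 0 = Quot.mk _ (.inl (G.src d)) := by
  unfold stripPt
  simp only [Set.projIcc_left, Real.toNNReal_zero]
  exact Quot.sound (.start d)

theorem stripPt_eq_stripPoint {O : G.Ribbon} {d d' : G.D} {x y : ℝ} {w : ℂ} (hw : w ∈ openStrip)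
    (h : stripPt O d x y = G.stripPoint O d' w) : d = d' ∧ x = w.re ∧ y = w.im := by
  obtain ⟨a, b, c⟩ := stripMk_eq_stripPoint hw h
  obtain ⟨h1, h2, h3⟩ := hw
  refine ⟨a, ?_, ?_⟩
  · rw [Set.coe_projIcc] at b
    rw [← b] at h1 h2 ⊢
    rcases le_total x 0 with h | h
    · rw [max_eq_left ((min_le_right _ _).trans h)] at h1
      exact absurd h1 (lt_irrefl _)
    · rcases le_total x 1 with h' | h'
      · rw [min_eq_right h', max_eq_right h]
      · rw [min_eq_left h', max_eq_right zero_le_one] at h2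
        exact absurd h2 (lt_irrefl _)
  · rw [← c] at h3 ⊢
    rw [Real.coe_toNNReal']
    rcases le_total y 0 with h | h
    · simp [Real.toNNReal_of_nonpos h] at h3
    · rw [max_eq_left h]

open Classical in
/-- A region of the plane folded into a ribbon surface: the half plane `re ≥ 0` is mapped to the two
strips of the edge `b`, and the half plane `re < 0` to the strip of `a` by the coordinate change
`α`. -/
def fold (O : G.Ribbon) (a b : G.D) (α : ℂ → ℂ) (w : ℂ) : (G.ribbonSpace O).carrier :=
  if 0 ≤ w.re then
    if 0 ≤ w.im then stripPt O b w.re w.im else stripPt O (G.rev b) (1 - w.re) (-w.im)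
  else stripPt O a (α w).re (α w).im

theorem fold_upper (O : G.Ribbon) (a b : G.D) (α : ℂ → ℂ) {w : ℂ} (h : 0 ≤ w.re) (h' : 0 ≤ w.im) :
    fold O a b α w = stripPt O b w.re w.im := by
  rw [fold, if_pos h, if_pos h']

theorem fold_lower (O : G.Ribbon) (a b : G.D) (α : ℂ → ℂ) {w : ℂ} (h : 0 ≤ w.re) (h' : w.im ≤ 0) :
    fold O a b α w = stripPt O (G.rev b) (1 - w.re) (-w.im) := by
  rw [fold, if_pos h]
  split_ifs with h2
  · rw [le_antisymm h' h2, stripPt_flip, neg_zero]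
  · rfl

theorem continuousOn_fold {O : G.Ribbon} {a b : G.D} {α : ℂ → ℂ} (hα : Continuous α) {L : Set ℂ}
    (hL : IsClosed L)
    (h : ∀ w ∈ L, 0 ≤ w.re → fold O a b α w = stripPt O a (α w).re (α w).im) :
    ContinuousOn (fold O a b α) ({w | 0 ≤ w.re} ∪ L) := by
  classical
  refine ContinuousOn.union_of_isClosed ?_ ?_ (isClosed_le continuous_const Complex.continuous_re) hL
  · have hc : Continuous fun w : ℂ => if 0 ≤ w.im then stripPt O b w.re w.im
        else stripPt O (G.rev b) (1 - w.re) (-w.im) := by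
      refine Continuous.if_le ?_ ?_ continuous_const Complex.continuous_im fun w hw => ?_
      · exact (continuous_stripPt O b).comp (Complex.continuous_re.prodMk Complex.continuous_im)
      · exact (continuous_stripPt O (G.rev b)).comp
          (f := fun w : ℂ => (1 - w.re, -w.im)) (by fun_prop)
      · rw [← hw, stripPt_flip, neg_zero]
    exact hc.continuousOn.congr fun w hw => by rw [fold, if_pos (show 0 ≤ w.re from hw)]
  · have hc : Continuous fun w : ℂ => stripPt O a (α w).re (α w).im :=
      (continuous_stripPt O a).comp (f := fun w : ℂ => ((α w).re, (α w).im)) (by fun_prop)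
    refine hc.continuousOn.congr fun w hw => ?_
    by_cases h0 : 0 ≤ w.re
    · exact h w hw h0
    · rw [fold, if_neg h0]

/-- Near a point folded into an open strip, folding is isotopic to the identity. -/
theorem fold_local {O : G.Ribbon} {a b : G.D} {α : ℂ → ℂ} (hα : PlaneIsotopic α) {u : ℂ}
    {d' : G.D} {w' : ℂ} (hw' : w' ∈ openStrip) (h : fold O a b α u = G.stripPoint O d' w') :
    ∃ χ : ℂ → ℂ, PlaneIsotopic χ ∧ χ u = w' ∧
      ∀ᶠ v in nhds u, fold O a b α v = G.stripPoint O d' (χ v) := by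
  by_cases h0 : 0 ≤ u.re
  · by_cases h1 : 0 ≤ u.im
    · rw [fold_upper O a b α h0 h1] at h
      obtain ⟨rfl, h2, h3⟩ := stripPt_eq_stripPoint hw' h
      refine ⟨fun w => w, .id, Complex.ext h2 h3, ?_⟩
      have e1 : ∀ᶠ v : ℂ in nhds u, 0 < v.re :=
        Complex.continuous_re.continuousAt.eventually (lt_mem_nhds (h2 ▸ hw'.1))
      have e2 : ∀ᶠ v : ℂ in nhds u, 0 < v.im :=
        Complex.continuous_im.continuousAt.eventually (lt_mem_nhds (h3 ▸ hw'.2.2))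
      filter_upwards [e1, e2] with v hv hv'
      exact fold_upper O a b α hv.le hv'.le
    · rw [fold_lower O a b α h0 (not_le.1 h1).le] at h
      obtain ⟨rfl, h2, h3⟩ := stripPt_eq_stripPoint hw' h
      have e1 : ∀ᶠ v : ℂ in nhds u, 0 < v.re :=
        Complex.continuous_re.continuousAt.eventually
          (lt_mem_nhds (by linarith [hw'.2.1]))
      have e2 : ∀ᶠ v : ℂ in nhds u, v.im < 0 :=
        Complex.continuous_im.continuousAt.eventually (gt_mem_nhds (not_le.1 h1))
      refine ⟨fun w => -w + 1, (planeIsotopic_add 1).comp planeIsotopic_neg,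
        Complex.ext ?_ ?_, ?_⟩
      · simp [← h2]
        ring
      · simp [← h3]
      filter_upwards [e1, e2] with v hv hv'
      rw [fold_lower O a b α hv.le hv'.le]
      change _ = stripPt O (G.rev b) (-v + 1).re (-v + 1).im
      congr 1
      · simp
        ring
      · simp
  · have h' := h
    rw [fold, if_neg h0] at h'
    obtain ⟨rfl, h2, h3⟩ := stripPt_eq_stripPoint hw' h'
    refine ⟨α, hα, Complex.ext h2 h3, ?_⟩
    have e1 : ∀ᶠ v : ℂ in nhds u, v.re < 0 :=
      Complex.continuous_re.continuousAt.eventually (gt_mem_nhds (not_le.1 h0))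
    filter_upwards [e1] with v hv
    rw [fold, if_neg (not_le.2 hv)]
    rfl

open Classical in
/-- The map of pieces which moves the strips of `a` and of the edge `b` by the plane map `Φ`, after
placing them in the plane by `β` (for `a`) and by the standard chart (for `b`); the other strips are
not moved. -/
def slidePiece (O' : G.Ribbon) (a b : G.D) (α β Φ : ℂ → ℂ) :
    G.RPiece → (G.ribbonSpace O').carrier
  | .inl v => Quot.mk _ (.inl v)
  | .inr ⟨d, (t, s)⟩ =>
    if d = a then fold O' a b α (Φ (β ⟨t, s⟩))
    else if d = b then fold O' a b α (Φ ⟨t, s⟩)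
    else if d = G.rev b then fold O' a b α (Φ ⟨1 - t, -s⟩)
    else stripMk O' d t s

theorem slidePiece_first (O' : G.Ribbon) (a b : G.D) (α β Φ : ℂ → ℂ) (t : unitInterval)
    (s : NNReal) : slidePiece O' a b α β Φ (.inr ⟨a, (t, s)⟩) = fold O' a b α (Φ (β ⟨t, s⟩)) := by
  simp [slidePiece]

theorem slidePiece_second (O' : G.Ribbon) {a b : G.D} (α β Φ : ℂ → ℂ) (hab : b ≠ a)
    (t : unitInterval) (s : NNReal) :
    slidePiece O' a b α β Φ (.inr ⟨b, (t, s)⟩) = fold O' a b α (Φ ⟨t, s⟩) := by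
  simp [slidePiece, hab]

theorem slidePiece_rev (O' : G.Ribbon) {a b : G.D} (α β Φ : ℂ → ℂ) (hab : G.rev b ≠ a)
    (t : unitInterval) (s : NNReal) :
    slidePiece O' a b α β Φ (.inr ⟨G.rev b, (t, s)⟩) = fold O' a b α (Φ ⟨1 - t, -s⟩) := by
  simp [slidePiece, hab, G.rev_ne]

theorem slidePiece_other (O' : G.Ribbon) {a b d : G.D} (α β Φ : ℂ → ℂ) (h1 : d ≠ a) (h2 : d ≠ b)
    (h3 : d ≠ G.rev b) (t : unitInterval) (s : NNReal) :
    slidePiece O' a b α β Φ (.inr ⟨d, (t, s)⟩) = stripMk O' d t s := by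
  simp [slidePiece, h1, h2, h3]

theorem continuous_slidePiece {O' : G.Ribbon} {a b : G.D} {α β Φ : ℂ → ℂ} {Q Q' : Set ℂ}
    (hα : ContinuousOn (fold O' a b α) Q') (hβ : Continuous β) (hΦ : Continuous Φ)
    (hQ : ∀ w ∈ Q, Φ w ∈ Q') (h1 : ∀ (t : unitInterval) (s : NNReal), β ⟨t, s⟩ ∈ Q)
    (h2 : ∀ (t : unitInterval) (s : NNReal), (⟨t, s⟩ : ℂ) ∈ Q)
    (h3 : ∀ (t : unitInterval) (s : NNReal), (⟨1 - t, -s⟩ : ℂ) ∈ Q) :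
    Continuous (slidePiece O' a b α β Φ) := by
  have k1 : Continuous fun x : unitInterval × NNReal => (⟨x.1, x.2⟩ : ℂ) :=
    continuous_complex_mk (by fun_prop) (by fun_prop)
  have k2 : Continuous fun x : unitInterval × NNReal => (⟨1 - x.1, -x.2⟩ : ℂ) :=
    continuous_complex_mk (by fun_prop) (by fun_prop)
  rw [continuous_sum_dom]
  refine ⟨continuous_of_discreteTopology, continuous_sigma fun d => ?_⟩
  by_cases ha : d = a
  · subst ha
    exact (hα.comp_continuous (hΦ.comp (hβ.comp k1)) fun x => hQ _ (h1 x.1 x.2)).congr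
      fun x => (slidePiece_first O' d b α β Φ x.1 x.2).symm
  by_cases hb : d = b
  · subst hb
    exact (hα.comp_continuous (hΦ.comp k1) fun x => hQ _ (h2 x.1 x.2)).congr
      fun x => (slidePiece_second O' α β Φ ha x.1 x.2).symm
  by_cases hb' : d = G.rev b
  · subst hb'
    exact (hα.comp_continuous (hΦ.comp k2) fun x => hQ _ (h3 x.1 x.2)).congr
      fun x => (slidePiece_rev O' α β Φ ha x.1 x.2).symm
  · exact (continuous_stripMk O' d).congr
      fun x => (slidePiece_other O' α β Φ ha hb hb' x.1 x.2).symm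

/-- The local hypothesis of `isOriented_of_local` holds for maps assembled by `slidePiece`. -/
theorem slidePiece_local {O O' : G.Ribbon} {a b : G.D} {α β Φ : ℂ → ℂ} (hα : PlaneIsotopic α)
    (hβ : PlaneIsotopic β) (hΦ : PlaneIsotopic Φ) (hab : b ≠ a) (hab' : G.rev b ≠ a)
    (f : (G.ribbonSpace O).carrier → (G.ribbonSpace O').carrier)
    (hf : ∀ x, f (Quot.mk _ x) = slidePiece O' a b α β Φ x)
    (d : G.D) (w : ℂ) (hw : w ∈ openStrip) (d' : G.D) (w' : ℂ) (hw' : w' ∈ openStrip)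
    (h : f (G.stripPoint O d w) = G.stripPoint O' d' w') :
    ∃ χ : ℂ → ℂ, PlaneIsotopic χ ∧ χ w = w' ∧
      ∀ᶠ v in nhds w, f (G.stripPoint O d v) = G.stripPoint O' d' (χ v) := by
  have key : ∀ θ : ℂ → ℂ, PlaneIsotopic θ →
      (∀ v ∈ openStrip, f (G.stripPoint O d v) = fold O' a b α (Φ (θ v))) →
      ∃ χ : ℂ → ℂ, PlaneIsotopic χ ∧ χ w = w' ∧
        ∀ᶠ v in nhds w, f (G.stripPoint O d v) = G.stripPoint O' d' (χ v) := by
    intro θ hθ hv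
    obtain ⟨χ, hχ, h1, h2⟩ := fold_local (O := O') (a := a) (b := b) hα (u := Φ (θ w)) hw'
      (by rw [← hv w hw, h])
    refine ⟨fun v => χ (Φ (θ v)), hχ.comp (hΦ.comp hθ), h1, ?_⟩
    have hc : Continuous fun v => Φ (θ v) := hΦ.continuous.comp hθ.continuous
    filter_upwards [hc.continuousAt.eventually h2, isOpen_openStrip.mem_nhds hw] with v e1 e2
    rw [hv v e2, e1]
  have hcoord : ∀ v ∈ openStrip, (⟨(Set.projIcc (0 : ℝ) 1 zero_le_one v.re : ℝ),
      (v.im.toNNReal : ℝ)⟩ : ℂ) = v := by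
    intro v hv
    apply Complex.ext
    · simp [Set.projIcc_of_mem _ (⟨hv.1.le, hv.2.1.le⟩ : v.re ∈ Set.Icc (0 : ℝ) 1)]
    · simp [hv.2.2.le]
  by_cases ha : d = a
  · subst ha
    refine key β hβ fun v hv => ?_
    rw [stripPoint, hf, slidePiece_first, hcoord v hv]
  by_cases hb : d = b
  · subst hb
    refine key (fun v => v) .id fun v hv => ?_
    rw [stripPoint, hf, slidePiece_second _ _ _ _ hab, hcoord v hv]
  by_cases hb' : d = G.rev b
  · subst hb'
    refine key (fun v => -v + 1) ((planeIsotopic_add 1).comp planeIsotopic_neg) fun v hv => ?_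
    rw [stripPoint, hf, slidePiece_rev _ _ _ _ hab']
    congr 2
    have := hcoord v hv
    rw [Complex.ext_iff] at this ⊢
    simp only at this ⊢
    rw [this.1, this.2]
    constructor
    · simp
      ring
    · simp
  · have hid : ∀ v, f (G.stripPoint O d v) = G.stripPoint O' d v := fun v => by
      rw [stripPoint, hf, slidePiece_other _ _ _ _ ha hb hb']
      rfl
    rw [hid] at h
    obtain ⟨rfl, h2, h3⟩ := stripPt_eq_stripPoint (x := w.re) (y := w.im) hw' h
    exact ⟨fun v => v, .id, Complex.ext h2 h3, Filter.Eventually.of_forall hid⟩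

end Graph

end

section

namespace Graph

variable {G : Graph}

theorem stripPt_zero_zero {O : G.Ribbon} (hV : ∀ v, v = G.base) (d : G.D) :
    stripPt O d 0 0 = (G.ribbonSpace O).pt := by
  rw [stripPt_zero, hV (G.src d)]
  rfl

theorem stripPt_one_zero {O : G.Ribbon} (hV : ∀ v, v = G.base) (d : G.D) :
    stripPt O d 1 0 = (G.ribbonSpace O).pt := by
  rw [stripPt_side, stripPt_zero_zero hV]

theorem fold_second (O : G.Ribbon) (a b : G.D) (α : ℂ → ℂ) (t : unitInterval) (s : NNReal) :
    fold O a b α ⟨t, s⟩ = stripMk O b t s := by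
  rw [fold_upper O a b α t.2.1 s.coe_nonneg, ← stripPt_coe]

theorem fold_rev (O : G.Ribbon) (a b : G.D) (α : ℂ → ℂ) (t : unitInterval) (s : NNReal) :
    fold O a b α ⟨1 - t, -s⟩ = stripMk O (G.rev b) t s := by
  rw [fold_lower O a b α (sub_nonneg.2 t.2.2) (neg_nonpos.2 s.coe_nonneg), ← stripPt_coe]
  simp

/-- On a graph with one vertex, the ribbon structure `O'` is obtained from `O` by sliding an end of the
edge of `a` along the edge of `b`. In the boundary cycles, `a` is removed from its place before `b`
and inserted after `rev b`. The last four conditions spell this out, including the cases in which two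
of these places are adjacent. -/
structure IsSlide (O O' : G.Ribbon) (a b : G.D) : Prop where
  base : ∀ v, v = G.base
  ne : b ≠ a
  rev_ne : G.rev b ≠ a
  next_source : O.next a = b
  next_target : O'.next (G.rev b) = a
  next_rev : O.next (G.rev b) ≠ a → O'.next a = O.next (G.rev b)
  next_rev' : O.next (G.rev b) = a → O'.next a = b
  next_other : ∀ d, d ≠ a → d ≠ G.rev b → O.next d ≠ a → O'.next d = O.next d
  next_other' : ∀ d, d ≠ a → d ≠ G.rev b → O.next d = a → O'.next d = b

theorem fold_source {O : G.Ribbon} {a b : G.D} (h : O.next a = b) {w : ℂ} (h1 : w.re ≤ 0)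
    (h2 : 0 ≤ w.im) : fold O a b (fun w => w + 1) w = stripPt O a (w.re + 1) w.im := by
  by_cases h0 : 0 ≤ w.re
  · rw [fold_upper O a b _ h0 h2, le_antisymm h1 h0, zero_add, stripPt_side, h]
  · rw [fold, if_neg h0]
    simp

theorem fold_target {O : G.Ribbon} {a b : G.D} (h : O.next (G.rev b) = a) {w : ℂ} (h1 : w.re ≤ 0)
    (h2 : w.im ≤ 0) : fold O a b (fun w => -w) w = stripPt O a (-w.re) (-w.im) := by
  by_cases h0 : 0 ≤ w.re
  · rw [fold_lower O a b _ h0 h2, le_antisymm h1 h0, sub_zero, neg_zero, stripPt_side, h]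
  · rw [fold, if_neg h0]
    simp

/-- A map assembled by `slidePiece` is compatible with the gluing as soon as it fixes the edge of
`a` and the vertex, and matches the sides of consecutive strips. -/
theorem slidePiece_respects {O O' : G.Ribbon} {a b : G.D} {α β Φ : ℂ → ℂ}
    (hV : ∀ v, v = G.base) (hab : b ≠ a) (hab' : G.rev b ≠ a)
    (ha : ∀ t : unitInterval, slidePiece O' a b α β Φ (.inr ⟨a, (t, 0)⟩) = stripMk O' a t 0)
    (hb : slidePiece O' a b α β Φ (.inr ⟨b, (0, 0)⟩) = (G.ribbonSpace O').pt)
    (hb' : slidePiece O' a b α β Φ (.inr ⟨G.rev b, (0, 0)⟩) = (G.ribbonSpace O').pt)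
    (hside : ∀ (d : G.D) (s : NNReal), slidePiece O' a b α β Φ (.inr ⟨d, (1, s)⟩) =
      slidePiece O' a b α β Φ (.inr ⟨O.next d, (0, s)⟩))
    (x y : G.RPiece) (hxy : G.RGlue O x y) :
    slidePiece O' a b α β Φ x = slidePiece O' a b α β Φ y := by
  have hother : ∀ (d : G.D) (t : unitInterval), d ≠ b → d ≠ G.rev b →
      slidePiece O' a b α β Φ (.inr ⟨d, (t, 0)⟩) = stripMk O' d t 0 := by
    intro d t h1 h2
    by_cases h : d = a
    · rw [h, ha]
    · exact slidePiece_other O' α β Φ h h1 h2 t 0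
  have hpt : ∀ v, (Quot.mk (G.RGlue O') (.inl v)) = (G.ribbonSpace O').pt := fun v => by
    rw [hV v]
    rfl
  rcases hxy with d | ⟨d, t⟩ | ⟨d, s⟩
  · refine Eq.trans ?_ (hpt _).symm
    by_cases h1 : d = b
    · rw [h1, hb]
    by_cases h2 : d = G.rev b
    · rw [h2, hb']
    rw [hother d 0 h1 h2, ← stripPt_zero_zero hV d, ← stripPt_coe]
    simp
  · by_cases h1 : d = b
    · subst h1
      rw [slidePiece_second O' α β Φ hab, slidePiece_rev O' α β Φ hab']
      simp
    by_cases h2 : d = G.rev b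
    · subst h2
      rw [G.rev_rev, slidePiece_second O' α β Φ hab, slidePiece_rev O' α β Φ hab']
      simp
    have h3 : G.rev d ≠ b := fun h => h2 (by rw [← h, G.rev_rev])
    have h4 : G.rev d ≠ G.rev b := fun h => h1 (by rw [← G.rev_rev d, h, G.rev_rev])
    rw [hother d t h1 h2, hother _ _ h3 h4]
    exact Quot.sound (.flip d t)
  · exact hside d s

/-- On the union of the strips of `b`, `rev b` and `a`, laid out in the plane by `fold`, a map
assembled by `slidePiece` acts as `Φ`. -/
theorem slidePiece_fold {O O' : G.Ribbon} {a b : G.D} {α α' β Φ : ℂ → ℂ}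
    (hab : b ≠ a) (hab' : G.rev b ≠ a)
    (f : (G.ribbonSpace O).carrier → (G.ribbonSpace O').carrier)
    (hf : ∀ x, f (Quot.mk _ x) = slidePiece O' a b α β Φ x) {v : ℂ} (h1 : v.re ≤ 1)
    (h2 : v.re < 0 → 0 ≤ (α' v).re ∧ (α' v).re ≤ 1 ∧ 0 ≤ (α' v).im ∧ β (α' v) = v) :
    f (fold O a b α' v) = fold O' a b α (Φ v) := by
  have hmk : ∀ {x y : ℝ} (d : G.D), 0 ≤ x → x ≤ 1 → 0 ≤ y →
      ∃ (t : unitInterval) (s : NNReal), (t : ℝ) = x ∧ (s : ℝ) = y ∧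
        f (stripPt O d x y) = slidePiece O' a b α β Φ (.inr ⟨d, (t, s)⟩) := by
    intro x y d hx hx' hy
    refine ⟨⟨x, hx, hx'⟩, ⟨y, hy⟩, rfl, rfl, ?_⟩
    rw [← hf]
    exact congrArg f (stripPt_coe O d ⟨x, hx, hx'⟩ ⟨y, hy⟩)
  by_cases h0 : 0 ≤ v.re
  · rcases le_total 0 v.im with h3 | h3
    · obtain ⟨t, s, e1, e2, e3⟩ := hmk b h0 h1 h3
      rw [fold_upper O a b α' h0 h3, e3, slidePiece_second O' α β Φ hab, e1, e2]
    · obtain ⟨t, s, e1, e2, e3⟩ := hmk (G.rev b) (sub_nonneg.2 h1) (sub_le_self 1 h0)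
        (neg_nonneg.2 h3)
      rw [fold_lower O a b α' h0 h3, e3, slidePiece_rev O' α β Φ hab', e1, e2]
      simp
  · obtain ⟨h4, h5, h6, h7⟩ := h2 (not_le.1 h0)
    obtain ⟨t, s, e1, e2, e3⟩ := hmk a h4 h5 h6
    rw [fold, if_neg h0, e3, slidePiece_first, e1, e2, Complex.eta, h7]

/-- The maps assembled from mutually inverse plane maps `Φ`, `Φ'` are mutually inverse. -/
theorem slide_leftInverse {O O' : G.Ribbon} {a b : G.D} {α α' β β' Φ Φ' : ℂ → ℂ} {Q Q' : Set ℂ}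
    (hab : b ≠ a) (hab' : G.rev b ≠ a)
    (f : (G.ribbonSpace O).carrier → (G.ribbonSpace O').carrier)
    (hf : ∀ x, f (Quot.mk _ x) = slidePiece O' a b α β Φ x)
    (f' : (G.ribbonSpace O').carrier → (G.ribbonSpace O).carrier)
    (hf' : ∀ x, f' (Quot.mk _ x) = slidePiece O a b α' β' Φ' x)
    (hQ : ∀ w ∈ Q, Φ w ∈ Q') (hΦ : ∀ w, Φ' (Φ w) = w)
    (hQ' : ∀ v ∈ Q', v.re ≤ 1 ∧
      (v.re < 0 → 0 ≤ (α v).re ∧ (α v).re ≤ 1 ∧ 0 ≤ (α v).im ∧ β' (α v) = v))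
    (h1 : ∀ (t : unitInterval) (s : NNReal), β ⟨t, s⟩ ∈ Q)
    (h2 : ∀ (t : unitInterval) (s : NNReal), (⟨t, s⟩ : ℂ) ∈ Q)
    (h3 : ∀ (t : unitInterval) (s : NNReal), (⟨1 - t, -s⟩ : ℂ) ∈ Q)
    (hfold : ∀ (t : unitInterval) (s : NNReal), fold O a b α' (β ⟨t, s⟩) = stripMk O a t s)
    (hv : ∀ v, f' (Quot.mk _ (.inl v)) = Quot.mk _ (.inl v)) : Function.LeftInverse f' f := by
  have key : ∀ u ∈ Q, f' (fold O' a b α (Φ u)) = fold O a b α' u := fun u hu => by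
    rw [slidePiece_fold hab hab' f' hf' (hQ' _ (hQ u hu)).1 (hQ' _ (hQ u hu)).2, hΦ]
  intro x
  induction x using Quot.inductionOn with
  | h x =>
    rw [hf]
    rcases x with v | ⟨d, t, s⟩
    · exact hv v
    by_cases ha : d = a
    · subst ha
      rw [slidePiece_first, key _ (h1 t s), hfold]
      rfl
    by_cases hb : d = b
    · subst hb
      rw [slidePiece_second O' α β Φ hab, key _ (h2 t s), fold_second]
      rfl
    by_cases hb' : d = G.rev b
    · subst hb'
      rw [slidePiece_rev O' α β Φ hab', key _ (h3 t s), fold_rev]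
      rfl
    · rw [slidePiece_other O' α β Φ ha hb hb', stripMk, hf', slidePiece_other O α' β' Φ' ha hb hb']
      rfl

theorem mem_slideSource_upper (t : unitInterval) (s : NNReal) : (⟨t, s⟩ : ℂ) ∈ slideSource :=
  ⟨t.2.2, by linarith [t.2.1], fun _ => s.coe_nonneg⟩

theorem mem_slideSource_lower (t : unitInterval) (s : NNReal) :
    (⟨1 - t, -s⟩ : ℂ) ∈ slideSource :=
  ⟨by simpa using t.2.1, by have := t.2.2; simp only; linarith,
    fun h => absurd h (not_lt.2 (sub_nonneg.2 t.2.2))⟩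

theorem mem_slideTarget_upper (t : unitInterval) (s : NNReal) : (⟨t, s⟩ : ℂ) ∈ slideTarget :=
  ⟨t.2.2, by linarith [t.2.1], fun h => absurd h (not_lt.2 t.2.1)⟩

theorem mem_slideTarget_lower (t : unitInterval) (s : NNReal) :
    (⟨1 - t, -s⟩ : ℂ) ∈ slideTarget :=
  ⟨by simpa using t.2.1, by have := t.2.2; simp only; linarith,
    fun h => absurd h (not_lt.2 (sub_nonneg.2 t.2.2))⟩

theorem mem_slideSource_first (t : unitInterval) (s : NNReal) :
    (⟨t, s⟩ : ℂ) + -1 ∈ slideSource := by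
  have := t.2.1
  have := t.2.2
  refine ⟨?_, ?_, fun _ => ?_⟩ <;> simp <;> linarith

theorem mem_slideTarget_first (t : unitInterval) (s : NNReal) :
    -(⟨t, s⟩ : ℂ) ∈ slideTarget := by
  have := t.2.1
  have := t.2.2
  refine ⟨?_, ?_, fun _ => ?_⟩ <;> simp <;> linarith

theorem slidePlaneInv_eq {u v : ℂ} (h : slidePlane u = v) : slidePlaneInv v = u := by
  rw [← h, slidePlaneInv_slidePlane]

namespace IsSlide

variable {O O' : G.Ribbon} {a b : G.D}

theorem respects (h : IsSlide O O' a b) (x y : G.RPiece) (hxy : G.RGlue O x y) :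
    slidePiece O' a b (fun w => -w) (fun w => w + -1) slidePlane x =
      slidePiece O' a b (fun w => -w) (fun w => w + -1) slidePlane y := by
  classical
  have c0 : (((0 : unitInterval) : ℝ)) = 0 := rfl
  have c1 : (((1 : unitInterval) : ℝ)) = 1 := rfl
  have n0 : ((0 : NNReal) : ℝ) = 0 := rfl
  have hpl : ∀ x y : ℝ, (⟨x, y⟩ : ℂ) + -1 = ⟨x - 1, y⟩ := fun x y => by
    apply Complex.ext <;> simp [sub_eq_add_neg]
  -- the left side of the strip of `e`
  have hl : ∀ (e : G.D) (s : NNReal), e ≠ b →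
      slidePiece O' a b (fun w => -w) (fun w => w + -1) slidePlane (.inr ⟨e, (0, s)⟩) =
        if e = a then stripPt O' b 0 s else stripPt O' e 0 s := by
    intro e s he
    split_ifs with h1
    · subst h1
      rw [slidePiece_first, hpl, c0, zero_sub, slidePlane_upper s.coe_nonneg,
        fold_upper _ _ _ _ le_rfl s.coe_nonneg]
    by_cases h2 : e = G.rev b
    · subst h2
      rw [slidePiece_rev _ _ _ _ h1, c0, sub_zero, slidePlane_right,
        fold_lower _ _ _ _ zero_le_one (neg_nonpos.2 s.coe_nonneg)]
      simp
    · rw [slidePiece_other _ _ _ _ h1 he h2, ← stripPt_coe, c0]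
  -- the right side of the strip of `e`
  have hr : ∀ (e : G.D) (s : NNReal), e ≠ a →
      slidePiece O' a b (fun w => -w) (fun w => w + -1) slidePlane (.inr ⟨e, (1, s)⟩) =
        if e = G.rev b then stripPt O' a 1 s else stripPt O' e 1 s := by
    intro e s he
    split_ifs with h1
    · subst h1
      rw [slidePiece_rev _ _ _ _ he, c1, sub_self, slidePlane_lower s.coe_nonneg,
        fold_target h.next_target (by simp) (by simp)]
      simp
    by_cases h2 : e = b
    · subst h2
      rw [slidePiece_second _ _ _ _ he, c1, slidePlane_right, fold_upper _ _ _ _ zero_le_one s.coe_nonneg]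
    · rw [slidePiece_other _ _ _ _ he h2 h1, ← stripPt_coe, c1]
  refine slidePiece_respects h.base h.ne h.rev_ne (fun t => ?_) ?_ ?_ (fun d s => ?_) x y hxy
  · rw [slidePiece_first, hpl, n0, slidePlane_middle t.2.1 t.2.2,
      fold_target h.next_target (by simpa using t.2.1) le_rfl, ← stripPt_coe]
    simp
  · have := slidePlane_lower le_rfl
    rw [neg_zero] at this
    rw [slidePiece_second _ _ _ _ h.ne, c0, n0, this,
      fold_target h.next_target (by simp) le_rfl]
    simpa using stripPt_one_zero h.base a
  · rw [hl _ _ (G.rev_ne b), if_neg h.rev_ne]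
    exact stripPt_zero_zero h.base _
  · by_cases hd : d = a
    · subst hd
      rw [h.next_source, slidePiece_first, slidePiece_second _ _ _ _ h.ne, hpl, c0, c1, sub_self]
    have hdb : O.next d ≠ b := fun hh => hd (by
      have e : O.next d = O.next a := hh.trans h.next_source.symm
      have e' := O.succ.injective e
      rw [← G.rev_rev d, e', G.rev_rev])
    rw [hr d s hd, hl _ _ hdb]
    by_cases h1 : d = G.rev b
    · subst h1
      rw [if_pos rfl]
      split_ifs with h2
      · rw [stripPt_side, h.next_rev' h2]
      · rw [stripPt_side, h.next_rev h2]
    · rw [if_neg h1]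
      split_ifs with h2
      · rw [stripPt_side, h.next_other' d hd h1 h2]
      · rw [stripPt_side, h.next_other d hd h1 h2]

theorem respects_symm (h : IsSlide O O' a b) (x y : G.RPiece) (hxy : G.RGlue O' x y) :
    slidePiece O a b (fun w => w + 1) (fun w => -w) slidePlaneInv x =
      slidePiece O a b (fun w => w + 1) (fun w => -w) slidePlaneInv y := by
  classical
  have c0 : (((0 : unitInterval) : ℝ)) = 0 := rfl
  have c1 : (((1 : unitInterval) : ℝ)) = 1 := rfl
  have n0 : ((0 : NNReal) : ℝ) = 0 := rfl
  have hpl : ∀ x y : ℝ, -(⟨x, y⟩ : ℂ) = ⟨-x, -y⟩ := fun x y => rfl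
  have hl : ∀ (e : G.D) (s : NNReal), e ≠ a →
      slidePiece O a b (fun w => w + 1) (fun w => -w) slidePlaneInv (.inr ⟨e, (0, s)⟩) =
        if e = b then stripPt O a 0 s else stripPt O e 0 s := by
    intro e s he
    split_ifs with h1
    · subst h1
      rw [slidePiece_second _ _ _ _ he, c0, slidePlaneInv_eq (slidePlane_upper s.coe_nonneg),
        fold_source h.next_source (by simp) s.coe_nonneg]
      simp
    by_cases h2 : e = G.rev b
    · subst h2
      rw [slidePiece_rev _ _ _ _ he, c0, sub_zero, slidePlaneInv_eq (slidePlane_right _),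
        fold_lower _ _ _ _ zero_le_one (neg_nonpos.2 s.coe_nonneg)]
      simp
    · rw [slidePiece_other _ _ _ _ he h1 h2, ← stripPt_coe, c0]
  have hr : ∀ (e : G.D) (s : NNReal), e ≠ G.rev b →
      slidePiece O a b (fun w => w + 1) (fun w => -w) slidePlaneInv (.inr ⟨e, (1, s)⟩) =
        if e = a then stripPt O (G.rev b) 1 s else stripPt O e 1 s := by
    intro e s he
    split_ifs with h1
    · subst h1
      rw [slidePiece_first, hpl, c1, slidePlaneInv_eq (slidePlane_lower s.coe_nonneg),
        fold_lower _ _ _ _ le_rfl (neg_nonpos.2 s.coe_nonneg)]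
      simp
    by_cases h2 : e = b
    · subst h2
      rw [slidePiece_second _ _ _ _ h1, c1, slidePlaneInv_eq (slidePlane_right _),
        fold_upper _ _ _ _ zero_le_one s.coe_nonneg]
    · rw [slidePiece_other _ _ _ _ h1 h2 he, ← stripPt_coe, c1]
  refine slidePiece_respects h.base h.ne h.rev_ne (fun t => ?_) ?_ ?_ (fun d s => ?_) x y hxy
  · rw [slidePiece_first, hpl, n0, neg_zero, slidePlaneInv_eq (slidePlane_middle t.2.1 t.2.2),
      fold_source h.next_source (by simpa using t.2.2) le_rfl, ← stripPt_coe]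
    simp
  · rw [hl _ _ h.ne, if_pos rfl]
    exact stripPt_zero_zero h.base _
  · rw [hl _ _ h.rev_ne, if_neg (G.rev_ne b)]
    exact stripPt_zero_zero h.base _
  · by_cases hd : d = G.rev b
    · subst hd
      rw [h.next_target, slidePiece_first, slidePiece_rev _ _ _ _ h.rev_ne, hpl, c0, c1, sub_self,
        neg_zero]
    have hda : O'.next d ≠ a := fun hh => hd (by
      have e' := O'.succ.injective (hh.trans h.next_target.symm)
      rw [← G.rev_rev d, e', G.rev_rev])
    rw [hr d s hd, hl _ _ hda]
    -- the strip whose right side is carried to the right side of the strip of `d`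
    by_cases h1 : d = a
    · subst h1
      rw [if_pos rfl, stripPt_side]
      by_cases h2 : O.next (G.rev b) = d
      · rw [h.next_rev' h2, if_pos rfl, h2]
      · rw [h.next_rev h2, if_neg]
        intro h3
        have e' := O.succ.injective (h3.trans h.next_source.symm)
        exact h.rev_ne (by rw [← G.rev_rev (G.rev b), e', G.rev_rev])
    · rw [if_neg h1, stripPt_side]
      by_cases h2 : O.next d = a
      · rw [h.next_other' d h1 hd h2, if_pos rfl, h2]
      · rw [h.next_other d h1 hd h2, if_neg]
        intro h3
        have e' := O.succ.injective (h3.trans h.next_source.symm)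
        exact h1 (by rw [← G.rev_rev d, e', G.rev_rev])

/-- The homeomorphism of ribbon surfaces given by a slide. -/
def homeo (h : IsSlide O O' a b) : (G.ribbonSpace O).carrier ≃ₜ (G.ribbonSpace O').carrier where
  toFun := Quot.lift _ h.respects
  invFun := Quot.lift _ h.respects_symm
  left_inv := by
    refine slide_leftInverse h.ne h.rev_ne _ (fun _ => rfl) _ (fun _ => rfl)
      (fun w => slidePlane_mem) slidePlaneInv_slidePlane (fun v hv => ⟨hv.1, fun h0 => ?_⟩)
      mem_slideSource_first mem_slideSource_upper mem_slideSource_lower (fun t s => ?_)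
      fun _ => rfl
    · have h1 := hv.2.1
      have h2 := hv.2.2 h0
      refine ⟨?_, ?_, ?_, by simp⟩ <;> simp <;> linarith
    · rw [fold_source h.next_source (by simpa using t.2.2) (by simp), ← stripPt_coe]
      simp
  right_inv := by
    refine slide_leftInverse h.ne h.rev_ne _ (fun _ => rfl) _ (fun _ => rfl)
      (fun w => slidePlaneInv_mem) slidePlane_slidePlaneInv (fun v hv => ⟨hv.1, fun h0 => ?_⟩)
      mem_slideTarget_first mem_slideTarget_upper mem_slideTarget_lower (fun t s => ?_)
      fun _ => rfl
    · have h1 := hv.2.1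
      have h2 := hv.2.2 h0
      refine ⟨?_, ?_, ?_, by simp⟩ <;> simp <;> linarith
    · rw [fold_target h.next_target (by simpa using t.2.1) (by simp), ← stripPt_coe]
      simp
  continuous_toFun := by
    refine continuous_quot_lift _ (continuous_slidePiece (Q := slideSource)
      (continuousOn_fold (L := {w | w.re ≤ 0} ∩ {w | w.im ≤ 0}) continuous_neg ?_ fun w hw h0 => ?_)
      (by fun_prop) planeIsotopic_slidePlane.continuous (fun w hw => ?_) mem_slideSource_first
      mem_slideSource_upper mem_slideSource_lower)
    · exact (isClosed_le Complex.continuous_re continuous_const).inter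
        (isClosed_le Complex.continuous_im continuous_const)
    · rw [fold_target h.next_target hw.1 hw.2]
      simp
    · have := slidePlane_mem hw
      rcases le_or_gt 0 (slidePlane w).re with h0 | h0
      · exact .inl h0
      · exact .inr ⟨h0.le, this.2.2 h0⟩
  continuous_invFun := by
    refine continuous_quot_lift _ (continuous_slidePiece (Q := slideTarget)
      (continuousOn_fold (L := {w | w.re ≤ 0} ∩ {w | 0 ≤ w.im}) (by fun_prop) ?_
        fun w hw h0 => ?_)
      (by fun_prop) planeIsotopic_slidePlaneInv.continuous (fun w hw => ?_) mem_slideTarget_first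
      mem_slideTarget_upper mem_slideTarget_lower)
    · exact (isClosed_le Complex.continuous_re continuous_const).inter
        (isClosed_le continuous_const Complex.continuous_im)
    · rw [fold_source h.next_source hw.1 hw.2]
      simp
    · have := slidePlaneInv_mem hw
      rcases le_or_gt 0 (slidePlaneInv w).re with h0 | h0
      · exact .inl h0
      · exact .inr ⟨h0.le, this.2.2 h0⟩

/-- A slide does not change the oriented ribbon surface. -/
theorem isOriented_homeo (h : IsSlide O O' a b) :
    IsOriented (G.ribbonSurface O) (G.ribbonSurface O') h.homeo := by
  have hG : ∀ v, ∃ d, G.src d = v := fun v => ⟨a, (h.base _).trans (h.base v).symm⟩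
  refine isOriented_of_local hG hG h.homeo rfl ?_ ?_
  · exact slidePiece_local (α := fun w => -w) (β := fun w => w + -1) planeIsotopic_neg
      (planeIsotopic_add (-1)) planeIsotopic_slidePlane h.ne h.rev_ne _ fun _ => rfl
  · exact slidePiece_local (α := fun w => w + 1) (β := fun w => -w) (planeIsotopic_add 1)
      planeIsotopic_neg planeIsotopic_slidePlaneInv h.ne h.rev_ne _ fun _ => rfl

end IsSlide

end Graph

end

section

/-! ### One vertex ribbon graphs as cyclic words -/

theorem IsOriented.refl (S : OrientedSpace) : IsOriented S S (Homeomorph.refl _) :=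
  ⟨rfl, fun _ => Iff.rfl⟩

theorem IsOriented.trans {S T U : OrientedSpace} {h : S.space.carrier ≃ₜ T.space.carrier}
    {k : T.space.carrier ≃ₜ U.space.carrier} (hh : IsOriented S T h) (hk : IsOriented T U k) :
    IsOriented S U (h.trans k) :=
  ⟨(congrArg k hh.map_pt).trans hk.map_pt, fun e =>
    (hh.positive_iff e).trans (hk.positive_iff (h ∘ e))⟩

theorem IsOriented.symm {S T : OrientedSpace} {h : S.space.carrier ≃ₜ T.space.carrier}
    (hh : IsOriented S T h) : IsOriented T S h.symm := by
  refine ⟨?_, fun e => ?_⟩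
  · rw [Homeomorph.symm_apply_eq, hh.map_pt]
  · rw [hh.positive_iff (h.symm ∘ e)]
    have : h ∘ h.symm ∘ e = e := funext fun x => h.apply_symm_apply (e x)
    rw [this]

section FormPerm

variable {α : Type*} [DecidableEq α]

theorem formPerm_of_infix {L A B : List α} {u v : α} (hL : L.Nodup) (h : L = A ++ u :: v :: B) :
    L.formPerm u = v := by
  have h1 : A.length + 1 < L.length := by simp [h]
  have := List.formPerm_apply_lt_getElem L hL A.length h1
  simpa [h] using this

theorem formPerm_last {L A : List α} {u v : α} (hL : L.Nodup) (h : L = v :: (A ++ [u])) :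
    L.formPerm u = v := by
  subst h
  simp

theorem exists_formPerm_pow {L : List α} (hL : L.Nodup) {d e : α} (hd : d ∈ L) (he : e ∈ L) :
    ∃ n : ℕ, (L.formPerm ^ n) d = e := by
  obtain ⟨i, hi, rfl⟩ := List.getElem_of_mem hd
  obtain ⟨j, hj, rfl⟩ := List.getElem_of_mem he
  refine ⟨L.length - i + j, ?_⟩
  rw [List.formPerm_pow_apply_getElem L hL _ i hi]
  congr 1
  rw [← Nat.add_assoc, Nat.add_sub_cancel' hi.le, Nat.add_mod_left, Nat.mod_eq_of_lt hj]

end FormPerm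

variable {E : Type}

/-- The inverse of a letter. -/
def bar (d : E × Bool) : E × Bool := (d.1, !d.2)

@[simp] theorem bar_bar (d : E × Bool) : bar (bar d) = d := by simp [bar]

/-- The elementary moves of cyclic words: rotation, and sliding a letter `x` along the edge `d`. -/
inductive SlideStep : List (E × Bool) → List (E × Bool) → Prop
  | rotate (A B : List (E × Bool)) : SlideStep (A ++ B) (B ++ A)
  | slide (d x : E × Bool) (M N : List (E × Bool)) :
      SlideStep (d :: x :: (M ++ bar d :: N)) (d :: (M ++ x :: bar d :: N))

/-- The equivalence of words generated by the elementary moves. -/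
def SlideEq : List (E × Bool) → List (E × Bool) → Prop := Relation.EqvGen SlideStep

theorem SlideStep.perm {L L' : List (E × Bool)} (h : SlideStep L L') : L.Perm L' := by
  rcases h with ⟨A, B⟩ | ⟨d, x, M, N⟩
  · exact List.perm_append_comm
  · exact (List.perm_middle.symm).cons d

theorem SlideEq.perm {L L' : List (E × Bool)} (h : SlideEq L L') : L.Perm L' := by
  induction h with
  | rel _ _ h => exact h.perm
  | refl => exact .refl _
  | symm _ _ _ ih => exact ih.symm
  | trans _ _ _ _ _ ih ih' => exact ih.trans ih'

variable [Fintype E] [DecidableEq E]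

/-- The ribbon structure on a rose with a given cyclic sequence of half edges. -/
def listRibbon (L : List (E × Bool)) (hL : L.Nodup) (hm : ∀ d, d ∈ L) :
    (Graph.rose E).Ribbon where
  succ := L.formPerm
  src_succ _ := rfl
  cyclic d e _ := by
    obtain ⟨n, hn⟩ := exists_formPerm_pow hL (hm d) (hm e)
    exact ⟨n, (congrArg (fun σ : Equiv.Perm (E × Bool) => σ d) (zpow_natCast L.formPerm n)).trans hn⟩

/-- Moving the letter `x` from the place after `d` to the place before `bar d` is a slide. -/
theorem isSlide_of_words {d x : E × Bool} {M N : List (E × Bool)}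
    {O O' : (Graph.rose E).Ribbon}
    (hL : (d :: x :: (M ++ bar d :: N)).Nodup) (hL' : (d :: (M ++ x :: bar d :: N)).Nodup)
    (hm : ∀ e, e ∈ (d :: x :: (M ++ bar d :: N)))
    (hO : O.succ = (d :: x :: (M ++ bar d :: N)).formPerm)
    (hO' : O'.succ = (d :: (M ++ x :: bar d :: N)).formPerm) :
    (Graph.rose E).IsSlide O O' (bar d) x := by
  have hn : ∀ e : E × Bool, O.next e = (d :: x :: (M ++ bar d :: N)).formPerm (bar e) :=
    fun e => by rw [← hO]; rfl
  have hn' : ∀ e : E × Bool, O'.next e = (d :: (M ++ x :: bar d :: N)).formPerm (bar e) :=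
    fun e => by rw [← hO']; rfl
  have hrev : ∀ e : E × Bool, (Graph.rose E).rev e = bar e := fun _ => rfl
  have hxd : x ≠ bar d := by
    rintro rfl
    simp at hL
  have hdx : x ≠ d := by
    rintro rfl
    simp at hL
  -- the successors of the letters other than `d` and `x`
  have hz : ∀ z, z ≠ d → z ≠ x →
      ((d :: x :: (M ++ bar d :: N)).formPerm z ≠ bar d →
        (d :: (M ++ x :: bar d :: N)).formPerm z = (d :: x :: (M ++ bar d :: N)).formPerm z) ∧
      ((d :: x :: (M ++ bar d :: N)).formPerm z = bar d →
        (d :: (M ++ x :: bar d :: N)).formPerm z = x) := by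
    intro z hzd hzx
    have key : ∀ y, (d :: x :: (M ++ bar d :: N)).formPerm z = y →
        (d :: (M ++ x :: bar d :: N)).formPerm z = y → y ≠ bar d →
        ((d :: x :: (M ++ bar d :: N)).formPerm z ≠ bar d →
        (d :: (M ++ x :: bar d :: N)).formPerm z = (d :: x :: (M ++ bar d :: N)).formPerm z) ∧
      ((d :: x :: (M ++ bar d :: N)).formPerm z = bar d →
        (d :: (M ++ x :: bar d :: N)).formPerm z = x) := by
      intro y h1 h2 h3
      exact ⟨fun _ => h2.trans h1.symm, fun h => absurd (h1.symm.trans h) h3⟩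
    have hdd : d ≠ bar d := by
      rintro h
      rw [← h] at hL
      simp at hL
    have hmem := hm z
    simp only [List.mem_cons, List.mem_append, hzd, hzx, false_or] at hmem
    rcases hmem with hM | hd | hN
    · obtain ⟨M₁, M₂, rfl⟩ := List.append_of_mem hM
      rcases M₂ with _ | ⟨m, M₂⟩
      · have h1 : (d :: x :: (M₁ ++ [z] ++ bar d :: N)).formPerm z = bar d :=
          formPerm_of_infix hL (A := d :: x :: M₁) (B := N) (by simp)
        have h2 : (d :: (M₁ ++ [z] ++ x :: bar d :: N)).formPerm z = x :=
          formPerm_of_infix hL' (A := d :: M₁) (B := bar d :: N) (by simp)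
        exact ⟨fun h => absurd h1 h, fun _ => h2⟩
      · refine key m ?_ ?_ ?_
        · exact formPerm_of_infix hL (A := d :: x :: M₁) (B := M₂ ++ bar d :: N) (by simp)
        · exact formPerm_of_infix hL' (A := d :: M₁) (B := M₂ ++ x :: bar d :: N) (by simp)
        · rintro rfl
          simp [List.nodup_append] at hL
    · subst hd
      rcases N with _ | ⟨m, N⟩
      · exact key d (formPerm_last hL (A := x :: M) (by simp))
          (formPerm_last hL' (A := M ++ [x]) (by simp)) hdd
      · refine key m ?_ ?_ ?_
        · exact formPerm_of_infix hL (A := d :: x :: M) (B := N) (by simp)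
        · exact formPerm_of_infix hL' (A := d :: M ++ [x]) (B := N) (by simp)
        · rintro rfl
          simp [List.nodup_append] at hL
    · obtain ⟨N₁, N₂, rfl⟩ := List.append_of_mem hN
      rcases N₂ with _ | ⟨m, N₂⟩
      · exact key d (formPerm_last hL (A := x :: M ++ bar d :: N₁) (by simp))
          (formPerm_last hL' (A := M ++ x :: bar d :: N₁) (by simp)) hdd
      · refine key m ?_ ?_ ?_
        · exact formPerm_of_infix hL (A := d :: x :: M ++ bar d :: N₁) (B := N₂) (by simp)
        · exact formPerm_of_infix hL' (A := d :: M ++ x :: bar d :: N₁) (B := N₂) (by simp)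
        · rintro rfl
          simp [List.nodup_append] at hL
  have hbarne : ∀ e : E × Bool, ∀ y, e ≠ bar y → bar e ≠ y := by
    rintro e y h rfl
    exact h (bar_bar e).symm
  constructor
  · exact fun v => rfl
  · exact hxd
  · rw [hrev]
    intro h
    exact hdx (by rw [← bar_bar x, h, bar_bar])
  · rw [hn, bar_bar]
    exact formPerm_of_infix hL (A := []) (B := M ++ bar d :: N) (by simp)
  · change O'.next (bar x) = bar d
    rw [hn', bar_bar]
    exact formPerm_of_infix hL' (A := d :: M) (B := N) (by simp)
  · change O.next (bar x) ≠ bar d → O'.next (bar d) = O.next (bar x)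
    rw [hn, hn', bar_bar, bar_bar]
    rcases M with _ | ⟨m, M⟩
    · intro h
      exact absurd (formPerm_of_infix hL (A := [d]) (B := N) (by simp)) h
    · intro _
      rw [formPerm_of_infix hL' (A := []) (B := M ++ x :: bar d :: N) (v := m) (by simp),
        formPerm_of_infix hL (A := [d]) (B := M ++ bar d :: N) (v := m) (by simp)]
  · change O.next (bar x) = bar d → O'.next (bar d) = x
    rw [hn, hn', bar_bar, bar_bar]
    rcases M with _ | ⟨m, M⟩
    · intro _
      exact formPerm_of_infix hL' (A := []) (B := bar d :: N) (by simp)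
    · rw [formPerm_of_infix hL (A := [d]) (B := M ++ bar d :: N) (v := m) (by simp)]
      rintro rfl
      simp [List.nodup_append] at hL
  · intro (e : E × Bool) h1 h2 h3
    rw [hn] at h3
    rw [hn, hn']
    exact (hz _ (hbarne e d h1) (hbarne e x h2)).1 h3
  · intro (e : E × Bool) h1 h2 h3
    rw [hn] at h3
    rw [hn']
    exact (hz _ (hbarne e d h1) (hbarne e x h2)).2 h3

/-- Equivalent words have homeomorphic ribbon surfaces. -/
theorem SlideEq.exists_homeo {L L' : List (E × Bool)} (h : SlideEq L L') (hL : L.Nodup)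
    (hm : ∀ d, d ∈ L) (hL' : L'.Nodup) (hm' : ∀ d, d ∈ L') :
    ∃ k, IsOriented ((Graph.rose E).ribbonSurface (listRibbon L hL hm))
      ((Graph.rose E).ribbonSurface (listRibbon L' hL' hm')) k := by
  induction h with
  | rel L L' h =>
    rcases h with ⟨A, B⟩ | ⟨d, x, M, N⟩
    · have : listRibbon (A ++ B) hL hm = listRibbon (B ++ A) hL' hm' := by
        unfold listRibbon
        congr 1
        exact List.formPerm_eq_of_isRotated hL List.isRotated_append
      rw [this]
      exact ⟨_, IsOriented.refl _⟩
    · exact ⟨_, (isSlide_of_words hL hL' hm rfl rfl).isOriented_homeo⟩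
  | refl => exact ⟨_, IsOriented.refl _⟩
  | symm L L' _ ih =>
    obtain ⟨k, hk⟩ := ih hL' hm' hL hm
    exact ⟨_, hk.symm⟩
  | trans L L' L'' h _ ih ih' =>
    have hp : L.Perm L' := SlideEq.perm h
    obtain ⟨k, hk⟩ := ih hL hm (hp.nodup hL) fun d => hp.mem_iff.1 (hm d)
    obtain ⟨k', hk'⟩ := ih' (hp.nodup hL) (fun d => hp.mem_iff.1 (hm d)) hL' hm'
    exact ⟨_, hk.trans hk'⟩

end

section

/-! ### Normal forms of cyclic words -/

namespace SlideEq

variable {E : Type} {L L' L'' : List (E × Bool)}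

theorem refl (L : List (E × Bool)) : SlideEq L L := Relation.EqvGen.refl L

theorem symm (h : SlideEq L L') : SlideEq L' L := Relation.EqvGen.symm _ _ h

theorem trans (h : SlideEq L L') (h' : SlideEq L' L'') : SlideEq L L'' :=
  Relation.EqvGen.trans _ _ _ h h'

theorem rotate (A B : List (E × Bool)) : SlideEq (A ++ B) (B ++ A) := .rel _ _ (.rotate A B)

/-- The letters between the two ends of an edge may be rotated. -/
theorem inner (d : E × Bool) (X M N : List (E × Bool)) :
    SlideEq (d :: (X ++ (M ++ bar d :: N))) (d :: (M ++ (X ++ bar d :: N))) := by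
  induction X generalizing M with
  | nil => exact refl _
  | cons x X ih =>
    have h1 : SlideEq (d :: ((x :: X) ++ (M ++ bar d :: N))) (d :: (X ++ (M ++ x :: bar d :: N))) := by
      have : SlideEq (d :: x :: ((X ++ M) ++ bar d :: N)) (d :: ((X ++ M) ++ x :: bar d :: N)) :=
        .rel _ _ (.slide d x (X ++ M) N)
      simpa using this
    refine trans h1 ?_
    simpa using ih (M ++ [x])

/-- The letters outside of the two ends of an edge may be rotated. -/
theorem outer (d : E × Bool) (P M N : List (E × Bool)) :
    SlideEq (d :: (P ++ bar d :: (M ++ N))) (d :: (P ++ bar d :: (N ++ M))) := by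
  have h1 : ∀ A : List (E × Bool), SlideEq (d :: (P ++ bar d :: A)) (bar d :: (A ++ d :: P)) :=
    fun A => by simpa using rotate (d :: P) (bar d :: A)
  refine (h1 _).trans (trans ?_ (h1 _).symm)
  have := inner (bar d) M N P
  simpa using this

/-- A pair of edges with linked ends can be made into a block. -/
theorem handle (x y : E × Bool) (P Q R S : List (E × Bool)) :
    SlideEq (x :: (P ++ y :: (Q ++ bar x :: (R ++ bar y :: S))))
      (x :: y :: bar x :: bar y :: (S ++ (R ++ (Q ++ P)))) := by
  have h1 : SlideEq (x :: (P ++ y :: (Q ++ bar x :: (R ++ bar y :: S))))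
      (x :: y :: (Q ++ (P ++ bar x :: (R ++ bar y :: S)))) := by
    simpa using inner x P (y :: Q) (R ++ bar y :: S)
  have r : ∀ A : List (E × Bool), SlideEq (x :: A) (A ++ [x]) := fun A => rotate [x] A
  have h2 : SlideEq (x :: y :: (Q ++ (P ++ bar x :: (R ++ bar y :: S))))
      (x :: y :: bar x :: (R ++ (Q ++ (P ++ bar y :: S)))) := by
    refine (r _).trans (trans ?_ (r _).symm)
    simpa using inner y (Q ++ P) (bar x :: R) (S ++ [x])
  have h3 : SlideEq (x :: y :: bar x :: (R ++ (Q ++ (P ++ bar y :: S))))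
      (x :: y :: bar x :: bar y :: (S ++ (R ++ (Q ++ P)))) := by
    simpa using outer x [y] (R ++ (Q ++ P)) (bar y :: S)
  exact h1.trans (h2.trans h3)

end SlideEq

variable {E : Type}

/-- A word which may be moved to any place of any cyclic word containing it. -/
def Movable (X : List (E × Bool)) : Prop := ∀ M N, SlideEq (X ++ (M ++ N)) (X ++ (N ++ M))

theorem movable_nil : Movable ([] : List (E × Bool)) := fun M N => SlideEq.rotate M N

theorem Movable.append {X Y : List (E × Bool)} (hX : Movable X) (hY : Movable Y) :
    Movable (X ++ Y) := by
  intro M N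
  have h1 : SlideEq (X ++ Y ++ (M ++ N)) (Y ++ (M ++ (N ++ X))) := by
    simpa using SlideEq.rotate X (Y ++ (M ++ N))
  have h2 : SlideEq (Y ++ (M ++ (N ++ X))) (Y ++ (N ++ (X ++ M))) := by
    simpa using hY M (N ++ X)
  have h3 : SlideEq (Y ++ (N ++ (X ++ M))) (X ++ (M ++ (Y ++ N))) := by
    simpa using SlideEq.rotate (Y ++ N) (X ++ M)
  have h4 : SlideEq (X ++ (M ++ (Y ++ N))) (X ++ (N ++ (M ++ Y))) := by
    simpa using hX (M ++ Y) N
  have h5 : SlideEq (X ++ (N ++ (M ++ Y))) (Y ++ (X ++ (N ++ M))) := by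
    simpa using SlideEq.rotate (X ++ (N ++ M)) Y
  have h6 : SlideEq (Y ++ (X ++ (N ++ M))) (Y ++ (N ++ (M ++ X))) := by
    simpa using hY X (N ++ M)
  have h7 : SlideEq (Y ++ (N ++ (M ++ X))) (X ++ Y ++ (N ++ M)) := by
    simpa using SlideEq.rotate (Y ++ (N ++ M)) X
  exact h1.trans (h2.trans (h3.trans (h4.trans (h5.trans (h6.trans h7)))))

/-- The letter of an edge, in its positive direction. -/
abbrev pos (x : E) : E × Bool := (x, true)

/-- The letter of an edge, in its negative direction. -/
abbrev neg (x : E) : E × Bool := (x, false)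

@[simp] theorem bar_pos (x : E) : bar (pos x) = neg x := rfl

@[simp] theorem bar_neg (x : E) : bar (neg x) = pos x := rfl

/-- The blocks of the standard words: a loop around a puncture, or a handle. -/
inductive Block (E : Type)
  | puncture (a : E) : Block E
  | handle (x y : E) : Block E

/-- The word of a block. -/
def Block.word : Block E → List (E × Bool)
  | .puncture a => [pos a, neg a]
  | .handle x y => [pos x, pos y, neg x, neg y]

/-- A block closes up on itself, so it can be slid along any other edge. -/
theorem Block.movable (b : Block E) : Movable b.word := by
  intro M N
  rcases b with a | ⟨x, y⟩
  · exact SlideEq.outer (pos a) [] M N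
  · have h1 : SlideEq (pos x :: (M ++ pos y :: neg x :: neg y :: N))
        (pos x :: pos y :: neg x :: neg y :: (N ++ M)) := by
      simpa using SlideEq.handle (pos x) (pos y) M [] [] N
    have r : ∀ A : List (E × Bool), SlideEq (pos x :: A) (A ++ [pos x]) :=
      fun A => SlideEq.rotate [pos x] A
    have h2 : SlideEq (pos x :: (M ++ pos y :: neg x :: neg y :: N))
        (pos x :: pos y :: neg x :: neg y :: (M ++ N)) := by
      refine (r _).trans (SlideEq.trans ?_ (r _).symm)
      refine SlideEq.trans (L' := pos y :: neg x :: neg y :: (N ++ (pos x :: M))) ?_ ?_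
      · simpa using SlideEq.rotate M (pos y :: neg x :: neg y :: (N ++ [pos x]))
      · simpa using SlideEq.outer (pos y) [neg x] (N ++ [pos x]) M
    exact h2.symm.trans h1

/-- The word of a sequence of blocks. -/
def blockWord (bs : List (Block E)) : List (E × Bool) := bs.flatMap Block.word

theorem movable_blockWord (bs : List (Block E)) : Movable (blockWord bs) := by
  induction bs with
  | nil => exact movable_nil
  | cons b bs ih =>
    simpa [blockWord] using b.movable.append ih

/-- Blocks may be permuted. -/
theorem SlideEq.append_right_blockWord {bs bs' : List (Block E)} (h : bs.Perm bs')
    (N : List (E × Bool)) : SlideEq (blockWord bs ++ N) (blockWord bs' ++ N) := by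
  induction h generalizing N with
  | nil => exact .refl _
  | @cons b bs bs' _ ih =>
    have h1 : ∀ bs : List (Block E), SlideEq (blockWord (b :: bs) ++ N)
        (blockWord bs ++ (N ++ b.word)) := fun bs => by
      simpa [blockWord] using SlideEq.rotate b.word (blockWord bs ++ N)
    exact (h1 _).trans ((ih _).trans (h1 _).symm)
  | swap a b bs =>
    have h1 : SlideEq (blockWord (b :: a :: bs) ++ N) (b.word ++ (blockWord bs ++ (N ++ a.word))) := by
      simpa [blockWord] using b.movable a.word (blockWord bs ++ N)
    have h2 : SlideEq (b.word ++ (blockWord bs ++ (N ++ a.word)))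
        (blockWord (a :: b :: bs) ++ N) := by
      simpa [blockWord] using SlideEq.rotate (b.word ++ (blockWord bs ++ N)) a.word
    exact h1.trans h2
  | trans _ _ ih ih' => exact (ih N).trans (ih' N)

/-- The stages in the construction of the words of the family. Each stage adds four edges, forming two
handles, or two loops around punctures to the word of the previous stages. With bit `false` all new
letters follow that word, with bit `true` new edges have their ends on different sides of it. A
`core` stage is an alternative first stage, whose bit selects one of two interlaced words. -/
inductive Stage (E : Type)
  | core (x y z w : E) (bit : Bool) : Stage E
  | handles (x y z w : E) (bit : Bool) : Stage E
  | punctures (a b : E) (bit : Bool) : Stage E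

/-- The blocks into which the edges of a stage can be slid. -/
def Stage.blocks : Stage E → List (Block E)
  | .core x y z w _ => [.handle x y, .handle z w]
  | .handles x y z w _ => [.handle x y, .handle z w]
  | .punctures a b _ => [.puncture a, .puncture b]

/-- The word obtained by adding a stage to a word. -/
def Stage.extend (X : List (E × Bool)) : Stage E → List (E × Bool)
  | .core x y z w false => X ++ [pos x, pos y, neg z, neg w, neg x, neg y, pos z, pos w]
  | .core x y z w true => X ++ [pos x, pos y, pos z, pos w, neg z, neg x, neg y, neg w]
  | .handles x y z w false => X ++ [pos x, pos y, neg x, neg y, pos z, pos w, neg z, neg w]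
  | .handles x y z w true =>
      [pos z, pos y, neg x, neg y] ++ (X ++ [pos w, neg z, neg w, pos x])
  | .punctures a b false => X ++ [pos a, neg a, pos b, neg b]
  | .punctures a b true => pos a :: (X ++ [neg a, pos b, neg b])

/-- The word of a sequence of stages. -/
def stageWord (l : List (Stage E)) : List (E × Bool) := l.foldl Stage.extend []

theorem stageWord_concat (l : List (Stage E)) (s : Stage E) :
    stageWord (l ++ [s]) = s.extend (stageWord l) := by
  simp [stageWord]

/-- The edges of a stage can be slid off the word of the previous stages, to form blocks of their
own. -/
theorem Stage.slideEq_extend (s : Stage E) {X : List (E × Bool)} {bs : List (Block E)}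
    (h : ∀ N, SlideEq (X ++ N) (blockWord bs ++ N)) (N : List (E × Bool)) :
    SlideEq (s.extend X ++ N) (blockWord (bs ++ s.blocks) ++ N) := by
  have hX : Movable X := fun M N =>
    (h _).trans ((movable_blockWord bs M N).trans (h _).symm)
  have hb : SlideEq (X ++ (blockWord s.blocks ++ N)) (blockWord (bs ++ s.blocks) ++ N) := by
    simpa [blockWord] using h (blockWord s.blocks ++ N)
  refine SlideEq.trans ?_ hb
  have hrot : ∀ A : List (E × Bool), SlideEq (X ++ A) (A ++ X) := fun A => SlideEq.rotate X A
  rcases s with ⟨x, y, z, w, _ | _⟩ | ⟨x, y, z, w, _ | _⟩ | ⟨a, b, _ | _⟩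
  · simp only [Stage.extend, Stage.blocks, blockWord, List.append_assoc]
    refine (hrot _).trans (SlideEq.trans ?_ (hrot _).symm)
    refine SlideEq.trans (L' := pos x :: pos y :: neg x :: neg y ::
      ([pos z, pos w] ++ (N ++ X) ++ [neg z, neg w])) ?_ ?_
    · simpa using SlideEq.handle (pos x) (pos y) [] [neg z, neg w] [] (pos z :: pos w :: (N ++ X))
    refine SlideEq.trans (L' := pos z :: pos w :: neg z :: neg w ::
      (blockWord [Block.handle x y] ++ (N ++ X))) ?_ ?_
    · refine SlideEq.trans (L' := pos z :: pos w :: (N ++ X ++ neg z :: neg w ::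
        blockWord [Block.handle x y])) ?_ ?_
      · simpa [blockWord, Block.word] using SlideEq.rotate [pos x, pos y, neg x, neg y]
          ([pos z, pos w] ++ (N ++ X) ++ [neg z, neg w])
      · simpa using SlideEq.handle (pos z) (pos w) [] (N ++ X) [] (blockWord [Block.handle x y])
    · simpa [blockWord, Block.word] using SlideEq.append_right_blockWord
        (List.Perm.swap (Block.handle x y) (Block.handle z w) []) (N ++ X)
  · simp only [Stage.extend, Stage.blocks, blockWord, List.append_assoc]
    refine (hrot _).trans (SlideEq.trans ?_ (hrot _).symm)
    refine SlideEq.trans (L' := pos x :: pos y :: neg x :: neg y ::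
      ((neg w :: (N ++ X)) ++ [pos z, pos w, neg z])) ?_ ?_
    · simpa using SlideEq.handle (pos x) (pos y) [] [pos z, pos w, neg z] [] (neg w :: (N ++ X))
    refine SlideEq.trans (L' := pos z :: pos w :: neg z :: neg w ::
      ((N ++ X) ++ blockWord [Block.handle x y])) ?_ ?_
    · refine SlideEq.trans (L' := pos z :: pos w :: neg z :: (blockWord [Block.handle x y] ++
        neg w :: (N ++ X))) ?_ ?_
      · simpa [blockWord, Block.word] using SlideEq.rotate
          ([pos x, pos y, neg x, neg y, neg w] ++ (N ++ X)) [pos z, pos w, neg z]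
      · simpa using SlideEq.handle (pos z) (pos w) [] [] (blockWord [Block.handle x y]) (N ++ X)
    · simpa [blockWord, Block.word] using SlideEq.rotate
        ([pos z, pos w, neg z, neg w] ++ (N ++ X)) [pos x, pos y, neg x, neg y]
  · simpa [Stage.extend, Stage.blocks, blockWord, Block.word] using SlideEq.refl _
  · simp only [Stage.extend, Stage.blocks, blockWord, List.append_assoc]
    refine SlideEq.trans (L' := pos z :: pos w :: neg z :: neg w ::
      (pos x :: (N ++ (pos y :: neg x :: neg y :: X)))) ?_ ?_
    · simpa using SlideEq.handle (pos z) (pos w) ([pos y, neg x, neg y] ++ X) [] [] (pos x :: N)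
    refine SlideEq.trans (L' := pos x :: pos y :: neg x :: neg y ::
      ((X ++ blockWord [Block.handle z w]) ++ N)) ?_ ?_
    · refine SlideEq.trans (L' := pos x :: (N ++ (pos y :: neg x :: neg y ::
        (X ++ blockWord [Block.handle z w])))) ?_ ?_
      · simpa [blockWord, Block.word] using SlideEq.rotate [pos z, pos w, neg z, neg w]
          (pos x :: (N ++ (pos y :: neg x :: neg y :: X)))
      · simpa using SlideEq.handle (pos x) (pos y) N [] [] (X ++ blockWord [Block.handle z w])
    · refine SlideEq.trans (L' := X ++ (blockWord [Block.handle z w] ++ N ++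
        blockWord [Block.handle x y])) ?_ ?_
      · simpa [blockWord, Block.word] using SlideEq.rotate [pos x, pos y, neg x, neg y]
          ((X ++ blockWord [Block.handle z w]) ++ N)
      · simpa [blockWord, Block.word] using
          hX (blockWord [Block.handle z w] ++ N) (blockWord [Block.handle x y])
  · simpa [Stage.extend, Stage.blocks, blockWord, Block.word] using SlideEq.refl _
  · simp only [Stage.extend, Stage.blocks, blockWord]
    refine SlideEq.trans (L' := X ++ ([neg a, pos b, neg b] ++ N ++ [pos a])) ?_ ?_
    · simpa using SlideEq.rotate [pos a] (X ++ ([neg a, pos b, neg b] ++ N))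
    · simpa [Block.word] using hX ([neg a, pos b, neg b] ++ N) [pos a]

/-- The words of the family can be slid to words of blocks. -/
theorem slideEq_stageWord (l : List (Stage E)) (N : List (E × Bool)) :
    SlideEq (stageWord l ++ N) (blockWord (l.flatMap Stage.blocks) ++ N) := by
  induction l using List.reverseRecOn generalizing N with
  | nil => exact .refl _
  | append_singleton l s ih =>
    rw [stageWord_concat, List.flatMap_append]
    simpa using s.slideEq_extend ih N

end

section

/-! ### Conjugacy of cyclically reduced words -/

section Conjugacy

variable {α : Type*}

theorem isCyclicallyReduced_rotate_one {a : α × Bool} {u : List (α × Bool)}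
    (h : FreeGroup.IsCyclicallyReduced (a :: u)) : FreeGroup.IsCyclicallyReduced (u ++ [a]) := by
  refine ⟨?_, ?_⟩
  · unfold FreeGroup.IsReduced
    rw [List.isChain_append]
    refine ⟨h.1.infix ⟨[a], [], by simp⟩, List.isChain_singleton a, ?_⟩
    intro x hx y hy hxy
    rcases List.eq_nil_or_concat u with rfl | ⟨u', b, rfl⟩
    · simp at hx
    · have := h.2
      rw [List.concat_eq_append, ← List.cons_append] at this
      rw [List.concat_eq_append] at hx
      simp at hx hy
      subst hx hy
      exact this _ List.getLast?_concat _ (by simp) hxy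
  · rcases u with _ | ⟨b, u⟩
    · simp
    · have := h.1
      rw [FreeGroup.IsReduced, List.isChain_cons_cons] at this
      simp only [List.cons_append, List.head?_cons]
      rw [← List.cons_append, List.getLast?_concat]
      rintro _ ⟨⟩ _ ⟨⟩
      exact this.1

theorem isCyclicallyReduced_rotate_one' {a : α × Bool} {u : List (α × Bool)}
    (h : FreeGroup.IsCyclicallyReduced (u ++ [a])) : FreeGroup.IsCyclicallyReduced (a :: u) := by
  have key : ∀ n (u : List (α × Bool)), FreeGroup.IsCyclicallyReduced u →
      FreeGroup.IsCyclicallyReduced (u.rotate n) := by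
    intro n
    induction n with
    | zero => simp
    | succ n ih =>
      intro u hu
      rcases u with _ | ⟨b, u⟩
      · simp
      · rw [List.rotate_cons_succ]
        exact ih _ (isCyclicallyReduced_rotate_one hu)
  have := key u.length _ h
  rwa [List.rotate_append_length_eq, List.singleton_append] at this

theorem letter_eq_of_not {a b : α × Bool} (h : ¬ (a.1 = b.1 → a.2 = b.2)) : b = (a.1, !a.2) := by
  rcases a with ⟨a, _ | _⟩ <;> rcases b with ⟨b, _ | _⟩ <;> simp_all

/-- Conjugating a cyclically reduced word by a reduced one either rotates it or gives a word
which is not cyclically reduced. -/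
theorem isRotated_of_conj {u v g : List (α × Bool)} (hu : FreeGroup.IsCyclicallyReduced u)
    (hv : FreeGroup.IsCyclicallyReduced v) (hg : FreeGroup.IsReduced g)
    (h : FreeGroup.mk g * FreeGroup.mk u * (FreeGroup.mk g)⁻¹ = FreeGroup.mk v) : u ~r v := by
  classical
  have hred : ∀ {a b : List (α × Bool)}, FreeGroup.IsReduced a → FreeGroup.IsReduced b →
      FreeGroup.mk a = FreeGroup.mk b → a = b := by
    intro a b ha hb hab
    rw [← ha.reduce_eq, ← hb.reduce_eq]
    exact FreeGroup.reduce.sound hab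
  rcases eq_or_ne u [] with rfl | hne
  · rw [← FreeGroup.one_eq_mk, mul_one, mul_inv_cancel] at h
    rw [hred FreeGroup.IsReduced.nil hv.1 h]
  induction g using List.reverseRecOn generalizing u with
  | nil =>
    rw [← FreeGroup.one_eq_mk, one_mul, inv_one, mul_one] at h
    rw [hred hu.1 hv.1 h]
  | append_singleton g c ih =>
    have hg' : FreeGroup.IsReduced g := hg.infix ⟨[], [c], by simp⟩
    have hcc : ∀ c : α × Bool, FreeGroup.mk [(c.1, !c.2)] = (FreeGroup.mk [c])⁻¹ := fun c => by
      rw [FreeGroup.inv_mk]; rfl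
    rw [← FreeGroup.mul_mk, mul_inv_rev] at h
    by_cases h1 : ∀ b ∈ u.head?, c.1 = b.1 → c.2 = b.2
    · by_cases h2 : ∀ l ∈ u.getLast?, l.1 = c.1 → l.2 = !c.2
      · -- nothing cancels
        exfalso
        have hr : FreeGroup.IsReduced (g ++ [c] ++ (u ++ FreeGroup.invRev (g ++ [c]))) := by
          unfold FreeGroup.IsReduced
          have hinv : FreeGroup.IsReduced (FreeGroup.invRev (g ++ [c])) := by
            rw [FreeGroup.isReduced_iff_reduce_eq, FreeGroup.reduce_invRev, hg.reduce_eq]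
          refine List.isChain_append.2 ⟨hg, List.isChain_append.2 ⟨hu.1, hinv, ?_⟩, ?_⟩
          · intro l hl b hb hlb
            simp [FreeGroup.invRev] at hb
            subst hb
            exact h2 l hl hlb
          · intro l hl b hb
            rw [List.getLast?_concat] at hl
            cases hl
            rw [List.head?_append_of_ne_nil _ hne] at hb
            exact h1 b hb
        have := hred hr hv.1 (by
          rw [← h, ← FreeGroup.mul_mk, ← FreeGroup.mul_mk, ← FreeGroup.mul_mk, ← FreeGroup.inv_mk,
            ← FreeGroup.mul_mk, mul_inv_rev]
          simp only [mul_assoc])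
        subst this
        have hv2 := hv.2
        rcases hgc : g ++ [c] with _ | ⟨a, g'⟩
        · simp at hgc
        · rw [hgc, FreeGroup.invRev_cons, ← List.append_assoc, ← List.append_assoc] at hv2
          have := hv2 (a.1, !a.2) List.getLast?_concat a (by simp) rfl
          simp at this
      · -- the last letter of `u` is `c`
        push Not at h2
        obtain ⟨l, hl, h3, h4⟩ := h2
        have hlc : l = c := by
          rcases l with ⟨l, _ | _⟩ <;> rcases c with ⟨c, _ | _⟩ <;> simp_all
        subst hlc
        obtain ⟨u', rfl⟩ : ∃ u', u = u' ++ [l] := by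
          rcases List.eq_nil_or_concat u with rfl | ⟨u', b, rfl⟩
          · simp at hl
          · simp at hl
            exact ⟨u', by simp [hl]⟩
        refine List.IsRotated.trans ?_ (ih (u := l :: u') (isCyclicallyReduced_rotate_one' hu) hg' ?_
          (by simp))
        · exact List.isRotated_append
        · rw [← h, ← List.singleton_append, ← FreeGroup.mul_mk, ← FreeGroup.mul_mk]
          group
    · -- the first letter of `u` is the inverse of `c`
      push Not at h1
      obtain ⟨b, hb, h3⟩ := h1
      have hbc := letter_eq_of_not (a := c) (b := b) (by simpa using h3)
      subst hbc
      obtain ⟨u', rfl⟩ : ∃ u', u = (c.1, !c.2) :: u' := by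
        rcases u with _ | ⟨b, u'⟩
        · simp at hb
        · simp at hb
          exact ⟨u', by rw [hb]⟩
      refine List.IsRotated.trans ?_ (ih (u := u' ++ [(c.1, !c.2)])
        (isCyclicallyReduced_rotate_one hu) hg' ?_ (by simp))
      · exact List.isRotated_append (l := [_])
      · rw [← h, ← List.singleton_append (l := u'), ← FreeGroup.mul_mk, ← FreeGroup.mul_mk, hcc]
        group

/-- Cyclically reduced words which are conjugate in the free group are rotations of each other. -/
theorem isRotated_of_isConj {u v : List (α × Bool)} (hu : FreeGroup.IsCyclicallyReduced u)
    (hv : FreeGroup.IsCyclicallyReduced v) (h : IsConj (FreeGroup.mk u) (FreeGroup.mk v)) :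
    u ~r v := by
  classical
  obtain ⟨g, hg⟩ := isConj_iff.1 h
  refine isRotated_of_conj hu hv (FreeGroup.isReduced_toWord (x := g)) ?_
  rwa [FreeGroup.mk_toWord]

end Conjugacy

section Orbits

variable {E : Type}

/-- The first `ℓ` letters of the orbit of a letter. -/
def orbitWord (ν : E × Bool → E × Bool) (d : E × Bool) (ℓ : ℕ) : List (E × Bool) :=
  (List.range ℓ).map fun i => ν^[i] d

@[simp] theorem length_orbitWord (ν : E × Bool → E × Bool) (d : E × Bool) (ℓ : ℕ) :
    (orbitWord ν d ℓ).length = ℓ := by simp [orbitWord]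

/-- A closed orbit without backtracking gives a cyclically reduced word. -/
theorem isCyclicallyReduced_orbitWord {ν : E × Bool → E × Bool} (hν : ∀ d, ν d ≠ bar d)
    {d : E × Bool} {ℓ : ℕ} (hd : ν^[ℓ] d = d) :
    FreeGroup.IsCyclicallyReduced (orbitWord ν d ℓ) := by
  have hν' : ∀ e : E × Bool, e.1 = (ν e).1 → e.2 = (ν e).2 := by
    intro e
    by_contra h
    exact hν e (letter_eq_of_not h)
  refine ⟨?_, ?_⟩
  · unfold FreeGroup.IsReduced orbitWord
    rw [List.isChain_map, List.isChain_iff_getElem]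
    intro i hi
    simp only [List.getElem_range, Function.iterate_succ_apply']
    exact hν' _
  · rcases ℓ with _ | ℓ
    · simp [orbitWord]
    · intro a ha b hb
      have h1 : a = ν^[ℓ] d := by
        rw [orbitWord, List.range_succ] at ha
        simp at ha
        exact ha.symm
      have h2 : b = d := by
        rw [orbitWord, List.range_succ_eq_map] at hb
        simp at hb
        exact hb.symm
      rw [Function.iterate_succ_apply', ← h1] at hd
      rw [h2, ← hd]
      exact hν' a

/-- If closed orbits of two maps without backtracking give conjugate words, then the orbits
coincide. -/
theorem apply_eq_of_isConj {ν N : E × Bool → E × Bool} (hν : ∀ d, ν d ≠ bar d)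
    (hN : ∀ d, N d ≠ bar d) {d d₀ : E × Bool} {ℓ L : ℕ} (hℓ : 0 < ℓ) (hd : ν^[ℓ] d = d)
    (hd₀ : N^[L] d₀ = d₀)
    (h : IsConj (FreeGroup.mk (orbitWord ν d ℓ)) (FreeGroup.mk (orbitWord N d₀ L))) :
    ν d = N d := by
  obtain ⟨k, hk⟩ := (isRotated_of_isConj (isCyclicallyReduced_orbitWord hν hd)
    (isCyclicallyReduced_orbitWord hN hd₀) h).symm
  have hL : L = ℓ := by simpa using congrArg List.length hk
  subst hL
  have h1 : ∀ i, i < L → ν^[i] d = N^[i + k] d₀ := by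
    intro i hi
    have h2 : ((orbitWord N d₀ L).rotate k)[i]'(by simpa) = (orbitWord ν d L)[i]'(by simpa) := by
      simp only [hk]
    rw [List.getElem_rotate] at h2
    simp only [orbitWord, List.getElem_map, List.getElem_range, List.length_map,
      List.length_range] at h2
    rw [← h2]
    exact Function.IsPeriodicPt.iterate_mod_apply hd₀ _
  have h0 := h1 0 hℓ
  rw [Function.iterate_zero_apply, Nat.zero_add] at h0
  rw [h0, ← Function.iterate_succ_apply' N, ← h0]
  rcases Nat.lt_or_ge 1 L with hL | hL
  · have := h1 1 hL
    rwa [Function.iterate_one, Nat.add_comm] at this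
  · obtain rfl : L = 1 := by omega
    rw [Function.iterate_one] at hd hd₀
    rw [hd, h0, Function.iterate_succ_apply, hd₀]

end Orbits

end

section

/-! ### Holonomy of principal coverings with two charts -/

section Holonomy

open Topology

/-- Transition data of a principal covering with two charts: open sets `U` and `V` which cover the
base, and a locally constant transition function on their intersection. -/
structure TwoCharts (B G : Type) [TopologicalSpace B] [TopologicalSpace G] where
  U : Set B
  V : Set B
  isOpen_U : IsOpen U
  isOpen_V : IsOpen V
  cover : ∀ x, x ∈ U ∨ x ∈ V
  τ : B → G
  continuousOn_τ : ContinuousOn τ (U ∩ V)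

namespace TwoCharts

variable {B G : Type} [TopologicalSpace B] [TopologicalSpace G] (C : TwoCharts B G)

/-- The chart domain with a given index. -/
def chart (i : Bool) : Set B := cond i C.V C.U

/-- The transition function from a chart to the chart `U`. -/
def trans [One G] (i : Bool) (x : B) : G := cond i (C.τ x) 1

/-- A lift of `f` to the covering, given by its coordinates `a` in the chart `U` and `b` in the
chart `V`. -/
structure IsLift [Group G] {Z : Type} [TopologicalSpace Z] (f : Z → B) (a b : Z → G) : Prop where
  continuousOn_U : ContinuousOn a (f ⁻¹' C.U)
  continuousOn_V : ContinuousOn b (f ⁻¹' C.V)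
  eq_mul : ∀ z, f z ∈ C.U → f z ∈ C.V → a z = b z * C.τ (f z)

open Classical in
/-- A chart around a point. -/
def index (x : B) : Bool := decide (x ∉ C.U)

theorem mem_chart_index (x : B) : x ∈ C.chart (C.index x) := by
  by_cases h : x ∈ C.U
  · simp [chart, index, h]
  · simpa [chart, index, h] using (C.cover x).resolve_left h

theorem isOpen_chart (i : Bool) : IsOpen (C.chart i) := by
  cases i
  · exact C.isOpen_U
  · exact C.isOpen_V

variable [Group G] [DiscreteTopology G]

theorem continuousOn_coord (i j : Bool) :
    ContinuousOn (fun p : B × G => p.2 * C.trans i p.1 * (C.trans j p.1)⁻¹)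
      ((C.chart i ∩ C.chart j) ×ˢ Set.univ) := by
  have h : ∀ k l : Bool, k ≠ l → (C.chart k ∩ C.chart l) ×ˢ (Set.univ : Set G) ⊆
      Prod.fst ⁻¹' (C.U ∩ C.V) := by
    rintro (_ | _) (_ | _) hkl ⟨x, y⟩ ⟨⟨h1, h2⟩, -⟩
    · exact absurd rfl hkl
    · exact ⟨h1, h2⟩
    · exact ⟨h2, h1⟩
    · exact absurd rfl hkl
  have hτ : ∀ k l : Bool, k ≠ l → ContinuousOn (fun p : B × G => C.τ p.1)
      ((C.chart k ∩ C.chart l) ×ˢ (Set.univ : Set G)) := fun k l hkl =>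
    C.continuousOn_τ.comp continuous_fst.continuousOn (h k l hkl)
  rcases i with _ | _ <;> rcases j with _ | _
  · simpa [trans] using continuous_snd.continuousOn
  · simp only [trans, cond_false, cond_true, mul_one]
    exact continuous_snd.continuousOn.mul (hτ _ _ (by simp)).inv
  · simp only [trans, cond_false, cond_true, inv_one, mul_one]
    exact continuous_snd.continuousOn.mul (hτ _ _ (by simp))
  · simpa [trans] using continuous_snd.continuousOn

/-- The principal covering with given transition data. -/
def core : FiberBundleCore Bool B G where
  baseSet := C.chart
  isOpen_baseSet := C.isOpen_chart
  indexAt := C.index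
  mem_baseSet_at := C.mem_chart_index
  coordChange i j x g := g * C.trans i x * (C.trans j x)⁻¹
  coordChange_self i x _ g := by simp
  continuousOn_coordChange := C.continuousOn_coord
  coordChange_comp i j k x _ g := by group

/-- The element of `G` which describes a point of the covering in the preferred chart. -/
def fib (e : C.core.TotalSpace) : G := e.2

/-- The point of the covering with a given description in the preferred chart. -/
def point (x : B) (g : G) : C.core.TotalSpace := ⟨x, g⟩

/-- The coordinate of a point of the covering in a chart. -/
def coord (i : Bool) (e : C.core.TotalSpace) : G :=
  C.fib e * C.trans (C.index e.1) e.1 * (C.trans i e.1)⁻¹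

theorem isCoveringMap : IsCoveringMap C.core.proj :=
  IsCoveringMap.mk C.core.proj (fun _ => G) (fun x => C.core.localTriv (C.index x)) C.mem_chart_index

theorem continuousOn_coord' (i : Bool) : ContinuousOn (C.coord i) (C.core.proj ⁻¹' C.chart i) := by
  have := continuous_snd.comp_continuousOn (C.core.localTriv i).continuousOn
  exact this

/-- A map to the covering is continuous if its projection and its coordinates in the two charts are.
-/
theorem continuous_of_coord {Z : Type} [TopologicalSpace Z] {Φ : Z → C.core.TotalSpace}
    (h : Continuous fun z => (Φ z).1)
    (hc : ∀ i, ContinuousOn (fun z => C.coord i (Φ z)) ((fun z => (Φ z).1) ⁻¹' C.chart i)) :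
    Continuous Φ := by
  rw [continuous_iff_continuousAt]
  intro z
  rw [FiberBundle.continuousAt_totalSpace]
  refine ⟨h.continuousAt, ?_⟩
  exact (hc (C.index (Φ z).1)).continuousAt
    (((C.isOpen_chart _).preimage h).mem_nhds (C.mem_chart_index _))

/-- The deck transformations. -/
def deck (u : G) (e : C.core.TotalSpace) : C.core.TotalSpace := C.point e.1 (u * C.fib e)

theorem continuous_deck (u : G) : Continuous (C.deck u) := by
  refine C.continuous_of_coord C.core.continuous_proj fun i => ?_
  have h1 : ∀ e, C.coord i (C.deck u e) = u * C.coord i e := fun e => by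
    change u * C.fib e * _ * _ = u * (C.fib e * _ * _)
    simp only [mul_assoc]
    rfl
  simp only [h1]
  exact (continuousOn_const (c := u)).mul (C.continuousOn_coord' i)

variable {C}

/-- The map to the covering with given coordinates. -/
def IsLift.toTotal {Z : Type} [TopologicalSpace Z] {f : Z → B} {a b : Z → G} (_ : C.IsLift f a b)
    (z : Z) : C.core.TotalSpace :=
  C.point (f z) (cond (C.index (f z)) (b z) (a z))

theorem IsLift.coord_toTotal {Z : Type} [TopologicalSpace Z] {f : Z → B} {a b : Z → G}
    (h : C.IsLift f a b) {i : Bool} {z : Z} (hz : f z ∈ C.chart i) :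
    C.coord i (h.toTotal z) = cond i (b z) (a z) := by
  have h1 := C.mem_chart_index (f z)
  change cond (C.index (f z)) (b z) (a z) * C.trans (C.index (f z)) (f z) * (C.trans i (f z))⁻¹ = _
  generalize C.index (f z) = j at h1
  rcases i with _ | _ <;> rcases j with _ | _
  · simp
  · simp [trans, h.eq_mul z hz h1]
  · simp [trans, h.eq_mul z h1 hz]
  · simp

theorem IsLift.continuous {Z : Type} [TopologicalSpace Z] {f : Z → B} {a b : Z → G}
    (h : C.IsLift f a b) (hf : Continuous f) : Continuous h.toTotal := by
  refine C.continuous_of_coord hf fun i => ?_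
  refine ContinuousOn.congr (f := fun z => cond i (b z) (a z)) ?_ fun z hz => h.coord_toTotal hz
  rcases i with _ | _
  · exact h.continuousOn_U
  · exact h.continuousOn_V

/-- The lift of a loop goes from its initial point `e` to `u e`. -/
structure IsHolonomy (C : TwoCharts B G) (f : C(unitInterval, B)) (u : G) : Prop where
  exists_lift : ∃ Γ : C(unitInterval, C.core.TotalSpace),
    (∀ t, (Γ t).1 = f t) ∧ Γ 1 = C.deck u (Γ 0)

/-- The holonomy of a loop is read off from the coordinates of a lift. -/
theorem IsLift.isHolonomy {f : C(unitInterval, B)} {a b : unitInterval → G}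
    (h : C.IsLift f a b) {u : G} (hf : f 1 = f 0) (ha : a 1 = u * a 0) (hb : b 1 = u * b 0) :
    C.IsHolonomy f u := by
  refine ⟨⟨h.toTotal, h.continuous f.continuous⟩, fun _ => rfl, ?_⟩
  change C.point (f 1) (cond (C.index (f 1)) (b 1) (a 1)) =
    C.point (f 0) (u * cond (C.index (f 0)) (b 0) (a 0))
  rw [hf, ha, hb]
  cases C.index (f 0) <;> rfl

theorem exists_deck {e e' : C.core.TotalSpace} (h : e.1 = e'.1) : ∃ u : G, e = C.deck u e' := by
  rcases e with ⟨x, g⟩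
  rcases e' with ⟨y, g'⟩
  obtain rfl : x = y := h
  refine ⟨C.fib ⟨x, g⟩ * (C.fib ⟨x, g'⟩)⁻¹, ?_⟩
  change C.point x (C.fib ⟨x, g⟩) = C.point x (C.fib ⟨x, g⟩ * (C.fib ⟨x, g'⟩)⁻¹ * C.fib ⟨x, g'⟩)
  rw [inv_mul_cancel_right]

theorem eq_of_deck_eq {u v : G} {e : C.core.TotalSpace} (h : C.deck u e = C.deck v e) : u = v := by
  have h1 : ∀ w, C.coord (C.index e.1) (C.deck w e) = w * C.coord (C.index e.1) e := fun w => by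
    change w * C.fib e * _ * _ = w * (C.fib e * _ * _)
    simp only [mul_assoc]
    rfl
  have := congrArg (C.coord (C.index e.1)) h
  rw [h1, h1] at this
  exact mul_right_cancel this

theorem deck_deck (u v : G) (e : C.core.TotalSpace) : C.deck u (C.deck v e) = C.deck (u * v) e := by
  change C.point e.1 (u * (v * C.fib e)) = C.point e.1 ((u * v) * C.fib e)
  rw [mul_assoc]

/-- Freely homotopic loops have conjugate holonomies. -/
theorem IsHolonomy.isConj {H : C(unitInterval × unitInterval, B)}
    (hH : ∀ s, H (s, 1) = H (s, 0)) {f f' : C(unitInterval, B)} (hf : ∀ t, H (0, t) = f t)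
    (hf' : ∀ t, H (1, t) = f' t) {u u' : G} (h : C.IsHolonomy f u) (h' : C.IsHolonomy f' u') :
    IsConj u u' := by
  obtain ⟨Γ, h1, h2⟩ := h
  obtain ⟨Γ', h1', h2'⟩ := h'
  have cov := C.isCoveringMap
  have h0 : ∀ a, H (0, a) = C.core.proj (Γ a) := fun a => (hf a).trans (h1 a).symm
  let K := cov.liftHomotopy H Γ h0
  have hK : ∀ x, (K x).1 = H x := fun x => congrFun (cov.liftHomotopy_lifts H Γ h0) x
  have hK0 : ∀ a, K (0, a) = Γ a := cov.liftHomotopy_zero H Γ h0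
  -- the two sides of the homotopy
  have e1 : (fun s : unitInterval => K (s, 1)) = fun s => C.deck u (K (s, 0)) := by
    refine cov.eq_of_comp_eq (by fun_prop) ((C.continuous_deck u).comp (by fun_prop)) ?_ 0 ?_
    · funext s
      exact (hK _).trans ((hH s).trans (hK _).symm)
    · rw [hK0, hK0, h2]
  obtain ⟨c, hc⟩ : ∃ c : G, K (1, 0) = C.deck c (Γ' 0) :=
    exists_deck ((hK _).trans ((hf' 0).trans (h1' 0).symm))
  have e2 : (fun t : unitInterval => K (1, t)) = fun t => C.deck c (Γ' t) := by
    refine cov.eq_of_comp_eq (by fun_prop) ((C.continuous_deck c).comp (by fun_prop)) ?_ 0 hc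
    funext t
    exact (hK _).trans ((hf' t).trans (h1' t).symm)
  have h3 := congrFun e1 1
  have h4 := congrFun e2 1
  rw [h3, hc, h2', deck_deck, deck_deck] at h4
  refine isConj_iff.2 ⟨c⁻¹, ?_⟩
  have := eq_of_deck_eq h4
  rw [inv_inv, mul_assoc, this]
  group

end TwoCharts

end Holonomy

end

section

/-! ### Loops in a rose -/

section Lines

open Topology

/-- Continuous functions on the intervals `[i, i + 1]` which agree at the integers form a continuous
function. -/
theorem continuous_floor_glue {Z : Type} [TopologicalSpace Z] {f : ℤ → ℝ → Z}
    (hf : ∀ i, Continuous (f i)) (h : ∀ i : ℤ, f i (i + 1) = f (i + 1) (i + 1)) :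
    Continuous fun x : ℝ => f ⌊x⌋ x := by
  rw [continuous_iff_continuousAt]
  intro x
  rw [continuousAt_iff_continuous_left_right]
  have hleft : ∀ y : ℝ, ((⌈x⌉ - 1 : ℤ) : ℝ) < y → y ≤ x → f ⌊y⌋ y = f (⌈x⌉ - 1) y := by
    intro y h1 h2
    rcases lt_or_eq_of_le (h2.trans (Int.le_ceil x)) with h3 | h3
    · have : ⌊y⌋ = ⌈x⌉ - 1 := by
        rw [Int.floor_eq_iff]
        refine ⟨h1.le, ?_⟩
        push_cast
        linarith
      rw [this]
    · have h4 := h (⌈x⌉ - 1)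
      push_cast at h4
      rw [sub_add_cancel, sub_add_cancel, ← h3] at h4
      rw [h4, h3, Int.floor_intCast]
  constructor
  · have h1 : ((⌈x⌉ - 1 : ℤ) : ℝ) < x := by
      push_cast
      linarith [Int.ceil_lt_add_one x]
    refine ContinuousWithinAt.congr_of_eventuallyEq (f := f (⌈x⌉ - 1))
      (hf _).continuousWithinAt ?_ (hleft x h1 le_rfl)
    filter_upwards [self_mem_nhdsWithin, mem_nhdsWithin_of_mem_nhds (Ioi_mem_nhds h1)] with y h2 h3
    exact hleft y h3 h2
  · refine ContinuousWithinAt.congr_of_eventuallyEq (f := f ⌊x⌋)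
      (hf _).continuousWithinAt ?_ rfl
    filter_upwards [self_mem_nhdsWithin,
      mem_nhdsWithin_of_mem_nhds (Iio_mem_nhds (Int.lt_floor_add_one x))] with y h2 h3
    have : ⌊y⌋ = ⌊x⌋ := by
      rw [Int.floor_eq_iff]
      exact ⟨(Int.floor_le x).trans h2, h3⟩
    rw [this]

namespace Graph

/-- The point with parameter `t`, truncated to `[0, 1]`, on a directed edge. -/
def edgePt (G : Graph) (d : G.D) (t : ℝ) : G.space.carrier :=
  Quot.mk _ (.inr ⟨d, Set.projIcc 0 1 zero_le_one t⟩)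

theorem edgePt_coe (G : Graph) (d : G.D) (t : unitInterval) :
    G.edgePt d t = Quot.mk _ (.inr ⟨d, t⟩) := by
  unfold edgePt
  rw [Set.projIcc_val]

theorem edgePt_flip (G : Graph) (d : G.D) (t : ℝ) :
    G.edgePt d t = G.edgePt (G.rev d) (1 - t) := by
  refine (Quot.sound (.flip d _)).trans ?_
  unfold edgePt
  congr 4
  apply Subtype.ext
  simp only [unitInterval.coe_symm_eq, Set.coe_projIcc]
  rcases le_total t 0 with h | h
  · rw [min_eq_right (by linarith), max_eq_left h, min_eq_left (by linarith), max_eq_right (by linarith)]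
    simp
  · rcases le_total t 1 with h' | h'
    · rw [min_eq_right h', max_eq_right h, min_eq_right (by linarith), max_eq_right (by linarith)]
    · rw [min_eq_left h', max_eq_right (by norm_num), min_eq_right (by linarith),
        max_eq_left (by linarith)]
      simp

theorem edgePt_zero (G : Graph) (d : G.D) : G.edgePt d 0 = Quot.mk _ (.inl (G.src d)) := by
  refine Eq.trans ?_ (Quot.sound (.start d))
  exact G.edgePt_coe d 0

theorem edgePt_one (G : Graph) (d : G.D) : G.edgePt d 1 = Quot.mk _ (.inl (G.src (G.rev d))) := by
  rw [edgePt_flip, sub_self, edgePt_zero]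

/-- The product of the distances to the two ends of the edge containing a point. -/
def endDist (G : Graph) : G.space.carrier → ℝ :=
  Quot.lift (Sum.elim (fun _ => 0) fun z => (z.2 : ℝ) * (1 - z.2)) (by
    rintro _ _ (d | ⟨d, t⟩)
    · simp
    · simp only [Sum.elim_inr, unitInterval.coe_symm_eq]
      ring)

theorem continuous_endDist (G : Graph) : Continuous G.endDist := by
  refine continuous_quot_lift _ (Continuous.sumElim continuous_const ?_)
  exact continuous_sigma fun d => by fun_prop

theorem endDist_edgePt (G : Graph) (d : G.D) {t : ℝ} (h0 : 0 ≤ t) (h1 : t ≤ 1) :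
    G.endDist (G.edgePt d t) = t * (1 - t) := by
  rw [show t = ((⟨t, h0, h1⟩ : unitInterval) : ℝ) from rfl, edgePt_coe]
  rfl

end Graph

variable {E : Type}

open Classical in
/-- The transition function of the universal covering of a rose on a directed edge. -/
def edgeTransition (d : E × Bool) (t : ℝ) : FreeGroup E :=
  if t = 0 ∨ t = 1 then 1
  else if d.2 then (if t ≤ 1 / 2 then 1 else .of d.1) else (if t < 1 / 2 then .of d.1 else 1)

theorem edgeTransition_bar (d : E × Bool) (t : ℝ) :
    edgeTransition d t = edgeTransition (bar d) (1 - t) := by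
  have h1 : (1 - t = 0 ∨ 1 - t = 1) ↔ (t = 0 ∨ t = 1) := by
    constructor <;> rintro (h | h)
    · exact .inr (by linarith)
    · exact .inl (by linarith)
    · exact .inr (by linarith)
    · exact .inl (by linarith)
  unfold edgeTransition bar
  simp only [h1]
  by_cases h : t = 0 ∨ t = 1
  · rw [if_pos h, if_pos h]
  · rw [if_neg h, if_neg h]
    rcases d with ⟨e, _ | _⟩
    · have : 1 - t ≤ 1 / 2 ↔ ¬ t < 1 / 2 := by constructor <;> intro h <;> linarith
      simp only [Bool.false_eq_true, if_false, Bool.not_false, if_true, this]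
      by_cases h2 : t < 1 / 2
      · rw [if_pos h2, if_neg (not_not.2 h2)]
      · rw [if_neg h2, if_pos h2]
    · have : 1 - t < 1 / 2 ↔ ¬ t ≤ 1 / 2 := by constructor <;> intro h <;> linarith
      simp only [Bool.false_eq_true, if_false, Bool.not_true, if_true, this]
      by_cases h2 : t ≤ 1 / 2
      · rw [if_pos h2, if_neg (not_not.2 h2)]
      · rw [if_neg h2, if_pos h2]

/-- The fibers of coverings are discrete. -/
instance : TopologicalSpace (FreeGroup E) := ⊥

instance : DiscreteTopology (FreeGroup E) := ⟨rfl⟩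

theorem continuousAt_edgeTransition (d : E × Bool) {t : ℝ} (h0 : t ≠ 0) (h1 : t ≠ 1)
    (h2 : t ≠ 1 / 2) : ContinuousAt (edgeTransition d) t := by
  have hev : ∀ᶠ s in 𝓝 t, s ≠ 0 ∧ s ≠ 1 ∧ (s < 1 / 2 ↔ t < 1 / 2) ∧ s ≠ 1 / 2 := by
    have h3 : ∀ᶠ s in 𝓝 t, (s < 1 / 2 ↔ t < 1 / 2) := by
      rcases lt_or_gt_of_ne h2 with h | h
      · filter_upwards [Iio_mem_nhds h] with s hs
        exact ⟨fun _ => h, fun _ => hs⟩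
      · filter_upwards [Ioi_mem_nhds h] with s hs
        exact ⟨fun h' => absurd h' (not_lt.2 (le_of_lt hs)), fun h' => absurd h' (not_lt.2 h.le)⟩
    filter_upwards [isOpen_ne.mem_nhds h0, isOpen_ne.mem_nhds h1, isOpen_ne.mem_nhds h2, h3] with
      s h4 h5 h6 h7
    exact ⟨h4, h5, h7, h6⟩
  refine ContinuousAt.congr (f := fun _ => edgeTransition d t) continuousAt_const ?_
  filter_upwards [hev] with s ⟨h4, h5, h6, h7⟩
  have h8 : s ≤ 1 / 2 ↔ t ≤ 1 / 2 := by
    rw [le_iff_lt_or_eq, le_iff_lt_or_eq, or_iff_left h7, or_iff_left h2, h6]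
  unfold edgeTransition
  simp only [h6, h8, h4, h5, h0, h1]

variable [Fintype E]

/-- The transition function of the universal covering of a rose. -/
def roseTransition : (Graph.rose E).space.carrier → FreeGroup E :=
  Quot.lift (Sum.elim (fun _ => 1) fun z => edgeTransition z.1 z.2) (by
    rintro _ _ (d | ⟨d, t⟩)
    · simp [edgeTransition]
    · exact edgeTransition_bar d t)

theorem roseTransition_edgePt (d : E × Bool) {t : ℝ} (h0 : 0 ≤ t) (h1 : t ≤ 1) :
    roseTransition ((Graph.rose E).edgePt d t) = edgeTransition d t := by
  have := (Graph.rose E).edgePt_coe d ⟨t, h0, h1⟩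
  change (Graph.rose E).edgePt d t = _ at this
  rw [this]
  rfl

variable (E) in
/-- The universal covering of a rose, with one chart away from the midpoints of the edges and one
chart away from the vertex. -/
def roseCover : TwoCharts (Graph.rose E).space.carrier (FreeGroup E) where
  U := {x | (Graph.rose E).endDist x ≠ 1 / 4}
  V := {x | (Graph.rose E).endDist x ≠ 0}
  isOpen_U := isOpen_ne.preimage (Graph.rose E).continuous_endDist
  isOpen_V := isOpen_ne.preimage (Graph.rose E).continuous_endDist
  cover x := by
    by_cases h : (Graph.rose E).endDist x = 0
    · left
      change _ ≠ _
      rw [h]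
      norm_num
    · exact .inr h
  τ := roseTransition
  continuousOn_τ := by
    have ho : IsOpen ({x | (Graph.rose E).endDist x ≠ 1 / 4} ∩ {x | (Graph.rose E).endDist x ≠ 0}) :=
      (isOpen_ne.preimage (Graph.rose E).continuous_endDist).inter
        (isOpen_ne.preimage (Graph.rose E).continuous_endDist)
    refine (isQuotientMap_quot_mk.continuousOn_isOpen_iff ho).2 ?_
    refine continuousOn_of_forall_continuousAt ?_
    rintro (v | ⟨d, t⟩) ⟨h1, h2⟩
    · exact absurd rfl h2
    · replace h1 : (t : ℝ) * (1 - t) ≠ 1 / 4 := h1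
      replace h2 : (t : ℝ) * (1 - t) ≠ 0 := h2
      have hemb : IsOpenEmbedding fun t : unitInterval =>
          (Sum.inr ⟨d, t⟩ : (Graph.rose E).Piece) :=
        IsOpenEmbedding.inr.comp IsOpenEmbedding.sigmaMk
      rw [← hemb.continuousAt_iff]
      refine (continuousAt_edgeTransition d (t := t) ?_ ?_ ?_).comp
        (f := fun t : unitInterval => (t : ℝ)) continuous_subtype_val.continuousAt
      · rintro h
        simp [h] at h2
      · rintro h
        simp [h] at h2
      · intro h
        norm_num [h] at h1

/-- The line in a rose which runs through the edges of the orbit of a letter. -/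
def orbitLine (N : Equiv.Perm (E × Bool)) (d : E × Bool) (x : ℝ) : (Graph.rose E).space.carrier :=
  (Graph.rose E).edgePt ((N ^ ⌊x⌋) d) (Int.fract x)

end Lines

end

section

/-! ### Holonomy of the boundary loops -/

section Cocycle

variable {G : Type} [Group G]

/-- The permutation whose iterates compute the partial products of the sequence `ρ`. -/
def cocycleStep (ρ : ℤ → G) : Equiv.Perm (G × ℤ) where
  toFun x := (x.1 * ρ x.2, x.2 + 1)
  invFun x := (x.1 * (ρ (x.2 - 1))⁻¹, x.2 - 1)
  left_inv x := by simp
  right_inv x := by simp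

/-- The partial products of a two-sided sequence: `ρ 0 * ⋯ * ρ (i - 1)` for `0 ≤ i`, extended to
negative `i` by the same recursion. -/
def cocycle (ρ : ℤ → G) (i : ℤ) : G := ((cocycleStep ρ ^ i) (1, 0)).1

theorem cocycleStep_zpow_snd (ρ : ℤ → G) (i : ℤ) : ((cocycleStep ρ ^ i) (1, 0)).2 = i := by
  have h1 : ∀ i : ℤ, ((cocycleStep ρ ^ (i + 1)) (1, 0)).2 = ((cocycleStep ρ ^ i) (1, 0)).2 + 1 := by
    intro i
    rw [add_comm, zpow_add, zpow_one, Equiv.Perm.mul_apply]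
    rfl
  induction i using Int.induction_on with
  | zero => rfl
  | succ i ih => rw [h1, ih]
  | pred i ih =>
    have := h1 (-(i : ℤ) - 1)
    rw [sub_add_cancel, ih] at this
    linarith

theorem cocycle_zero (ρ : ℤ → G) : cocycle ρ 0 = 1 := rfl

theorem cocycle_add_one (ρ : ℤ → G) (i : ℤ) : cocycle ρ (i + 1) = cocycle ρ i * ρ i := by
  unfold cocycle
  rw [add_comm, zpow_add, zpow_one, Equiv.Perm.mul_apply]
  conv_rhs => rw [← cocycleStep_zpow_snd ρ i]
  rw [cocycleStep_zpow_snd ρ i]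
  change _ * ρ ((cocycleStep ρ ^ i) (1, 0)).2 = _
  rw [cocycleStep_zpow_snd]

/-- The recursion satisfied by `cocycle` determines a sequence up to its initial value. -/
theorem eq_mul_cocycle {ρ Q : ℤ → G} (h : ∀ i, Q (i + 1) = Q i * ρ i) (i : ℤ) :
    Q i = Q 0 * cocycle ρ i := by
  induction i using Int.induction_on with
  | zero => rw [cocycle_zero, mul_one]
  | succ i ih => rw [h, ih, cocycle_add_one, mul_assoc]
  | pred i ih =>
    have h1 := h (-(i : ℤ) - 1)
    have h2 := cocycle_add_one ρ (-(i : ℤ) - 1)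
    rw [sub_add_cancel] at h1 h2
    rw [h1, h2, ← mul_assoc] at ih
    exact mul_right_cancel ih

/-- For a sequence of period `L`, the partial products over a period factor out on the left. -/
theorem cocycle_add {ρ : ℤ → G} {L : ℤ} (h : ∀ i, ρ (i + L) = ρ i) (i : ℤ) :
    cocycle ρ (i + L) = cocycle ρ L * cocycle ρ i := by
  have := eq_mul_cocycle (Q := fun i => cocycle ρ (i + L)) (ρ := ρ) (fun i => ?_) i
  · simpa using this
  · rw [add_right_comm, cocycle_add_one, h]

end Cocycle

section OrbitLine

open Topology

variable {E : Type}

/-- The element of the free group given by a letter. -/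
def letterElt (d : E × Bool) : FreeGroup E := FreeGroup.mk [d]

theorem letterElt_true (e : E) : letterElt (e, true) = FreeGroup.of e := rfl

theorem letterElt_false (e : E) : letterElt (e, false) = (FreeGroup.of e)⁻¹ := rfl

theorem letterElt_bar (d : E × Bool) : letterElt (bar d) = (letterElt d)⁻¹ := by
  unfold letterElt
  rw [FreeGroup.inv_mk]
  rfl

/-- The partial products of the letters of an orbit. -/
def orbitElt (N : Equiv.Perm (E × Bool)) (d : E × Bool) : ℤ → FreeGroup E :=
  cocycle fun i => letterElt ((N ^ i) d)

theorem perm_natPow_apply (N : Equiv.Perm (E × Bool)) (n : ℕ) (d : E × Bool) :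
    (N ^ n) d = N^[n] d := by
  rw [Equiv.Perm.iterate_eq_pow]

theorem orbitElt_natCast (N : Equiv.Perm (E × Bool)) (d : E × Bool) (n : ℕ) :
    orbitElt N d n = FreeGroup.mk (orbitWord N d n) := by
  induction n with
  | zero => rfl
  | succ n ih =>
    have h1 : orbitWord N d (n + 1) = orbitWord N d n ++ [N^[n] d] := by
      simp [orbitWord, List.range_succ]
    rw [h1, ← FreeGroup.mul_mk, ← ih, Nat.cast_succ]
    refine (cocycle_add_one _ _).trans ?_
    rw [zpow_natCast, perm_natPow_apply]
    rfl

/-- The map on letters whose orbits are the orbits of `N` read backwards. -/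
def reversed (N : Equiv.Perm (E × Bool)) (d : E × Bool) : E × Bool := bar (N⁻¹ (bar d))

/-- The partial products at negative indices are given by the orbit read backwards. -/
theorem orbitElt_neg (N : Equiv.Perm (E × Bool)) (d : E × Bool) (n : ℕ) :
    orbitElt N d (-n) = FreeGroup.mk (orbitWord (reversed N) (bar (N⁻¹ d)) n) := by
  have hit : ∀ n : ℕ, (reversed N)^[n] (bar (N⁻¹ d)) = bar ((N ^ (-(n : ℤ) - 1)) d) := by
    intro n
    induction n with
    | zero => simp
    | succ n ih =>
      rw [Function.iterate_succ_apply', ih, reversed, bar_bar, ← Equiv.Perm.mul_apply,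
        ← zpow_neg_one, ← zpow_add]
      congr 3
      push_cast
      ring
  induction n with
  | zero => rfl
  | succ n ih =>
    have h1 : orbitWord (reversed N) (bar (N⁻¹ d)) (n + 1) =
        orbitWord (reversed N) (bar (N⁻¹ d)) n ++ [bar ((N ^ (-(n : ℤ) - 1)) d)] := by
      rw [← hit]
      simp [orbitWord, List.range_succ]
    rw [h1, ← FreeGroup.mul_mk, ← ih]
    have h2 := cocycle_add_one (fun i => letterElt ((N ^ i) d)) (-(n : ℤ) - 1)
    rw [sub_add_cancel] at h2
    change orbitElt N d _ = orbitElt N d _ * letterElt (bar _)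
    rw [letterElt_bar, eq_mul_inv_iff_mul_eq]
    refine Eq.trans ?_ h2.symm
    change orbitElt N d _ * _ = orbitElt N d _ * _
    congr 2
    push_cast
    ring

theorem iterate_reversed {N : Equiv.Perm (E × Bool)} {d : E × Bool} {n : ℕ} (h : (N ^ n) d = d) :
    (reversed N)^[n] (bar (N⁻¹ d)) = bar (N⁻¹ d) := by
  have hit : ∀ n : ℕ, (reversed N)^[n] (bar (N⁻¹ d)) = bar (((N ^ n)⁻¹ * N⁻¹) d) := by
    intro n
    induction n with
    | zero => simp
    | succ n ih =>
      rw [Function.iterate_succ_apply', ih, reversed, bar_bar, ← Equiv.Perm.mul_apply, ← mul_assoc,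
        ← mul_inv_rev, ← pow_succ]
  have h3 : (N ^ n)⁻¹ * N⁻¹ = N⁻¹ * (N ^ n)⁻¹ := by
    rw [← mul_inv_rev, ← mul_inv_rev, ← pow_succ, ← pow_succ']
  rw [hit, h3, Equiv.Perm.mul_apply, Equiv.Perm.inv_eq_iff_eq.2 h.symm]

theorem zpow_add_apply {N : Equiv.Perm (E × Bool)} {d : E × Bool} {m : ℤ} (h : (N ^ m) d = d)
    (i : ℤ) : (N ^ (i + m)) d = (N ^ i) d := by
  rw [zpow_add, Equiv.Perm.mul_apply, h]

variable [Fintype E]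

theorem floor_add_half {x : ℝ} : ⌊x + 1 / 2⌋ = if Int.fract x < 1 / 2 then ⌊x⌋ else ⌊x⌋ + 1 := by
  have h0 := Int.fract_nonneg x
  have h1 := Int.fract_lt_one x
  have h2 := Int.floor_add_fract x
  split_ifs with h
  · rw [Int.floor_eq_iff]
    constructor <;> linarith
  · rw [Int.floor_eq_iff]
    push_cast
    constructor <;> linarith

theorem continuousAt_floor {x : ℝ} (h : Int.fract x ≠ 0) : ContinuousAt (fun y : ℝ => ⌊y⌋) x := by
  refine ContinuousAt.congr (f := fun _ => ⌊x⌋) continuousAt_const ?_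
  have h1 : (⌊x⌋ : ℝ) < x := lt_of_le_of_ne (Int.floor_le x) fun h' => h (by
    rw [Int.fract, h', sub_self])
  filter_upwards [Ioo_mem_nhds h1 (Int.lt_floor_add_one x)] with y hy
  exact (Int.floor_eq_iff.2 ⟨hy.1.le, hy.2⟩).symm

/-- The coordinate of the lift of a line in the chart around the vertex. -/
def lineLiftU (N : Equiv.Perm (E × Bool)) (d : E × Bool) (x : ℝ) : FreeGroup E :=
  orbitElt N d ⌊x + 1 / 2⌋

/-- The coordinate of the lift of a line in the chart away from the vertex. -/
def lineLiftV (N : Equiv.Perm (E × Bool)) (d : E × Bool) (x : ℝ) : FreeGroup E :=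
  if ((N ^ ⌊x⌋) d).2 then orbitElt N d ⌊x⌋ else orbitElt N d (⌊x⌋ + 1)

/-- The line through the edges of an orbit lifts to the covering of the rose, by the partial
products of its letters. In the chart around the vertex the coordinate jumps at the midpoints of
edges, in the other chart it jumps at the vertex. -/
theorem isLift_orbitLine (N : Equiv.Perm (E × Bool)) (d : E × Bool) :
    (roseCover E).IsLift (orbitLine N d) (lineLiftU N d) (lineLiftV N d) := by
  have he : ∀ x, (Graph.rose E).endDist (orbitLine N d x) = Int.fract x * (1 - Int.fract x) :=
    fun x => (Graph.rose E).endDist_edgePt _ (Int.fract_nonneg x) (Int.fract_lt_one x).le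
  have hV : ∀ x, orbitLine N d x ∈ (roseCover E).V → Int.fract x ≠ 0 := by
    intro x hx h
    exact hx ((he x).trans (by rw [h, zero_mul]))
  have hU : ∀ x, orbitLine N d x ∈ (roseCover E).U → Int.fract x ≠ 1 / 2 := by
    intro x hx h
    exact hx ((he x).trans (by rw [h]; norm_num))
  refine ⟨?_, ?_, ?_⟩
  · refine continuousOn_of_forall_continuousAt fun x hx => ?_
    have h1 : Int.fract (x + 1 / 2) ≠ 0 := by
      intro h
      apply hU x hx
      have h2 := Int.fract_nonneg x
      have h3 := Int.fract_lt_one x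
      have h4 : x + 1 / 2 - ⌊x + 1 / 2⌋ = 0 := h
      rw [floor_add_half] at h4
      have h5 := Int.floor_add_fract x
      split_ifs at h4
      · linarith
      · push_cast at h4
        linarith
    exact (continuous_of_discreteTopology (f := orbitElt N d)).continuousAt.comp
      (f := fun x : ℝ => ⌊x + 1 / 2⌋)
      ((continuousAt_floor h1).comp (f := fun x : ℝ => x + 1 / 2) (by fun_prop))
  · refine continuousOn_of_forall_continuousAt fun x hx => ?_
    exact (continuous_of_discreteTopology (f := fun i : ℤ =>
      if ((N ^ i) d).2 then orbitElt N d i else orbitElt N d (i + 1))).continuousAt.comp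
      (f := fun x : ℝ => ⌊x⌋) (continuousAt_floor (hV x hx))
  · intro x hxU hxV
    have h0 := hV x hxV
    have h2 := hU x hxU
    have h1 := Int.fract_lt_one x
    have hτ : (roseCover E).τ (orbitLine N d x) = edgeTransition ((N ^ ⌊x⌋) d) (Int.fract x) :=
      roseTransition_edgePt _ (Int.fract_nonneg x) h1.le
    rw [hτ]
    have hs : orbitElt N d (⌊x⌋ + 1) = orbitElt N d ⌊x⌋ * letterElt ((N ^ ⌊x⌋) d) :=
      cocycle_add_one _ _
    unfold lineLiftU lineLiftV edgeTransition
    have hne : ¬ (Int.fract x = 0 ∨ Int.fract x = 1) := by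
      rintro (h | h)
      exacts [h0 h, h1.ne h]
    rw [floor_add_half, if_neg hne, hs]
    revert hs
    rcases (N ^ ⌊x⌋) d with ⟨e, _ | _⟩ <;> intro hs <;>
      simp only [Bool.false_eq_true, if_false, if_true]
    · rw [letterElt_false] at hs ⊢
      by_cases h : Int.fract x < 1 / 2
      · rw [if_pos h, if_pos h, inv_mul_cancel_right]
      · rw [if_neg h, if_neg h, hs, mul_one]
    · rw [letterElt_true] at hs
      by_cases h : Int.fract x < 1 / 2
      · rw [if_pos h, if_pos h.le, mul_one]
      · have h' : ¬ Int.fract x ≤ 1 / 2 := fun h3 => h (lt_of_le_of_ne h3 h2)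
        rw [if_neg h, if_neg h', hs]

/-- A loop which runs along a line, covering `m` letters, has the product of these letters as
holonomy. -/
theorem isHolonomy_orbitLine {N : Equiv.Perm (E × Bool)} {d : E × Bool} {m : ℤ}
    (h : (N ^ m) d = d) {x : C(unitInterval, ℝ)} (hx : x 1 = x 0 + m)
    {f : C(unitInterval, (Graph.rose E).space.carrier)} (hf : ∀ t, f t = orbitLine N d (x t)) :
    (roseCover E).IsHolonomy f (orbitElt N d m) := by
  have hl := isLift_orbitLine N d
  have hp : ∀ i, orbitElt N d (i + m) = orbitElt N d m * orbitElt N d i :=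
    cocycle_add fun i => congrArg letterElt (zpow_add_apply h i)
  have hf' : (f : unitInterval → _) = orbitLine N d ∘ x := funext hf
  have hl' : (roseCover E).IsLift f (lineLiftU N d ∘ x) (lineLiftV N d ∘ x) := by
    rw [hf']
    refine ⟨?_, ?_, fun z => hl.eq_mul (x z)⟩
    · exact hl.continuousOn_U.comp x.continuous.continuousOn fun _ h => h
    · exact hl.continuousOn_V.comp x.continuous.continuousOn fun _ h => h
  refine hl'.isHolonomy ?_ ?_ ?_
  · rw [hf, hf, hx, orbitLine, orbitLine, Int.floor_add_intCast, Int.fract_add_intCast,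
      zpow_add_apply h]
  · change orbitElt N d ⌊x 1 + 1 / 2⌋ = _ * orbitElt N d ⌊x 0 + 1 / 2⌋
    rw [hx, add_right_comm, Int.floor_add_intCast, hp]
  · change (if ((N ^ ⌊x 1⌋) d).2 then orbitElt N d ⌊x 1⌋ else orbitElt N d (⌊x 1⌋ + 1)) =
      _ * (if ((N ^ ⌊x 0⌋) d).2 then orbitElt N d ⌊x 0⌋ else orbitElt N d (⌊x 0⌋ + 1))
    rw [hx, Int.floor_add_intCast, zpow_add_apply h, add_right_comm, hp, hp]
    split_ifs <;> rfl

/-- If a closed orbit of `ν` is freely homotopic to a loop along an orbit of `N`, then it is an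
orbit of `N`, or an orbit of `N` read backwards. -/
theorem apply_eq_of_homotopy {ν N : Equiv.Perm (E × Bool)} (hν : ∀ d, ν d ≠ bar d)
    (hN : ∀ d, N d ≠ bar d) {d d₀ : E × Bool} {ℓ : ℕ} (hℓ : 0 < ℓ) (hd : (ν ^ ℓ) d = d) {m : ℤ}
    (hd₀ : (N ^ m) d₀ = d₀) {x : C(unitInterval, ℝ)} (hx : x 1 = x 0 + m)
    {H : C(unitInterval × unitInterval, (Graph.rose E).space.carrier)}
    (hH : ∀ s, H (s, 1) = H (s, 0)) (h0 : ∀ t, H (0, t) = orbitLine ν d (ℓ * t))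
    (h1 : ∀ t, H (1, t) = orbitLine N d₀ (x t)) : ν d = N d ∨ ν d = reversed N d := by
  have hh0 := isHolonomy_orbitLine (N := ν) (d := d) (m := ℓ) (by rwa [zpow_natCast])
    (x := ⟨fun t => ℓ * t, by fun_prop⟩) (by simp)
    (f := H.comp ⟨fun t => (0, t), by fun_prop⟩) h0
  have hh1 := isHolonomy_orbitLine hd₀ hx (f := H.comp ⟨fun t => (1, t), by fun_prop⟩) h1
  have hc := TwoCharts.IsHolonomy.isConj hH (fun _ => rfl) (fun _ => rfl) hh0 hh1
  rw [orbitElt_natCast] at hc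
  rw [perm_natPow_apply] at hd
  have hN' : ∀ d, reversed N d ≠ bar d := by
    intro d h
    have h2 : N⁻¹ (bar d) = d := by
      rw [← bar_bar (N⁻¹ (bar d))]
      exact (congrArg bar h).trans (bar_bar d)
    rw [Equiv.Perm.inv_eq_iff_eq] at h2
    exact hN d h2.symm
  obtain ⟨n, rfl | rfl⟩ := m.eq_nat_or_neg
  · left
    rw [orbitElt_natCast] at hc
    rw [zpow_natCast, perm_natPow_apply] at hd₀
    exact apply_eq_of_isConj hν hN hℓ hd hd₀ hc
  · right
    rw [orbitElt_neg] at hc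
    have h2 : (N ^ n) d₀ = d₀ := by
      rw [zpow_neg, zpow_natCast, Equiv.Perm.inv_eq_iff_eq] at hd₀
      exact hd₀.symm
    exact apply_eq_of_isConj hν hN' hℓ hd (iterate_reversed h2) hc

end OrbitLine

end

section

/-! ### The retraction of a ribbon surface to its graph -/

namespace Graph

variable (G : Graph) (O : G.Ribbon)

/-- The height of a point of a ribbon surface above the graph. -/
def height : (G.ribbonSpace O).carrier → ℝ :=
  Quot.lift (Sum.elim (fun _ => 0) fun z => (z.2.2 : ℝ)) (by
    rintro _ _ (d | ⟨d, t⟩ | ⟨d, s⟩) <;> rfl)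

theorem continuous_height : Continuous (G.height O) := by
  refine continuous_quot_lift _ (Continuous.sumElim continuous_const ?_)
  exact continuous_sigma fun d => by fun_prop

theorem height_nonneg (x : (G.ribbonSpace O).carrier) : 0 ≤ G.height O x := by
  induction x using Quot.inductionOn with
  | h x =>
    rcases x with v | ⟨d, t, s⟩
    · exact le_rfl
    · exact s.coe_nonneg

/-- The projection of a ribbon surface to its graph along the strips. -/
def retraction : PtdMap (G.ribbonSpace O) G.space where
  map :=
    { toFun := Quot.lift (Sum.elim (fun v => Quot.mk _ (.inl v))
        fun z => Quot.mk _ (.inr ⟨z.1, z.2.1⟩)) (by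
          rintro _ _ (d | ⟨d, t⟩ | ⟨d, s⟩)
          · exact Quot.sound (.start d)
          · exact Quot.sound (.flip d t)
          · have h1 := G.edgePt_one d
            have h2 := G.edgePt_zero (O.next d)
            rw [show (1 : ℝ) = ((1 : unitInterval) : ℝ) from rfl, edgePt_coe] at h1
            rw [show (0 : ℝ) = ((0 : unitInterval) : ℝ) from rfl, edgePt_coe] at h2
            have h3 : G.src (O.next d) = G.src (G.rev d) := O.src_succ _
            rw [h3] at h2
            exact h1.trans h2.symm)
      continuous_toFun := by
        refine continuous_quot_lift _ (Continuous.sumElim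
          (continuous_quot_mk.comp continuous_inl) (continuous_sigma fun d => ?_))
        exact continuous_quot_mk.comp (continuous_inr.comp (continuous_sigmaMk.comp continuous_fst)) }
  map_pt := rfl

theorem inclusion_comp_retraction : (G.inclusion O).cls ≫ (G.retraction O).cls = 𝟙 _ := by
  rw [← PtdMap.cls_comp, ← PtdMap.cls_id]
  congr 1
  apply PtdMap.ext
  ext x
  induction x using Quot.inductionOn with
  | h x => rcases x with v | ⟨d, t⟩ <;> rfl

/-- The path along which a point of a ribbon surface is pushed down to the graph. -/
def pushPath : (G.ribbonSpace O).carrier → C(unitInterval, (G.ribbonSpace O).carrier) :=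
  Quot.lift (Sum.elim (fun v => .const _ (Quot.mk _ (.inl v)))
      fun z => ⟨fun u => stripMk O z.1 z.2.1 (unitInterval.toNNReal u * z.2.2), by
        exact (continuous_stripMk O z.1).comp (f := fun u : unitInterval =>
          (z.2.1, unitInterval.toNNReal u * z.2.2)) (by fun_prop)⟩) (by
    rintro _ _ (d | ⟨d, t⟩ | ⟨d, s⟩)
    · ext u
      change stripMk O d 0 (unitInterval.toNNReal u * 0) = _
      rw [mul_zero]
      exact Quot.sound (.start d)
    · ext u
      change stripMk O d t (unitInterval.toNNReal u * 0) =
        stripMk O (G.rev d) (unitInterval.symm t) (unitInterval.toNNReal u * 0)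
      rw [mul_zero]
      exact Quot.sound (.flip d t)
    · ext u
      exact Quot.sound (.side d _))

theorem continuous_pushPath : Continuous (G.pushPath O) := by
  refine continuous_quot_lift _ (Continuous.sumElim continuous_of_discreteTopology
    (continuous_sigma fun d => ?_))
  refine ContinuousMap.continuous_of_continuous_uncurry _ ?_
  exact (continuous_stripMk O d).comp (f := fun z : (unitInterval × NNReal) × unitInterval =>
    (z.1.1, unitInterval.toNNReal z.2 * z.1.2)) (by fun_prop)

/-- A ribbon surface deformation retracts to its graph. -/
theorem retraction_comp_inclusion : (G.retraction O).cls ≫ (G.inclusion O).cls = 𝟙 _ := by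
  rw [← PtdMap.cls_comp, ← PtdMap.cls_id]
  have hc : Continuous fun z : unitInterval × (G.ribbonSpace O).carrier => G.pushPath O z.2 z.1 :=
    (ContinuousMap.continuous_uncurry_of_continuous ⟨_, G.continuous_pushPath O⟩).comp
      continuous_swap
  refine PtdMap.cls_eq ⟨⟨⟨⟨fun z => G.pushPath O z.2 z.1, hc⟩, fun x => ?_, fun x => ?_⟩, ?_⟩⟩
  · induction x using Quot.inductionOn with
    | h x =>
      rcases x with v | ⟨d, t, s⟩
      · rfl
      · change stripMk O d t (unitInterval.toNNReal 0 * s) = stripMk O d t 0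
        rw [unitInterval.toNNReal_zero, zero_mul]
  · induction x using Quot.inductionOn with
    | h x =>
      rcases x with v | ⟨d, t, s⟩
      · rfl
      · change stripMk O d t (unitInterval.toNNReal 1 * s) = stripMk O d t s
        rw [unitInterval.toNNReal_one, one_mul]
  · rintro u x rfl
    rfl

/-- The inclusion of a graph into its ribbon surface, as an isomorphism in the pointed homotopy
category. -/
def inclusionIso : G.space ≅ G.ribbonSpace O :=
  ⟨(G.inclusion O).cls, (G.retraction O).cls, G.inclusion_comp_retraction O,
    G.retraction_comp_inclusion O⟩

instance : CompactSpace G.space.carrier :=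
  haveI : CompactSpace G.Piece := inferInstance
  Quot.compactSpace

theorem exists_inclusion_of_height_eq_zero {x : (G.ribbonSpace O).carrier} (h : G.height O x = 0) :
    ∃ y, (G.inclusion O).map y = x := by
  induction x using Quot.inductionOn with
  | h x =>
    rcases x with v | ⟨d, t, s⟩
    · exact ⟨Quot.mk _ (.inl v), rfl⟩
    · obtain rfl : s = 0 := NNReal.coe_eq_zero.1 h
      exact ⟨Quot.mk _ (.inr ⟨d, t⟩), rfl⟩

theorem exists_strip_of_height_ne_zero {x : (G.ribbonSpace O).carrier} (h : G.height O x ≠ 0) :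
    ∃ d t s, x = stripMk O d t s := by
  induction x using Quot.inductionOn with
  | h x =>
    rcases x with v | ⟨d, t, s⟩
    · exact absurd rfl h
    · exact ⟨d, t, s, rfl⟩

/-! ### Loops around a puncture -/

variable {G}

/-- The permutation of the directed edges whose cycles are the boundary cycles. -/
def Ribbon.nextPerm (O : G.Ribbon) : Equiv.Perm G.D :=
  (Function.Involutive.toPerm G.rev G.rev_rev).trans O.succ

theorem Ribbon.nextPerm_apply (O : G.Ribbon) (d : G.D) : O.nextPerm d = O.next d := rfl

end Graph

section Angle

variable {D : Type} (ν : Equiv.Perm D) (d₀ : D)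

theorem zpow_apply_eq_iff {i j : ℤ} : (ν ^ i) d₀ = (ν ^ j) d₀ ↔
    ∃ k : ℤ, i = j + k * Function.minimalPeriod ν d₀ := by
  have h1 : (ν ^ i) d₀ = (ν ^ j) d₀ ↔ (ν ^ (i - j)) d₀ = d₀ := by
    rw [zpow_sub, ← (Commute.zpow_zpow_self ν i j).inv_right.eq.symm, Equiv.Perm.mul_apply,
      Equiv.Perm.inv_eq_iff_eq]
  have h2 := MulAction.zpow_smul_eq_iff_minimalPeriod_dvd (a := ν) (b := d₀) (n := i - j)
  refine h1.trans (h2.trans ⟨?_, ?_⟩)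
  · rintro ⟨k, hk⟩
    refine ⟨k, ?_⟩
    rw [mul_comm] at hk
    have hk' : i - j = k * (Function.minimalPeriod ν d₀ : ℤ) := hk
    linarith
  · rintro ⟨k, hk⟩
    refine ⟨k, ?_⟩
    rw [mul_comm]
    have hk' : i - j = k * (Function.minimalPeriod ν d₀ : ℤ) := by linarith
    exact hk'

/-- The point on the unit circle with coordinate `x`, if the circle is divided into as many parts of
length `1` as the cycle of `d₀` has elements. -/
def cyclePoint (x : ℝ) : Circle := Circle.exp (2 * Real.pi * x / Function.minimalPeriod ν d₀)

theorem cyclePoint_add (x y : ℝ) :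
    cyclePoint ν d₀ (x + y) = cyclePoint ν d₀ x * cyclePoint ν d₀ y := by
  unfold cyclePoint
  rw [← Circle.exp_add]
  congr 1
  ring

open Classical in
/-- The starting point of the interval of `d` on the circle, and `0` if `d` is not in the cycle
of `d₀`. -/
def cycleStart (d : D) : ℂ :=
  if h : ∃ j : ℤ, (ν ^ j) d₀ = d then cyclePoint ν d₀ h.choose else 0

theorem cycleStart_of_not {d : D} (h : ¬ ∃ j : ℤ, (ν ^ j) d₀ = d) : cycleStart ν d₀ d = 0 := by
  unfold cycleStart
  rw [dif_neg h]

variable [Fintype D]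

theorem minimalPeriod_perm_pos : 0 < Function.minimalPeriod ν d₀ := by
  apply Function.minimalPeriod_pos_of_mem_periodicPts
  refine ⟨orderOf ν, orderOf_pos ν, ?_⟩
  change ν^[orderOf ν] d₀ = d₀
  rw [Equiv.Perm.iterate_eq_pow, pow_orderOf_eq_one]
  rfl

theorem cyclePoint_eq_iff {x y : ℝ} : cyclePoint ν d₀ x = cyclePoint ν d₀ y ↔
    ∃ k : ℤ, x = y + k * Function.minimalPeriod ν d₀ := by
  have h0 : (Function.minimalPeriod ν d₀ : ℝ) ≠ 0 := by
    exact_mod_cast (minimalPeriod_perm_pos ν d₀).ne'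
  have hpi := Real.pi_ne_zero
  unfold cyclePoint
  rw [Circle.exp_eq_exp]
  refine exists_congr fun k => ?_
  field_simp

theorem cycleStart_zpow (j : ℤ) : cycleStart ν d₀ ((ν ^ j) d₀) = cyclePoint ν d₀ j := by
  have h : ∃ i : ℤ, (ν ^ i) d₀ = (ν ^ j) d₀ := ⟨j, rfl⟩
  unfold cycleStart
  rw [dif_pos h]
  obtain ⟨k, hk⟩ := (zpow_apply_eq_iff ν d₀).1 h.choose_spec
  refine congrArg _ ((cyclePoint_eq_iff ν d₀).2 ⟨k, ?_⟩)
  exact_mod_cast hk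

theorem cycleStart_apply (d : D) :
    cycleStart ν d₀ (ν d) = cycleStart ν d₀ d * cyclePoint ν d₀ 1 := by
  by_cases h : ∃ j : ℤ, (ν ^ j) d₀ = d
  · obtain ⟨j, rfl⟩ := h
    have : ν ((ν ^ j) d₀) = (ν ^ (j + 1)) d₀ := by
      rw [add_comm, zpow_add, zpow_one, Equiv.Perm.mul_apply]
    rw [this, cycleStart_zpow, cycleStart_zpow, ← Circle.coe_mul, ← cyclePoint_add]
    push_cast
    rfl
  · rw [cycleStart_of_not ν d₀ h, cycleStart_of_not, zero_mul]
    rintro ⟨j, hj⟩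
    apply h
    refine ⟨j - 1, ?_⟩
    rw [sub_eq_add_neg, add_comm, zpow_add, zpow_neg_one, Equiv.Perm.mul_apply, hj,
      show ν⁻¹ (ν d) = d from ν.symm_apply_apply d]

end Angle

namespace Graph

variable {G : Graph} (O : G.Ribbon) (d₀ : G.D)

/-- Polar coordinates, with the height as radius, in the punctured disk glued in along the boundary
cycle of `d₀`; the function is `0` in the other punctured disks. -/
def polar : (G.ribbonSpace O).carrier → ℂ :=
  Quot.lift (Sum.elim (fun _ => 0) fun z =>
    ((z.2.2 : ℝ) : ℂ) * (cycleStart O.nextPerm d₀ z.1 * cyclePoint O.nextPerm d₀ z.2.1)) (by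
    rintro _ _ (d | ⟨d, t⟩ | ⟨d, s⟩)
    · simp
    · simp
    · simp only [Sum.elim_inr]
      rw [← O.nextPerm_apply, cycleStart_apply, mul_assoc, ← Circle.coe_mul, ← cyclePoint_add]
      simp)

theorem polar_stripMk (d : G.D) (t : unitInterval) (s : NNReal) : polar O d₀ (stripMk O d t s) =
    ((s : ℝ) : ℂ) * (cycleStart O.nextPerm d₀ d * cyclePoint O.nextPerm d₀ t) := rfl

theorem continuous_cyclePoint : Continuous (cyclePoint O.nextPerm d₀) := by
  unfold cyclePoint
  fun_prop

theorem continuous_polar : Continuous (polar O d₀) := by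
  have := continuous_cyclePoint O d₀
  refine continuous_quot_lift _ (Continuous.sumElim continuous_const ?_)
  exact continuous_sigma fun d => by fun_prop

/-- A loop in the complement of the graph runs in one of the punctured disks; its projection to
the graph follows a lift to `ℝ` of its angular coordinate. -/
theorem exists_unwinding {δ : C(unitInterval, (G.ribbonSpace O).carrier)}
    (hδ : ∀ t, G.height O (δ t) ≠ 0) (hl : δ 1 = δ 0) :
    ∃ (d₀ : G.D) (x : C(unitInterval, ℝ)) (m : ℤ), (O.nextPerm ^ m) d₀ = d₀ ∧ x 1 = x 0 + m ∧
      ∀ t, ∃ (i : ℤ) (s : unitInterval), x t = i + s ∧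
        (G.retraction O).map (δ t) = G.edgePt ((O.nextPerm ^ i) d₀) s := by
  obtain ⟨d₀, t₀, s₀, h0⟩ := G.exists_strip_of_height_ne_zero O (hδ 0)
  have hν := minimalPeriod_perm_pos O.nextPerm d₀
  set L := Function.minimalPeriod O.nextPerm d₀ with hL
  have hLp : (0 : ℝ) < L := by exact_mod_cast hν
  have hpi := Real.pi_pos
  -- a point of the loop is either in the disk of `d₀`, or its polar coordinate vanishes
  have hstrip : ∀ t, polar O d₀ (δ t) ≠ 0 → ‖polar O d₀ (δ t)‖ = G.height O (δ t) ∧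
      ∃ (i : ℤ) (s : unitInterval), (G.retraction O).map (δ t) = G.edgePt ((O.nextPerm ^ i) d₀) s ∧
        polar O d₀ (δ t) = (G.height O (δ t) : ℂ) * cyclePoint O.nextPerm d₀ (i + s) := by
    intro t ht
    obtain ⟨d, u, s, h1⟩ := G.exists_strip_of_height_ne_zero O (hδ t)
    have hd : ∃ j : ℤ, (O.nextPerm ^ j) d₀ = d := by
      by_contra h
      apply ht
      rw [h1, polar_stripMk, cycleStart_of_not _ _ h, zero_mul, mul_zero]
    obtain ⟨j, rfl⟩ := hd
    have h2 : polar O d₀ (δ t) = (G.height O (δ t) : ℂ) * cyclePoint O.nextPerm d₀ (j + u) := by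
      rw [h1, polar_stripMk, cycleStart_zpow, ← Circle.coe_mul, ← cyclePoint_add]
      rfl
    refine ⟨?_, j, u, ?_, h2⟩
    · rw [h2, norm_mul, Circle.norm_coe, mul_one, Complex.norm_real, Real.norm_eq_abs,
        abs_of_nonneg (G.height_nonneg O _)]
    · rw [h1, edgePt_coe]
      rfl
  have hne : ∀ t, polar O d₀ (δ t) ≠ 0 := by
    have hopen : IsOpen {t | polar O d₀ (δ t) ≠ 0} :=
      isOpen_ne.preimage ((continuous_polar O d₀).comp δ.continuous)
    have heq : {t | polar O d₀ (δ t) ≠ 0} = {t | ‖polar O d₀ (δ t)‖ = G.height O (δ t)} := by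
      ext t
      refine ⟨fun h => (hstrip t h).1, fun (h : _ = _) h' => hδ t ?_⟩
      rw [← h, h', norm_zero]
    have hclosed : IsClosed {t | polar O d₀ (δ t) ≠ 0} := by
      rw [heq]
      exact isClosed_eq ((continuous_polar O d₀).comp δ.continuous).norm
        ((G.continuous_height O).comp δ.continuous)
    have h1 : {t | polar O d₀ (δ t) ≠ 0} = Set.univ := by
      refine IsClopen.eq_univ ⟨hclosed, hopen⟩ ⟨0, ?_⟩
      change polar O d₀ (δ 0) ≠ 0
      have hs : (s₀ : ℝ) ≠ 0 := by
        have := hδ 0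
        rwa [h0] at this
      have hz := cycleStart_zpow O.nextPerm d₀ 0
      rw [zpow_zero, Equiv.Perm.one_apply] at hz
      rw [h0, polar_stripMk, hz]
      exact mul_ne_zero (Complex.ofReal_ne_zero.2 hs)
        (mul_ne_zero (Circle.coe_ne_zero _) (Circle.coe_ne_zero _))
    intro t
    exact (Set.eq_univ_iff_forall.1 h1) t
  -- the angular coordinate of the loop and its lift
  have hc : ∀ t, ‖polar O d₀ (δ t) / (G.height O (δ t) : ℂ)‖ = 1 := fun t => by
    rw [norm_div, (hstrip t (hne t)).1, Complex.norm_real, Real.norm_eq_abs,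
      abs_of_nonneg (G.height_nonneg O _), div_self (hδ t)]
  let c : C(unitInterval, Circle) :=
    ⟨fun t => ⟨polar O d₀ (δ t) / (G.height O (δ t) : ℂ), mem_sphere_zero_iff_norm.2 (hc t)⟩, by
      refine Continuous.subtype_mk ?_ _
      refine ((continuous_polar O d₀).comp δ.continuous).div ?_ fun t =>
        Complex.ofReal_ne_zero.2 (hδ t)
      exact Complex.continuous_ofReal.comp ((G.continuous_height O).comp δ.continuous)⟩
  obtain ⟨θ, hθ⟩ := Circle.exp_surjective (c 0)
  obtain ⟨Γ, hΓ, -⟩ := Circle.isCoveringMap_exp.exists_path_lifts c θ hθ.symm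
  let x : C(unitInterval, ℝ) := ⟨fun t => Γ t * L / (2 * Real.pi), by fun_prop⟩
  have hx : ∀ t, cyclePoint O.nextPerm d₀ (x t) = c t := by
    intro t
    rw [← congrFun hΓ t]
    change Circle.exp _ = Circle.exp _
    congr 1
    change 2 * Real.pi * (Γ t * L / (2 * Real.pi)) / L = Γ t
    field_simp
  obtain ⟨k, hk⟩ : ∃ k : ℤ, x 1 = x 0 + k * L := by
    rw [hL, ← cyclePoint_eq_iff, hx, hx]
    apply Circle.ext
    change polar O d₀ (δ 1) / (G.height O (δ 1) : ℂ) = polar O d₀ (δ 0) / (G.height O (δ 0) : ℂ)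
    rw [hl]
  refine ⟨d₀, x, k * L, ?_, ?_, fun t => ?_⟩
  · have := (zpow_apply_eq_iff O.nextPerm d₀ (i := k * L) (j := 0)).2 ⟨k, by rw [zero_add]⟩
    rwa [zpow_zero, Equiv.Perm.one_apply] at this
  · rw [hk]
    push_cast
    rfl
  · obtain ⟨-, i, s, h1, h2⟩ := hstrip t (hne t)
    have h3 : cyclePoint O.nextPerm d₀ (x t) = cyclePoint O.nextPerm d₀ (i + s) := by
      rw [hx]
      apply Circle.ext
      change polar O d₀ (δ t) / (G.height O (δ t) : ℂ) = _
      rw [h2, mul_div_cancel_left₀ _ (Complex.ofReal_ne_zero.2 (hδ t))]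
    obtain ⟨j, hj⟩ := (cyclePoint_eq_iff _ _).1 h3
    refine ⟨i + j * L, s, ?_, ?_⟩
    · rw [hj]
      push_cast
      ring
    · rw [h1]
      congr 1
      exact (zpow_apply_eq_iff O.nextPerm d₀).2 ⟨-j, by ring⟩

end Graph

end

section

/-! ### Boundary cycles are determined by the homotopy type of the surface relative to the graph -/

section Boundary

variable {E : Type} [Fintype E]

theorem orbitLine_add (N : Equiv.Perm (E × Bool)) (d : E × Bool) (i : ℤ) (s : unitInterval) :
    orbitLine N d (i + s) = (Graph.rose E).edgePt ((N ^ i) d) s := by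
  unfold orbitLine
  rw [Int.floor_intCast_add, Int.fract_intCast_add]
  rcases eq_or_lt_of_le s.2.2 with h | h
  · rw [h, Int.floor_one, Int.fract_one]
    exact ((Graph.rose E).edgePt_zero ((N ^ (i + 1)) d)).trans
      ((Graph.rose E).edgePt_one ((N ^ i) d)).symm
  · rw [Int.floor_eq_zero_iff.2 ⟨s.2.1, h⟩, Int.fract_eq_self.2 ⟨s.2.1, h⟩, add_zero]

/-- The line at height `s` along the boundary cycle of a directed edge. -/
def boundaryLine {G : Graph} (O : G.Ribbon) (d : G.D) (s : ℝ) (x : ℝ) : (G.ribbonSpace O).carrier :=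
  Graph.stripPt O ((O.nextPerm ^ ⌊x⌋) d) (Int.fract x) s

theorem continuous_boundaryLine {G : Graph} (O : G.Ribbon) (d : G.D) (s : ℝ) :
    Continuous (boundaryLine O d s) := by
  refine continuous_floor_glue
    (f := fun i x => Graph.stripPt O ((O.nextPerm ^ i) d) (x - i) s) (fun i => ?_) fun i => ?_
  · exact (Graph.continuous_stripPt O _).comp (f := fun x : ℝ => (x - i, s)) (by fun_prop)
  · push_cast
    rw [add_sub_cancel_left, sub_self, Graph.stripPt_side, ← O.nextPerm_apply]
    have h : O.nextPerm ((O.nextPerm ^ i) d) = (O.nextPerm ^ (i + 1)) d := by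
      rw [add_comm, zpow_add, zpow_one]
      rfl
    rw [h]

theorem height_boundaryLine {G : Graph} (O : G.Ribbon) (d : G.D) {s : ℝ} (hs : 0 ≤ s) (x : ℝ) :
    G.height O (boundaryLine O d s x) = s := Real.coe_toNNReal s hs

theorem retraction_boundaryLine (O : (Graph.rose E).Ribbon) (d : E × Bool) (s x : ℝ) :
    ((Graph.rose E).retraction O).map (boundaryLine O d s x) = orbitLine O.nextPerm d x := rfl

theorem bar_ne (d : E × Bool) : bar d ≠ d := (Graph.rose E).rev_ne d

/-- The automorphism of the half edges given by an automorphism of a rose. -/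
def letterPerm (k : Graph.GIso (Graph.rose E) (Graph.rose E)) : Equiv.Perm (E × Bool) := k.onD

theorem letterPerm_bar (k : Graph.GIso (Graph.rose E) (Graph.rose E)) (d : E × Bool) :
    letterPerm k (bar d) = bar (letterPerm k d) := k.onD_rev d

theorem letterPerm_inv_bar (k : Graph.GIso (Graph.rose E) (Graph.rose E)) (d : E × Bool) :
    (letterPerm k)⁻¹ (bar d) = bar ((letterPerm k)⁻¹ d) := by
  rw [Equiv.Perm.inv_eq_iff_eq, letterPerm_bar]
  exact congrArg bar (Equiv.apply_symm_apply (letterPerm k) d).symm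

/-- The successor permutation of a ribbon structure on a rose. -/
def succPerm (O : (Graph.rose E).Ribbon) : Equiv.Perm (E × Bool) := O.succ

/-- If a homeomorphism of ribbon surfaces of roses is compatible, up to homotopy and an
automorphism of the rose, with the projections to the rose, then it takes boundary cycles to boundary
cycles, possibly reversed. A boundary loop is pushed so far towards its puncture that its image
avoids the graph in the other surface; the image then winds around a puncture there, and its
conjugacy class in the free group is a power of the class of a boundary cycle. -/
theorem succ_eq_of_homotopic {O O' : (Graph.rose E).Ribbon}
    (hO : ∀ d : E × Bool, succPerm O d ≠ d) (hO' : ∀ d : E × Bool, succPerm O' d ≠ d)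
    (h : ((Graph.rose E).ribbonSpace O).carrier ≃ₜ ((Graph.rose E).ribbonSpace O').carrier)
    (k : Graph.GIso (Graph.rose E) (Graph.rose E))
    (F : C(unitInterval × ((Graph.rose E).ribbonSpace O).carrier, (Graph.rose E).space.carrier))
    (hF0 : ∀ z, F (0, z) = ((Graph.rose E).retraction O).map z)
    (hF1 : ∀ z, F (1, z) = k.map.map (((Graph.rose E).retraction O').map (h z)))
    (d : E × Bool) :
    succPerm O d = (letterPerm k * succPerm O' * (letterPerm k)⁻¹) d ∨
    succPerm O d = (letterPerm k * succPerm O' * (letterPerm k)⁻¹)⁻¹ d := by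
  let ν : Equiv.Perm (E × Bool) := O.nextPerm
  let ν' : Equiv.Perm (E × Bool) := O'.nextPerm
  let κ := letterPerm k
  let N := κ * ν' * κ⁻¹
  have hνs : ∀ e : E × Bool, ν e = succPerm O (bar e) := fun _ => rfl
  have hνs' : ∀ e : E × Bool, ν' e = succPerm O' (bar e) := fun _ => rfl
  have hNs : ∀ e : E × Bool, N e = (κ * succPerm O' * κ⁻¹) (bar e) := fun e => by
    change κ (ν' (κ⁻¹ e)) = κ (succPerm O' (κ⁻¹ (bar e)))
    rw [hνs', letterPerm_inv_bar]
  have hν : ∀ e, ν e ≠ bar e := fun e => hO _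
  have hN : ∀ e, N e ≠ bar e := fun e he => by
    rw [hNs] at he
    have h1 : κ (succPerm O' (κ⁻¹ (bar e))) = bar e := he
    rw [← Equiv.Perm.eq_inv_iff_eq] at h1
    exact hO' _ h1
  -- a height above the preimage of the graph
  obtain ⟨s, hs0, hs⟩ : ∃ s : ℝ, 0 < s ∧ ∀ z, (Graph.rose E).height O z = s →
      (Graph.rose E).height O' (h z) ≠ 0 := by
    have hK : IsCompact ((Graph.rose E).height O '' (h.symm ''
        Set.range ((Graph.rose E).inclusion O').map)) :=
      ((isCompact_range (ContinuousMap.continuous _)).image h.symm.continuous).image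
        ((Graph.rose E).continuous_height O)
    obtain ⟨M, hM⟩ := hK.bddAbove
    refine ⟨max M 0 + 1, by positivity, fun z hz h0 => ?_⟩
    obtain ⟨y, hy⟩ := (Graph.rose E).exists_inclusion_of_height_eq_zero O' h0
    have h1 := hM ⟨z, ⟨h z, ⟨y, hy⟩, h.symm_apply_apply z⟩, rfl⟩
    rw [hz] at h1
    linarith [le_max_left M 0]
  let b := boundaryLine O (bar d) s
  have hb : Continuous b := continuous_boundaryLine O (bar d) s
  let ℓ := orderOf ν
  have hℓ : 0 < ℓ := orderOf_pos ν
  have hνℓ : (ν ^ ℓ) (bar d) = bar d := by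
    rw [pow_orderOf_eq_one]
    rfl
  have hclosed : b (ℓ * (1 : unitInterval)) = b (ℓ * (0 : unitInterval)) := by
    have h1 : (ν ^ ((ℓ : ℕ) : ℤ)) (bar d) = (ν ^ (0 : ℤ)) (bar d) := by
      rw [zpow_natCast, hνℓ]
      rfl
    change Graph.stripPt O ((ν ^ ⌊(ℓ : ℝ) * (1 : unitInterval)⌋) (bar d)) _ _ =
      Graph.stripPt O ((ν ^ ⌊(ℓ : ℝ) * (0 : unitInterval)⌋) (bar d)) _ _
    rw [Set.Icc.coe_one, Set.Icc.coe_zero, mul_one, mul_zero, Int.floor_natCast,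
      Int.floor_zero, h1, Int.fract_natCast, Int.fract_zero]
  let δ : C(unitInterval, ((Graph.rose E).ribbonSpace O').carrier) :=
    ⟨fun t => h (b (ℓ * t)), h.continuous.comp (hb.comp (by fun_prop))⟩
  obtain ⟨d₀, x, m, hm, hx, hr⟩ := Graph.exists_unwinding O' (δ := δ)
    (fun t => hs _ (height_boundaryLine O _ hs0.le _)) (congrArg h hclosed)
  have hpow : ∀ i : ℤ, N ^ i = κ * ν' ^ i * κ⁻¹ := fun i => conj_zpow
  have hNk : ∀ i : ℤ, (N ^ i) (κ d₀) = κ ((ν' ^ i) d₀) := fun i => by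
    rw [hpow]
    change κ ((ν' ^ i) (κ⁻¹ (κ d₀))) = _
    rw [show κ⁻¹ (κ d₀) = d₀ from κ.symm_apply_apply d₀]
  have key := apply_eq_of_homotopy hν hN hℓ hνℓ (d₀ := κ d₀) (m := m)
    (by rw [hNk]; exact congrArg κ hm) hx
    (H := F.comp ⟨fun z => (z.1, b (ℓ * z.2)), by fun_prop⟩)
    (fun u => congrArg (fun z => F (u, z)) hclosed)
    (fun t => (hF0 _).trans (retraction_boundaryLine O (bar d) s _))
    (fun t => by
      obtain ⟨i, u, h1, h2⟩ := hr t
      refine (hF1 _).trans ((congrArg k.map.map h2).trans ?_)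
      rw [h1, orbitLine_add, hNk]
      rfl)
  rw [hνs, bar_bar] at key
  refine key.imp (fun h1 => ?_) fun h1 => ?_
  · rw [h1, hNs, bar_bar]
  · rw [h1]
    change bar (N⁻¹ (bar (bar d))) = _
    rw [bar_bar]
    refine Equiv.injective (κ * succPerm O' * κ⁻¹) ?_
    refine Eq.trans ?_ (Equiv.apply_symm_apply (κ * succPerm O' * κ⁻¹) d).symm
    rw [← hNs]
    exact Equiv.apply_symm_apply N d

end Boundary

/-! ### Distances between the ends of an edge -/

section Invariant

variable {E : Type}

/-- The distances, along a cyclic order of the half edges, from a half edge to the other half of the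
same edge. -/
def endDistances (σ : Equiv.Perm (E × Bool)) : Set ℕ := {j | ∃ d, (σ ^ j) d = bar d}

theorem endDistances_inv (σ : Equiv.Perm (E × Bool)) : endDistances σ⁻¹ = endDistances σ := by
  have key : ∀ σ : Equiv.Perm (E × Bool), endDistances σ ⊆ endDistances σ⁻¹ := by
    rintro σ j ⟨d, hd⟩
    refine ⟨bar d, ?_⟩
    rw [inv_pow, Equiv.Perm.inv_eq_iff_eq, bar_bar, hd]
  refine Set.Subset.antisymm ?_ (key σ)
  have := key σ⁻¹
  rwa [inv_inv] at this

theorem endDistances_conj (κ σ : Equiv.Perm (E × Bool)) (hκ : ∀ d, κ (bar d) = bar (κ d)) :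
    endDistances (κ * σ * κ⁻¹) = endDistances σ := by
  ext j
  constructor
  · rintro ⟨d, hd⟩
    refine ⟨κ⁻¹ d, ?_⟩
    rw [conj_pow, Equiv.Perm.mul_apply, Equiv.Perm.mul_apply] at hd
    apply κ.injective
    rw [hd, hκ]
    exact congrArg bar (κ.apply_symm_apply d).symm
  · rintro ⟨d, hd⟩
    refine ⟨κ d, ?_⟩
    rw [conj_pow, Equiv.Perm.mul_apply, Equiv.Perm.mul_apply,
      show κ⁻¹ (κ d) = d from κ.symm_apply_apply d, hd, hκ]

/-- A cyclic order is determined up to reversal by the pairs of neighbors. -/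
theorem eq_or_eq_inv {D : Type} [Fintype D] {σ τ : Equiv.Perm D} (hσ : ∀ x y, σ.SameCycle x y)
    (hD : 2 < Fintype.card D) (h : ∀ x, σ x = τ x ∨ σ x = τ⁻¹ x) : σ = τ ∨ σ = τ⁻¹ := by
  classical
  by_cases h0 : ∃ x, σ x = τ x
  · left
    obtain ⟨x, hx⟩ := h0
    have h2 : ∀ y, σ (σ y) ≠ y := by
      intro y hy
      have h3 : ∀ n : ℕ, (σ ^ n) y = y ∨ (σ ^ n) y = σ y := by
        intro n
        induction n with
        | zero => exact .inl rfl
        | succ n ih =>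
          rw [pow_succ', Equiv.Perm.mul_apply]
          rcases ih with ih | ih
          · exact .inr (by rw [ih])
          · exact .inl (by rw [ih, hy])
      have h4 : (Finset.univ : Finset D) ⊆ {y, σ y} := by
        intro z _
        obtain ⟨n, hn⟩ := (hσ y z).exists_nat_pow_eq
        rw [Finset.mem_insert, Finset.mem_singleton, ← hn]
        exact h3 n
      have h5 := (Finset.card_le_card h4).trans Finset.card_le_two
      rw [Finset.card_univ] at h5
      omega
    have h3 : ∀ n : ℕ, σ ((σ ^ n) x) = τ ((σ ^ n) x) := by
      intro n
      induction n with
      | zero => exact hx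
      | succ n ih =>
        rw [pow_succ', Equiv.Perm.mul_apply]
        refine (h _).resolve_right fun h6 => h2 ((σ ^ n) x) ?_
        rw [h6, ih]
        exact τ.symm_apply_apply _
    ext y
    obtain ⟨n, rfl⟩ := (hσ x y).exists_nat_pow_eq
    rw [h3]
  · right
    push Not at h0
    ext x
    rw [(h x).resolve_left (h0 x)]

end Invariant

end

section

/-! ### Roses drawn in a surface -/

/-- An orientation preserving homeomorphism, as an isomorphism in the pointed homotopy category. -/
def IsOriented.iso {S T : OrientedSpace} {h : S.space.carrier ≃ₜ T.space.carrier}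
    (hh : IsOriented S T h) : S.space ≅ T.space where
  hom := hh.cls
  inv := hh.symm.cls
  hom_inv_id := by
    refine (PtdMap.cls_comp _ _).symm.trans (congrArg PtdMap.cls ?_)
    apply PtdMap.ext
    ext x
    exact h.symm_apply_apply x
  inv_hom_id := by
    refine (PtdMap.cls_comp _ _).symm.trans (congrArg PtdMap.cls ?_)
    apply PtdMap.ext
    ext x
    exact h.apply_symm_apply x

variable {E : Type} [Fintype E]

theorem admissible_rose [Nonempty E] : (Graph.rose E).Admissible where
  connected _ _ := Relation.ReflTransGen.refl
  valence_ge v hv := absurd (Subsingleton.elim (α := Unit) v _) hv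
  valence_base := by
    have h1 : (Graph.rose E).valence (Graph.rose E).base = Nat.card (E × Bool) :=
      Nat.card_congr (Equiv.subtypeUnivEquiv fun _ => rfl)
    rw [h1, Nat.card_eq_fintype_card, Fintype.card_prod, Fintype.card_bool]
    have := Fintype.card_pos (α := E)
    omega
  not_separating _ h := h fun _ _ => Relation.ReflTransGen.refl

theorem degree_rose : (Graph.rose E).degree = 0 := by
  classical
  unfold Graph.degree
  refine Finset.sum_eq_zero fun x hx => ?_
  exact absurd (Subsingleton.elim (α := Unit) x _) (Finset.mem_filter.1 hx).2

section Drawn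

variable [Nonempty E] {n : ℕ} {S : OrientedSpace} (ψ : R n ≅ S.space)
  {O : (Graph.rose E).Ribbon}
  {h : ((Graph.rose E).ribbonSpace O).carrier ≃ₜ S.space.carrier}
  (hh : IsOriented ((Graph.rose E).ribbonSurface O) S h)

/-- An identification of a ribbon surface of the rose with `S`, as an isomorphism in the pointed
homotopy category. -/
def drawnIso : (Graph.rose E).ribbonSpace O ≅ S.space := hh.iso

/-- The rose, marked by the identification of one of its ribbon surfaces with the marked surface. -/
def drawnRose : MarkedGraph n where
  graph := Graph.rose E
  admissible := admissible_rose
  marking := ψ ≪≫ (drawnIso hh).symm ≪≫ ((Graph.rose E).inclusionIso O).symm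

theorem canBeDrawn_drawnRose : (drawnRose ψ hh).CanBeDrawn S ψ := by
  refine ⟨O, h, hh, ?_⟩
  change (ψ.hom ≫ (drawnIso hh).inv ≫ ((Graph.rose E).inclusionIso O).inv) ≫
    ((Graph.rose E).inclusionIso O).hom ≫ (drawnIso hh).hom = ψ.hom
  simp

/-- The vertex of the complex given by a ribbon structure on the rose. -/
def roseVertex : DegreeVertex S ψ 2 :=
  ⟨Quotient.mk _ (drawnRose ψ hh), drawnRose ψ hh, rfl, canBeDrawn_drawnRose ψ hh,
    (degree_rose (E := E)).trans_le (by norm_num)⟩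

/-- If two roses are in the same orbit, then their ribbon surfaces are homeomorphic by a
homeomorphism which is compatible, up to homotopy, with the projections to the roses. -/
theorem exists_homotopy_of_mem_orbit {O' : (Graph.rose E).Ribbon}
    {h' : ((Graph.rose E).ribbonSpace O').carrier ≃ₜ S.space.carrier}
    (hh' : IsOriented ((Graph.rose E).ribbonSurface O') S h')
    (hv : roseVertex ψ hh ∈ MulAction.orbit (MCG S)ᵐᵒᵖ (roseVertex ψ hh')) :
    ∃ (e : ((Graph.rose E).ribbonSpace O).carrier ≃ₜ ((Graph.rose E).ribbonSpace O').carrier)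
      (k : Graph.GIso (Graph.rose E) (Graph.rose E))
      (F : C(unitInterval × ((Graph.rose E).ribbonSpace O).carrier,
        (Graph.rose E).space.carrier)),
      (∀ z, F (0, z) = ((Graph.rose E).retraction O).map z) ∧
      ∀ z, F (1, z) = k.map.map (((Graph.rose E).retraction O').map (e z)) := by
  obtain ⟨f, hf⟩ := hv
  obtain ⟨f, rfl⟩ := MulOpposite.op_surjective f
  induction f using QuotientGroup.induction_on with
  | H f =>
    have h1 : Quotient.mk (MarkedGraph.setoid n)
        ((drawnRose ψ hh').act (markedAut S ψ (QuotientGroup.mk f))) =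
        Quotient.mk (MarkedGraph.setoid n) (drawnRose ψ hh) := congrArg Subtype.val hf
    obtain ⟨k, hk⟩ := Quotient.exact h1
    let r := ((Graph.rose E).inclusionIso O).inv
    let r' := ((Graph.rose E).inclusionIso O').inv
    let a : S.space ≅ S.space := homotopyClass S f
    let κ : (Graph.rose E).space ⟶ (Graph.rose E).space := k.map.cls
    have h2 : ((ψ.hom ≫ a.hom ≫ ψ.inv) ≫ (ψ.hom ≫ (drawnIso hh').inv ≫ r')) ≫ κ =
        ψ.hom ≫ (drawnIso hh).inv ≫ r := hk
    have h3 : (drawnIso hh).hom ≫ a.hom ≫ (drawnIso hh').inv ≫ r' ≫ κ = r := by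
      have h4 : ψ.hom ≫ a.hom ≫ (drawnIso hh').inv ≫ r' ≫ κ = ψ.hom ≫ (drawnIso hh).inv ≫ r := by
        rw [← h2]
        simp only [Category.assoc, Iso.inv_hom_id_assoc]
      rw [cancel_epi] at h4
      rw [h4, Iso.hom_inv_id_assoc]
    let e := h.trans ((f : S.space.carrier ≃ₜ S.space.carrier).trans h'.symm)
    let m₁ : PtdMap ((Graph.rose E).ribbonSpace O) (Graph.rose E).space :=
      ((((⟨⟨h, h.continuous⟩, hh.map_pt⟩ : PtdMap _ S.space).comp
        (⟨⟨f.1, f.1.continuous⟩, f.2.map_pt⟩ : PtdMap S.space S.space)).comp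
        (⟨⟨h'.symm, h'.symm.continuous⟩, hh'.symm.map_pt⟩ :
          PtdMap S.space ((Graph.rose E).ribbonSpace O'))).comp
        ((Graph.rose E).retraction O')).comp k.map
    have h5 : m₁.cls = ((Graph.rose E).retraction O).cls := by
      refine Eq.trans ?_ h3
      simp only [← Category.assoc]
      rfl
    obtain ⟨H⟩ := Quotient.exact h5.symm
    exact ⟨e, k, H.toContinuousMap, H.apply_zero, H.apply_one⟩

/-- The set of end distances of a ribbon structure on the rose is an invariant of the orbit. -/
theorem endDistances_eq_of_mem_orbit {O' : (Graph.rose E).Ribbon}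
    {h' : ((Graph.rose E).ribbonSpace O').carrier ≃ₜ S.space.carrier}
    (hh' : IsOriented ((Graph.rose E).ribbonSurface O') S h') (hE : 1 < Fintype.card E)
    (hv : roseVertex ψ hh ∈ MulAction.orbit (MCG S)ᵐᵒᵖ (roseVertex ψ hh')) :
    endDistances (succPerm O) = endDistances (succPerm O') := by
  have hcard : 2 < Fintype.card (E × Bool) := by
    rw [Fintype.card_prod, Fintype.card_bool]
    omega
  have hcyc : ∀ (O : (Graph.rose E).Ribbon) (x y : E × Bool), (succPerm O).SameCycle x y :=
    fun O x y => O.cyclic x y rfl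
  have hfix : ∀ (O : (Graph.rose E).Ribbon) (x : E × Bool), succPerm O x ≠ x := by
    intro O x hx
    obtain ⟨i, hi⟩ := hcyc O x (bar x)
    rw [Equiv.Perm.zpow_apply_eq_self_of_apply_eq_self hx] at hi
    exact bar_ne x hi.symm
  obtain ⟨e, k, F, hF0, hF1⟩ := exists_homotopy_of_mem_orbit ψ hh hh' hv
  have h1 := succ_eq_of_homotopic (hfix O) (hfix O') e k F hF0 hF1
  have h2 := endDistances_conj (letterPerm k) (succPerm O') (letterPerm_bar k)
  rcases eq_or_eq_inv (hcyc O) hcard h1 with h3 | h3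
  · rw [h3, h2]
  · rw [h3, endDistances_inv, h2]

end Drawn

/-- Ribbon structures on roses with different sets of end distances give different vertices of the
quotient. -/
theorem card_le_card_quotientVertex [Nonempty E] {n : ℕ} {S : OrientedSpace} (ψ : R n ≅ S.space)
    (hE : 1 < Fintype.card E) {C : Type} [Fintype C] (O : C → (Graph.rose E).Ribbon)
    (hO : ∀ c, ∃ h, IsOriented ((Graph.rose E).ribbonSurface (O c)) S h)
    (hinj : Function.Injective fun c => endDistances (succPerm (O c))) :
    (Fintype.card C : ℕ∞) ≤ ENat.card (QuotientVertex S ψ 2) := by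
  choose h hh using hO
  have hi : Function.Injective fun c =>
      (Quotient.mk _ (roseVertex ψ (hh c)) : QuotientVertex S ψ 2) := by
    intro c c' hc
    exact hinj (endDistances_eq_of_mem_orbit ψ (hh c) (hh c') hE (Quotient.exact hc))
  rw [← ENat.card_eq_coe_fintype_card]
  exact ENat.card_le_card_of_injective hi

end

section

/-! ### The distances between the ends of the edges in the words of the family -/

variable {E : Type} [DecidableEq E]

/-- The distance between the two letters of an edge in a word. -/
def edgeLen (L : List (E × Bool)) (e : E) : ℕ := Nat.dist (L.idxOf (pos e)) (L.idxOf (neg e))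

theorem edgeLen_append_append {P X Q : List (E × Bool)} {e : E} (h1 : pos e ∈ X) (h2 : neg e ∈ X)
    (h3 : pos e ∉ P) (h4 : neg e ∉ P) : edgeLen (P ++ (X ++ Q)) e = edgeLen X e := by
  unfold edgeLen
  rw [List.idxOf_append_of_notMem h3, List.idxOf_append_of_notMem h4,
    List.idxOf_append_of_mem h1, List.idxOf_append_of_mem h2, Nat.dist_add_add_left]

/-- The edges which are added in a stage. -/
def Stage.edges {E : Type} : Stage E → List E
  | .core x y z w _ => [x, y, z, w]
  | .handles x y z w _ => [x, y, z, w]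
  | .punctures a b _ => [a, b]

/-- The distances between the ends of the edges which are added in a stage to a word of length
`k`. -/
def Stage.lens {E : Type} (k : ℕ) : Stage E → List ℕ
  | .core _ _ _ _ false => [4, 4, 4, 4]
  | .core _ _ _ _ true => [5, 5, 2, 4]
  | .handles _ _ _ _ false => [2, 2, 2, 2]
  | .handles _ _ _ _ true => [k + 5, 2, k + 5, 2]
  | .punctures _ _ false => [1, 1]
  | .punctures _ _ true => [k + 1, 1]

theorem Stage.mem_extend {E : Type} (s : Stage E) (X : List (E × Bool)) (d : E × Bool) :
    d ∈ s.extend X ↔ d ∈ X ∨ d.1 ∈ s.edges := by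
  rcases s with ⟨x, y, z, w, _ | _⟩ | ⟨x, y, z, w, _ | _⟩ | ⟨a, b, _ | _⟩ <;>
    rcases d with ⟨e, _ | _⟩ <;> simp [Stage.extend, Stage.edges] <;> tauto

theorem Stage.length_extend {E : Type} (s : Stage E) (X : List (E × Bool)) :
    (s.extend X).length = X.length + 2 * s.edges.length := by
  rcases s with ⟨x, y, z, w, _ | _⟩ | ⟨x, y, z, w, _ | _⟩ | ⟨a, b, _ | _⟩ <;>
    simp [Stage.extend, Stage.edges]

/-- Adding a stage does not separate the letters of the previous stages. -/
theorem Stage.edgeLen_extend_old (s : Stage E) {X : List (E × Bool)} {e : E} (h1 : pos e ∈ X)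
    (h2 : neg e ∈ X) (he : e ∉ s.edges) : edgeLen (s.extend X) e = edgeLen X e := by
  have h0 : ∀ Q, edgeLen (X ++ Q) e = edgeLen X e := fun Q =>
    edgeLen_append_append (P := []) h1 h2 (by simp) (by simp)
  rcases s with ⟨x, y, z, w, _ | _⟩ | ⟨x, y, z, w, _ | _⟩ | ⟨a, b, _ | _⟩
  · exact h0 _
  · exact h0 _
  · exact h0 _
  · simp only [Stage.edges, List.mem_cons, List.not_mem_nil, or_false, not_or] at he
    exact edgeLen_append_append h1 h2 (by simp [he]) (by simp [he])
  · exact h0 _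
  · simp only [Stage.edges, List.mem_cons, List.not_mem_nil, or_false, not_or] at he
    exact edgeLen_append_append (P := [pos a]) h1 h2 (by simp [he]) (by simp)

theorem Stage.edgeLen_extend_new (s : Stage E) {X : List (E × Bool)} (hs : s.edges.Nodup)
    (h : ∀ e ∈ s.edges, ∀ b, (e, b) ∉ X) : s.edges.map (edgeLen (s.extend X)) = s.lens X.length := by
  rcases s with ⟨x, y, z, w, _ | _⟩ | ⟨x, y, z, w, _ | _⟩ | ⟨a, b, _ | _⟩ <;>
  · simp only [Stage.edges, List.mem_cons, List.not_mem_nil, or_false, forall_eq_or_imp, forall_eq,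
      List.nodup_cons, not_or, List.nodup_nil, and_true, not_false_eq_true] at h hs
    simp [Stage.edges, Stage.extend, Stage.lens, edgeLen, List.idxOf_append, h, hs, Nat.dist,
      Ne.symm, eq_comm]
    omega

/-- The word of the first `r` terms of a sequence of stages. -/
def seqWord {E : Type} (st : ℕ → Stage E) (r : ℕ) : List (E × Bool) :=
  stageWord ((List.range r).map st)

theorem seqWord_succ {E : Type} (st : ℕ → Stage E) (r : ℕ) :
    seqWord st (r + 1) = (st r).extend (seqWord st r) := by
  unfold seqWord
  rw [List.range_succ, List.map_append, List.map_singleton, stageWord_concat]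

theorem mem_seqWord {E : Type} (st : ℕ → Stage E) (r : ℕ) (d : E × Bool) :
    d ∈ seqWord st r ↔ ∃ i < r, d.1 ∈ (st i).edges := by
  induction r with
  | zero => simp [seqWord, stageWord]
  | succ r ih =>
    rw [seqWord_succ, Stage.mem_extend, ih]
    constructor
    · rintro (⟨i, hi, h⟩ | h)
      · exact ⟨i, by omega, h⟩
      · exact ⟨r, by omega, h⟩
    · rintro ⟨i, hi, h⟩
      rcases Nat.lt_succ_iff_lt_or_eq.1 hi with h' | rfl
      · exact .inl ⟨i, h', h⟩
      · exact .inr h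

/-- The distances in a word are those of its stages. -/
theorem exists_edgeLen_seqWord {st : ℕ → Stage E} {r : ℕ} (hnd : ∀ i < r, (st i).edges.Nodup)
    (hdis : ∀ i j, i < j → j < r → ∀ e ∈ (st i).edges, e ∉ (st j).edges) (ℓ : ℕ) :
    (∃ e, pos e ∈ seqWord st r ∧ edgeLen (seqWord st r) e = ℓ) ↔
      ∃ i < r, ℓ ∈ (st i).lens (seqWord st i).length := by
  induction r with
  | zero => simp [seqWord, stageWord]
  | succ r ih =>
    have ih' := ih (fun i hi => hnd i (by omega)) fun i j hij hj => hdis i j hij (by omega)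
    have hfresh : ∀ e ∈ (st r).edges, ∀ b, (e, b) ∉ seqWord st r := by
      intro e he b hb
      obtain ⟨i, hi, h⟩ := (mem_seqWord st r _).1 hb
      exact hdis i r hi (by omega) e h he
    have hnew := (st r).edgeLen_extend_new (hnd r (by omega)) hfresh
    have hold : ∀ e, pos e ∈ seqWord st r →
        edgeLen (seqWord st (r + 1)) e = edgeLen (seqWord st r) e := by
      intro e he
      have he' : neg e ∈ seqWord st r :=
        (mem_seqWord st r (neg e)).2 ((mem_seqWord st r (pos e)).1 he)
      rw [seqWord_succ]
      exact (st r).edgeLen_extend_old he he' fun h => hfresh e h true he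
    constructor
    · rintro ⟨e, he, rfl⟩
      rw [seqWord_succ, Stage.mem_extend] at he
      rcases he with he | he
      · obtain ⟨i, hi, h⟩ := ih'.1 ⟨e, he, (hold e he).symm⟩
        exact ⟨i, by omega, h⟩
      · refine ⟨r, by omega, ?_⟩
        rw [← hnew, seqWord_succ]
        exact List.mem_map_of_mem he
    · rintro ⟨i, hi, h⟩
      rcases Nat.lt_succ_iff_lt_or_eq.1 hi with h' | rfl
      · obtain ⟨e, he, rfl⟩ := ih'.2 ⟨i, h', h⟩
        refine ⟨e, ?_, hold e he⟩
        rw [seqWord_succ, Stage.mem_extend]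
        exact .inl he
      · rw [← hnew] at h
        obtain ⟨e, he, rfl⟩ := List.mem_map.1 h
        refine ⟨e, ?_, by rw [seqWord_succ]⟩
        rw [seqWord_succ, Stage.mem_extend]
        exact .inr he

/-- Distances between the ends of an edge are read off from a word, in both directions around the
cyclic order. -/
theorem mem_endDistances_formPerm {L : List (E × Bool)} (hL : L.Nodup) (hm : ∀ d, d ∈ L) {j : ℕ}
    (hj0 : 0 < j) (hj : j < L.length) : j ∈ endDistances L.formPerm ↔
      ∃ e, edgeLen L e = j ∨ edgeLen L e = L.length - j := by
  have hidx : ∀ d, (L.formPerm ^ j) d = bar d ↔ (L.idxOf d + j) % L.length = L.idxOf (bar d) := by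
    intro d
    have h1 := List.idxOf_lt_length_of_mem (hm d)
    have h2 := List.idxOf_lt_length_of_mem (hm (bar d))
    have h3 := List.formPerm_pow_apply_getElem L hL j (L.idxOf d) h1
    rw [List.getElem_idxOf] at h3
    rw [h3]
    conv_lhs => rhs; rw [← List.getElem_idxOf h2]
    exact hL.getElem_inj_iff
  have hcase : ∀ d, (L.formPerm ^ j) d = bar d ↔
      L.idxOf d + j = L.idxOf (bar d) ∨ L.idxOf d + j = L.idxOf (bar d) + L.length := by
    intro d
    have h1 := List.idxOf_lt_length_of_mem (hm d)
    have h2 := List.idxOf_lt_length_of_mem (hm (bar d))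
    rw [hidx]
    rcases Nat.lt_or_ge (L.idxOf d + j) L.length with h | h
    · rw [Nat.mod_eq_of_lt h]
      omega
    · rw [Nat.mod_eq_sub_mod h, Nat.mod_eq_of_lt (by omega)]
      omega
  constructor
  · rintro ⟨⟨e, b⟩, hd⟩
    refine ⟨e, ?_⟩
    rw [hcase] at hd
    have h1 := List.idxOf_lt_length_of_mem (hm (pos e))
    have h2 := List.idxOf_lt_length_of_mem (hm (neg e))
    cases b
    · change L.idxOf (neg e) + j = L.idxOf (pos e) ∨ L.idxOf (neg e) + j =
        L.idxOf (pos e) + L.length at hd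
      simp only [edgeLen, Nat.dist]
      omega
    · change L.idxOf (pos e) + j = L.idxOf (neg e) ∨ L.idxOf (pos e) + j =
        L.idxOf (neg e) + L.length at hd
      simp only [edgeLen, Nat.dist]
      omega
  · rintro ⟨e, he⟩
    have h1 := List.idxOf_lt_length_of_mem (hm (pos e))
    have h2 := List.idxOf_lt_length_of_mem (hm (neg e))
    have h3 : (L.idxOf (pos e) + j = L.idxOf (neg e) ∨ L.idxOf (pos e) + j =
        L.idxOf (neg e) + L.length) ∨ (L.idxOf (neg e) + j = L.idxOf (pos e) ∨ L.idxOf (neg e) + j =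
        L.idxOf (pos e) + L.length) := by
      simp only [edgeLen, Nat.dist] at he
      omega
    rcases h3 with h3 | h3
    · exact ⟨pos e, (hcase _).2 h3⟩
    · exact ⟨neg e, (hcase _).2 h3⟩

end

section

/-! ### The family of words -/

/-- A finite sequence, extended to all natural numbers by a default value. -/
def extendFin {α : Type} {n : ℕ} (f : Fin n → α) (d : α) (i : ℕ) : α :=
  if h : i < n then f ⟨i, h⟩ else d

theorem extendFin_of_lt {α : Type} {n : ℕ} (f : Fin n → α) (d : α) {i : ℕ} (h : i < n) :
    extendFin f d i = f ⟨i, h⟩ := dif_pos h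

theorem map_range_extendFin {α β : Type} {n : ℕ} (f : Fin n → α) (d : α) (k : α → β) :
    (List.range n).map (fun i => k (extendFin f d i)) = (List.finRange n).map fun i => k (f i) := by
  rw [← List.map_coe_finRange_eq_range, List.map_map]
  refine List.map_congr_left fun i _ => ?_
  simp [extendFin]

theorem flatMap_range_pair {α : Type} (f : ℕ → α) (n : ℕ) :
    (List.range n).flatMap (fun i => [f (2 * i), f (2 * i + 1)]) = (List.range (2 * n)).map f := by
  induction n with
  | zero => rfl
  | succ n ih =>
    rw [List.range_succ, List.flatMap_append, ih, Nat.mul_succ, List.range_succ, List.range_succ]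
    simp

/-- The stages of the words of the family: `m` stages which add two handles each, followed by stages
which add two punctures each. The `i`-th bit `c i` is the choice in the `i`-th stage, and the bit
`c₀` replaces the first stage by a core. -/
def familyStage {E : Type} (m : ℕ) (x y a : ℕ → E) (c₀ : Bool) (c : ℕ → Bool) (i : ℕ) : Stage E :=
  if i < m then
    if i = 0 ∧ c₀ then .core (x (2 * i)) (y (2 * i)) (x (2 * i + 1)) (y (2 * i + 1)) (c i)
    else .handles (x (2 * i)) (y (2 * i)) (x (2 * i + 1)) (y (2 * i + 1)) (c i)
  else .punctures (a (2 * (i - m))) (a (2 * (i - m) + 1)) (c i)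

section Family

variable {E : Type} (m q : ℕ) (x y a : ℕ → E) (c₀ : Bool) (c : ℕ → Bool)

theorem familyStage_add (k : ℕ) : familyStage m x y a c₀ c (m + k) =
    .punctures (a (2 * k)) (a (2 * k + 1)) (c (m + k)) := by
  unfold familyStage
  rw [if_neg (by omega), Nat.add_sub_cancel_left]

variable {m} in
theorem blocks_familyStage {i : ℕ} (hi : i < m) : (familyStage m x y a c₀ c i).blocks =
    [.handle (x (2 * i)) (y (2 * i)), .handle (x (2 * i + 1)) (y (2 * i + 1))] := by
  unfold familyStage
  rw [if_pos hi]
  split_ifs <;> rfl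

variable {m} in
theorem edges_familyStage {i : ℕ} (hi : i < m) : (familyStage m x y a c₀ c i).edges =
    [x (2 * i), y (2 * i), x (2 * i + 1), y (2 * i + 1)] := by
  unfold familyStage
  rw [if_pos hi]
  split_ifs <;> rfl

theorem flatMap_blocks_familyStage :
    ((List.range (m + q)).map (familyStage m x y a c₀ c)).flatMap Stage.blocks =
      (List.range (2 * m)).map (fun i => .handle (x i) (y i)) ++
      (List.range (2 * q)).map fun i => .puncture (a i) := by
  rw [List.range_add, List.map_append, List.flatMap_append, List.flatMap_map, List.map_map,
    List.flatMap_map, ← flatMap_range_pair, ← flatMap_range_pair]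
  congr 1
  · refine List.flatMap_congr fun i hi => ?_
    exact blocks_familyStage x y a c₀ c (List.mem_range.1 hi)
  · refine List.flatMap_congr fun k _ => ?_
    change (familyStage m x y a c₀ c (m + k)).blocks = _
    rw [familyStage_add]
    rfl

theorem length_seqWord_familyStage :
    (∀ i ≤ m, (seqWord (familyStage m x y a c₀ c) i).length = 8 * i) ∧
    ∀ k, (seqWord (familyStage m x y a c₀ c) (m + k)).length = 8 * m + 4 * k := by
  have h1 : ∀ i ≤ m, (seqWord (familyStage m x y a c₀ c) i).length = 8 * i := by
    intro i hi
    induction i with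
    | zero => rfl
    | succ i ih =>
      rw [seqWord_succ, Stage.length_extend, ih (by omega), edges_familyStage x y a c₀ c (by omega)]
      simp only [List.length_cons, List.length_nil]
      omega
  refine ⟨h1, fun k => ?_⟩
  induction k with
  | zero => rw [Nat.add_zero, h1 m le_rfl, Nat.mul_zero, Nat.add_zero]
  | succ k ih =>
    rw [← Nat.add_assoc, seqWord_succ, Stage.length_extend, ih, familyStage_add]
    simp only [Stage.edges, List.length_cons, List.length_nil]
    omega

/-- The distances which occur in the `i`-th stage. -/
theorem mem_lens_familyStage {i ℓ : ℕ}
    (h : ℓ ∈ (familyStage m x y a c₀ c i).lens (seqWord (familyStage m x y a c₀ c) i).length) :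
    (c₀ = true ∧ ℓ = 4) ∨ ℓ = 2 ∨ ℓ = 1 ∨ (i < m ∧ c i = true ∧ ℓ = 8 * i + 5) ∨
      (m ≤ i ∧ c i = true ∧ ℓ = 8 * m + 4 * (i - m) + 1) := by
  obtain ⟨h1, h2⟩ := length_seqWord_familyStage m x y a c₀ c
  rcases Nat.lt_or_ge i m with hi | hi
  · rw [h1 i hi.le] at h
    unfold familyStage at h
    rw [if_pos hi] at h
    split_ifs at h with h0
    · obtain ⟨rfl, h0⟩ := h0
      cases hc : c 0 <;> simp only [hc, Stage.lens, List.mem_cons, List.not_mem_nil] at h <;>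
        grind
    · cases hc : c i <;> simp only [hc, Stage.lens, List.mem_cons, List.not_mem_nil] at h <;>
        grind
  · obtain ⟨k, rfl⟩ := Nat.exists_eq_add_of_le hi
    rw [h2, familyStage_add] at h
    cases hc : c (m + k) <;> simp only [hc, Stage.lens, List.mem_cons, List.not_mem_nil] at h <;>
      grind

variable {m c c₀}

theorem four_mem_lens_familyStage (hm : 0 < m) (h : c₀ = true) :
    4 ∈ (familyStage m x y a c₀ c 0).lens (seqWord (familyStage m x y a c₀ c) 0).length := by
  unfold familyStage
  rw [if_pos hm, if_pos ⟨rfl, h⟩]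
  cases c 0 <;> simp [Stage.lens]

theorem handle_mem_lens_familyStage {i : ℕ} (hi : i < m) (h : c i = true) :
    8 * i + 5 ∈ (familyStage m x y a c₀ c i).lens
      (seqWord (familyStage m x y a c₀ c) i).length := by
  rw [(length_seqWord_familyStage m x y a c₀ c).1 i hi.le]
  unfold familyStage
  rw [if_pos hi]
  split_ifs with h0
  · rw [h, h0.1]
    simp [Stage.lens]
  · rw [h]
    simp [Stage.lens]

theorem puncture_mem_lens_familyStage {i : ℕ} (hi : m ≤ i) (h : c i = true) :
    8 * m + 4 * (i - m) + 1 ∈ (familyStage m x y a c₀ c i).lens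
      (seqWord (familyStage m x y a c₀ c) i).length := by
  obtain ⟨k, rfl⟩ := Nat.exists_eq_add_of_le hi
  rw [(length_seqWord_familyStage m x y a c₀ c).2, familyStage_add, h]
  simp [Stage.lens]

end Family

section Decode

variable {E : Type} [DecidableEq E] {m q : ℕ} {x y a : ℕ → E}

/-- The bits of a word of the family can be read off from the distances between the ends of the
edges: the distances are `1`, `2`, `4` or congruent to `1` modulo `4`, and their complements in the
length of the word are even or congruent to `3` modulo `4`. -/
theorem familyStage_bits (hm : 0 < m)
    (hnd : ∀ c₀ c, ∀ i < m + q, (familyStage m x y a c₀ c i).edges.Nodup)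
    (hdis : ∀ c₀ c i j, i < j → j < m + q → ∀ e ∈ (familyStage m x y a c₀ c i).edges,
      e ∉ (familyStage m x y a c₀ c j).edges)
    (hL : ∀ c₀ c, (seqWord (familyStage m x y a c₀ c) (m + q)).Nodup)
    (hmem : ∀ c₀ c d, d ∈ seqWord (familyStage m x y a c₀ c) (m + q)) {c₀ c₀' : Bool}
    {c c' : ℕ → Bool}
    (h : endDistances (seqWord (familyStage m x y a c₀ c) (m + q)).formPerm =
      endDistances (seqWord (familyStage m x y a c₀' c') (m + q)).formPerm) :
    c₀ = c₀' ∧ ∀ i < m + q, c i = c' i := by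
  have key : ∀ c₀ c j, 0 < j → j < 8 * m + 4 * q →
      (j ∈ endDistances (seqWord (familyStage m x y a c₀ c) (m + q)).formPerm ↔
      ∃ i < m + q, ∃ ℓ ∈ (familyStage m x y a c₀ c i).lens
        (seqWord (familyStage m x y a c₀ c) i).length, ℓ = j ∨ ℓ = 8 * m + 4 * q - j) := by
    intro c₀ c j hj0 hj
    have hlen := (length_seqWord_familyStage m x y a c₀ c).2 q
    rw [mem_endDistances_formPerm (hL c₀ c) (hmem c₀ c) hj0 (by rwa [hlen]), hlen]
    have hex := exists_edgeLen_seqWord (hnd c₀ c) (hdis c₀ c)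
    constructor
    · rintro ⟨e, he⟩
      obtain ⟨i, hi, hℓ⟩ := (hex _).1 ⟨e, hmem c₀ c _, rfl⟩
      exact ⟨i, hi, _, hℓ, he⟩
    · rintro ⟨i, hi, ℓ, hℓ, he⟩
      obtain ⟨e, -, rfl⟩ := (hex _).2 ⟨i, hi, hℓ⟩
      exact ⟨e, he⟩
  have h4 : ∀ c₀ c, 4 ∈ endDistances (seqWord (familyStage m x y a c₀ c) (m + q)).formPerm ↔
      c₀ = true := by
    intro c₀ c
    rw [key c₀ c 4 (by omega) (by omega)]
    constructor
    · rintro ⟨i, hi, ℓ, hℓ, he⟩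
      rcases mem_lens_familyStage m x y a c₀ c hℓ with h | h | h | h | h
      · exact h.1
      all_goals omega
    · intro h
      exact ⟨0, by omega, 4, four_mem_lens_familyStage x y a hm h, .inl rfl⟩
  have h5 : ∀ c₀ c i, i < m →
      (8 * i + 5 ∈ endDistances (seqWord (familyStage m x y a c₀ c) (m + q)).formPerm ↔
      c i = true) := by
    intro c₀ c i hi
    rw [key c₀ c _ (by omega) (by omega)]
    constructor
    · rintro ⟨k, hk, ℓ, hℓ, he⟩
      rcases mem_lens_familyStage m x y a c₀ c hℓ with h | h | h | h | h
      · omega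
      · omega
      · omega
      · obtain rfl : k = i := by omega
        exact h.2.1
      · omega
    · intro h
      exact ⟨i, by omega, _, handle_mem_lens_familyStage x y a hi h, .inl rfl⟩
  have h1 : ∀ c₀ c i, m ≤ i → i < m + q → (8 * m + 4 * (i - m) + 1 ∈
      endDistances (seqWord (familyStage m x y a c₀ c) (m + q)).formPerm ↔ c i = true) := by
    intro c₀ c i hi hi'
    rw [key c₀ c _ (by omega) (by omega)]
    constructor
    · rintro ⟨k, hk, ℓ, hℓ, he⟩
      rcases mem_lens_familyStage m x y a c₀ c hℓ with h | h | h | h | h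
      · omega
      · omega
      · omega
      · omega
      · obtain rfl : k = i := by omega
        exact h.2.1
    · intro h
      exact ⟨i, by omega, _, puncture_mem_lens_familyStage x y a hi h, .inl rfl⟩
  refine ⟨?_, fun i hi => ?_⟩
  · rw [Bool.eq_iff_iff, ← h4 c₀ c, h, h4]
  · rw [Bool.eq_iff_iff]
    rcases Nat.lt_or_ge i m with hi' | hi'
    · rw [← h5 c₀ c i hi', h, h5 _ _ _ hi']
    · rw [← h1 c₀ c i hi' hi, h, h1 _ _ _ hi' hi]

end Decode

end

section

/-! ### The family on the standard surface -/

section Standard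

variable {g p m q : ℕ}

/-- The first loop of a handle of the standard rose. -/
def stdX (hg : 0 < g) : ℕ → StdEdge g p :=
  extendFin (fun k : Fin g => .inr (.inl k)) (.inr (.inl ⟨0, hg⟩))

/-- The second loop of a handle of the standard rose. -/
def stdY (hg : 0 < g) : ℕ → StdEdge g p :=
  extendFin (fun k : Fin g => .inr (.inr k)) (.inr (.inl ⟨0, hg⟩))

/-- The loop around a puncture in the standard rose. -/
def stdA (hg : 0 < g) : ℕ → StdEdge g p :=
  extendFin (fun j : Fin (p - 1) => .inl j) (.inr (.inl ⟨0, hg⟩))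

theorem blockWord_std (hg : 0 < g) :
    blockWord ((List.range (p - 1)).map (fun i => Block.puncture (stdA (p := p) hg i)) ++
      (List.range g).map fun i => .handle (stdX hg i) (stdY hg i)) = stdList g p := by
  have h1 : (List.range g).map (fun i => Block.handle (stdX (p := p) hg i) (stdY hg i)) =
      (List.finRange g).map fun k => .handle (.inr (.inl k)) (.inr (.inr k)) := by
    rw [← List.map_coe_finRange_eq_range, List.map_map]
    refine List.map_congr_left fun k _ => ?_
    simp [stdX, stdY, extendFin]
  rw [h1, blockWord, List.flatMap_append]
  unfold stdA
  rw [map_range_extendFin, List.flatMap_map, List.flatMap_map]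
  rfl

/-- The word of the family with given bits. -/
def familyWord (hg : 0 < g) (m q : ℕ) (c₀ : Bool) (c : ℕ → Bool) : List (StdEdge g p × Bool) :=
  seqWord (familyStage m (stdX hg) (stdY hg) (stdA hg) c₀ c) (m + q)

/-- All words of the family can be slid to the word of the standard surface. -/
theorem slideEq_familyWord (hg : 0 < g) (hm : g = 2 * m) (hq : p - 1 = 2 * q) (c₀ : Bool)
    (c : ℕ → Bool) : SlideEq (familyWord (p := p) hg m q c₀ c) (stdList g p) := by
  have h1 := slideEq_stageWord
    ((List.range (m + q)).map (familyStage m (stdX (p := p) hg) (stdY hg) (stdA hg) c₀ c)) []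
  rw [flatMap_blocks_familyStage, List.append_nil, ← hm, ← hq] at h1
  refine h1.trans ?_
  rw [← blockWord_std hg, ← List.append_nil (blockWord (_ ++ List.map _ (List.range g)))]
  exact SlideEq.append_right_blockWord List.perm_append_comm []

theorem stdX_of_lt (hg : 0 < g) {i : ℕ} (hi : i < g) :
    stdX (p := p) hg i = .inr (.inl ⟨i, hi⟩) := extendFin_of_lt _ _ hi

theorem stdY_of_lt (hg : 0 < g) {i : ℕ} (hi : i < g) :
    stdY (p := p) hg i = .inr (.inr ⟨i, hi⟩) := extendFin_of_lt _ _ hi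

theorem stdA_of_lt (hg : 0 < g) {i : ℕ} (hi : i < p - 1) :
    stdA (p := p) hg i = .inl ⟨i, hi⟩ := extendFin_of_lt _ _ hi

theorem edges_std_handle (hg : 0 < g) (hm : g = 2 * m) {c₀ : Bool} {c : ℕ → Bool} {i : ℕ}
    (hi : i < m) : (familyStage m (stdX (p := p) hg) (stdY hg) (stdA hg) c₀ c i).edges =
      [.inr (.inl ⟨2 * i, by omega⟩), .inr (.inr ⟨2 * i, by omega⟩),
        .inr (.inl ⟨2 * i + 1, by omega⟩), .inr (.inr ⟨2 * i + 1, by omega⟩)] := by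
  rw [edges_familyStage _ _ _ _ _ hi, stdX_of_lt, stdX_of_lt, stdY_of_lt, stdY_of_lt]

theorem edges_std_puncture (hg : 0 < g) (hq : p - 1 = 2 * q) {c₀ : Bool} {c : ℕ → Bool} {k : ℕ}
    (hk : k < q) : (familyStage m (stdX (p := p) hg) (stdY hg) (stdA hg) c₀ c (m + k)).edges =
      [.inl ⟨2 * k, by omega⟩, .inl ⟨2 * k + 1, by omega⟩] := by
  rw [familyStage_add, Stage.edges, stdA_of_lt, stdA_of_lt]

theorem nodup_edges_std (hg : 0 < g) (hm : g = 2 * m) (hq : p - 1 = 2 * q) (c₀ : Bool)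
    (c : ℕ → Bool) (i : ℕ) (hi : i < m + q) :
    (familyStage m (stdX (p := p) hg) (stdY hg) (stdA hg) c₀ c i).edges.Nodup := by
  rcases Nat.lt_or_ge i m with h | h
  · rw [edges_std_handle hg hm h]
    simp
  · obtain ⟨k, rfl⟩ := Nat.exists_eq_add_of_le h
    rw [edges_std_puncture hg hq (by omega)]
    simp

theorem disjoint_edges_std (hg : 0 < g) (hm : g = 2 * m) (hq : p - 1 = 2 * q) (c₀ : Bool)
    (c : ℕ → Bool) (i j : ℕ) (hij : i < j) (hj : j < m + q) (e : StdEdge g p)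
    (he : e ∈ (familyStage m (stdX hg) (stdY hg) (stdA hg) c₀ c i).edges) :
    e ∉ (familyStage m (stdX hg) (stdY hg) (stdA hg) c₀ c j).edges := by
  rcases Nat.lt_or_ge j m with h | h
  · rw [edges_std_handle hg hm (by omega)] at he ⊢
    rcases e with e | e | e <;> simp [Fin.ext_iff] at he ⊢ <;> omega
  · obtain ⟨k, rfl⟩ := Nat.exists_eq_add_of_le h
    rw [edges_std_puncture hg hq (by omega)]
    rcases Nat.lt_or_ge i m with h' | h'
    · rw [edges_std_handle hg hm h'] at he
      rcases e with e | e | e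
      · simp at he
      · simp
      · simp
    · obtain ⟨k', rfl⟩ := Nat.exists_eq_add_of_le h'
      rw [edges_std_puncture hg hq (by omega)] at he
      rcases e with e | e | e
      · simp [Fin.ext_iff] at he ⊢
        omega
      · simp
      · simp

theorem nodup_familyWord (hg : 0 < g) (hm : g = 2 * m) (hq : p - 1 = 2 * q) (c₀ : Bool)
    (c : ℕ → Bool) : (familyWord (p := p) hg m q c₀ c).Nodup :=
  (slideEq_familyWord hg hm hq c₀ c).perm.nodup_iff.2 (nodup_stdList g p)

theorem mem_familyWord (hg : 0 < g) (hm : g = 2 * m) (hq : p - 1 = 2 * q) (c₀ : Bool)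
    (c : ℕ → Bool) (d : StdEdge g p × Bool) : d ∈ familyWord hg m q c₀ c :=
  (slideEq_familyWord hg hm hq c₀ c).perm.mem_iff.2 (mem_stdList d)

/-- The ribbon structure of the standard rose with given bits. -/
def familyRibbon (hg : 0 < g) (hm : g = 2 * m) (hq : p - 1 = 2 * q)
    (c : Bool × (Fin (m + q) → Bool)) :
    (Graph.rose (StdEdge g p)).Ribbon :=
  listRibbon (familyWord hg m q c.1 (extendFin c.2 false)) (nodup_familyWord hg hm hq _ _)
    (mem_familyWord hg hm hq _ _)

/-- All ribbon structures of the family have the given surface as their ribbon surface. -/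
theorem exists_isOriented_familyRibbon (hg : 0 < g) (hm : g = 2 * m) (hq : p - 1 = 2 * q)
    {S : OrientedSpace} (hS : IsSurface g p S) (c : Bool × (Fin (m + q) → Bool)) :
    ∃ h, IsOriented ((Graph.rose (StdEdge g p)).ribbonSurface (familyRibbon hg hm hq c)) S h := by
  obtain ⟨h, hh⟩ := hS
  obtain ⟨k, hk⟩ := (slideEq_familyWord hg hm hq c.1 (extendFin c.2 false)).exists_homeo
    (nodup_familyWord hg hm hq _ _) (mem_familyWord hg hm hq _ _) (nodup_stdList g p) mem_stdList
  exact ⟨_, hk.trans hh.symm⟩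

/-- The bits can be recovered from the set of end distances. -/
theorem endDistances_familyRibbon_injective (hg : 0 < g) (hm : g = 2 * m) (hq : p - 1 = 2 * q) :
    Function.Injective fun c : Bool × (Fin (m + q) → Bool) =>
      endDistances (succPerm (familyRibbon (p := p) hg hm hq c)) := by
  rintro ⟨c₀, c⟩ ⟨c₀', c'⟩ h
  obtain ⟨h1, h2⟩ := familyStage_bits (by omega) (nodup_edges_std hg hm hq)
    (disjoint_edges_std hg hm hq) (nodup_familyWord hg hm hq) (mem_familyWord hg hm hq) h
  refine Prod.ext h1 (funext fun i => ?_)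
  have := h2 i i.2
  rwa [extendFin_of_lt _ _ i.2, extendFin_of_lt _ _ i.2] at this

end Standard

end

end RibbonComplex

end

theorem mainTheorem2 (g p : ℕ) (hg : 2 ≤ g) (hg_even : Even g) (hp : 1 ≤ p) (hp_odd : Odd p)
    (S : RibbonComplex.OrientedSpace) (hS : RibbonComplex.IsSurface g p S)
    (ψ : RibbonComplex.R (2 * g + p - 1) ≅ S.space) :
    ((2 ^ ((p - 1) / 2 + g / 2 + 1) : ℕ) : ℕ∞) ≤
      ENat.card (RibbonComplex.QuotientVertex S ψ 2) := by
  obtain ⟨m, hm⟩ := hg_even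
  obtain ⟨q, hq⟩ := hp_odd
  have hg0 : 0 < g := by omega
  have hm' : g = 2 * m := by omega
  have hq' : p - 1 = 2 * q := by omega
  have : Nonempty (RibbonComplex.StdEdge g p) := ⟨.inr (.inl ⟨0, hg0⟩)⟩
  have hE : 1 < Fintype.card (RibbonComplex.StdEdge g p) := by
    simp only [Fintype.card_sum, Fintype.card_fin]
    omega
  have h := RibbonComplex.card_le_card_quotientVertex ψ hE
    (RibbonComplex.familyRibbon hg0 hm' hq')
    (RibbonComplex.exists_isOriented_familyRibbon hg0 hm' hq' hS)
    (RibbonComplex.endDistances_familyRibbon_injective hg0 hm' hq')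
  refine le_trans (le_of_eq ?_) h
  rw [Fintype.card_prod, Fintype.card_bool, Fintype.card_fun, Fintype.card_fin, Fintype.card_bool,
    hq', hm', Nat.mul_div_cancel_left _ two_pos, Nat.mul_div_cancel_left _ two_pos]
  congr 1
  ring
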